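/- **Theorem (Reflection positivity in planes and spheres).** Let $N\ge 1$ be an integer and let $\lambda$ satisfy $0\le\lambda<1$ if $N=1$ and $N-2\le\lambda<N$ if $N\ge 2$. Let $B\subset\mathbb R^N$ be either an open ball $\{x: |x-a|<r\}$ with $a\in\mathbb R^N$, $r>0$, or an open half-space $\{x: x\cdot e>t\}$ with $|e|=1$, $t\in\mathbb R$. For a function $f$ on $\mathbb R^N$ put $$ (\Theta_B f)(x)=\Big(\frac{r}{|x-a|}\Big)^{2N-\lambda} f\Big(\frac{r^2(x-a)}{|x-a|^2}+a\Big)\quad\text{if $B$ is a ball},\qquad (\Theta_B f)(x)=f\big(x+2(t-x\cdot e)e\big)\quad\text{if $B$ is a half-space}, $$ and $$ f^i=\begin{cases} f&\text{on }B,\\ \Theta_B f&\text{on }\mathbb R^N\setminus B,\end{cases}\qquad f^o=\begin{cases}\Theta_B f&\text{on }B,\\ f&\text{on }\mathbb R^N\setminus B.\end{cases} $$ (a) Let $\lambda>0$, and let $f\in L^{2N/(2N-\lambda)}(\mathbb R^N)$ be complex-valued. For $g\in\{f,f^i,f^o\}$ the integral $$ I_\lambda[g]=\iint_{\mathbb R^N\times\mathbb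 R^N}\frac{\overline{g(x)}\,g(y)}{|x-y|^{\lambda}}\,dx\,dy $$ converges absolutely and is real, and $$ \tfrac12\big(I_\lambda[f^i]+I_\lambda[f^o]\big)\ \ge\ I_\lambda[f]. $$ If $\lambda>N-2$, this inequality is strict unless $f=\Theta_B f$ almost everywhere. (b) Let $\lambda=0$ (so $N\in\{1,2\}$), and let $f\in L^1(\mathbb R^N)$ be non-negative with $$ \int f(x)\,\log_+\!\Big(f(x)\big(\tfrac{1+|x|^2}{2}\big)^N\Big)\,dx<\infty ,\qquad \int_B f\,dx=\int_{\mathbb R^N\setminus B}f\,dx , $$ and, if $B$ is a ball, $\int_{\mathbb R^N} f\,dx=1$. For $g\in\{f,f^i,f^o\}$ both integrals in $$ J[g]=\iint_{\mathbb R^N\times\mathbb R^N} g(x)\log\frac1{|x-y|}\,g(y)\,dx\,dy-\frac1N\int_{\mathbb R^N} g\log g\,dx $$ converge absolutely, and $$ \tfrac12\big(J[f^i]+J[f^o]\big)\ \ge\ J[f]. $$ If $0>N-2$ (that is, $N=1$), this inequality is strict unless $f=\Theta_B f$ almost everywhere. -/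

import Mathlib

open MeasureTheory

noncomputable section

namespace ReflPos

/-- Either an open ball `{x | |x - a| < r}` with `r > 0`, or an open half-space
`{x | x · e > t}` with `|e| = 1`, in `ℝ^N`. -/
inductive BallOrHalfSpace (N : ℕ) : Type
  | ball (a : EuclideanSpace ℝ (Fin N)) (r : ℝ) (hr : 0 < r) : BallOrHalfSpace N
  | halfSpace (e : EuclideanSpace ℝ (Fin N)) (t : ℝ) (he : ‖e‖ = 1) : BallOrHalfSpace N

namespace BallOrHalfSpace

/-- `B` is a ball (as opposed to a half-space). -/
def IsBall {N : ℕ} : BallOrHalfSpace N → Prop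
  | ball _ _ _ => True
  | halfSpace _ _ _ => False

/-- The underlying set of points. -/
def carrier {N : ℕ} : BallOrHalfSpace N → Set (EuclideanSpace ℝ (Fin N))
  | ball a r _ => Metric.ball a r
  | halfSpace e t _ => {x | t < inner ℝ x e}

/-- The point map `Θ_B`: the inversion `x ↦ r² (x - a) / |x - a|² + a` for a ball, and the
reflection `x ↦ x + 2 (t - x · e) e` on the bounding hyperplane for a half-space. -/
def reflect {N : ℕ} : BallOrHalfSpace N → EuclideanSpace ℝ (Fin N) → EuclideanSpace ℝ (Fin N)
  | ball a r _, x => (r ^ 2 / ‖x - a‖ ^ 2) • (x - a) + a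
  | halfSpace e t _, x => x + (2 * (t - inner ℝ x e)) • e

/-- The weight of the operator `Θ_B`: `(r / |x - a|)^(2N - lam)` for a ball, `1` for a half-space. -/
def weight {N : ℕ} (lam : ℝ) : BallOrHalfSpace N → EuclideanSpace ℝ (Fin N) → ℝ
  | ball a r _, x => (r / ‖x - a‖) ^ (2 * (N : ℝ) - lam)
  | halfSpace _ _ _, _ => 1

/-- The operator `Θ_B` (depending on `lam`) acting on real- or complex-valued functions. -/
def theta {N : ℕ} (lam : ℝ) (B : BallOrHalfSpace N) {V : Type*} [SMul ℝ V]
    (f : EuclideanSpace ℝ (Fin N) → V) : EuclideanSpace ℝ (Fin N) → V :=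
  fun x => B.weight lam x • f (B.reflect x)

open Classical in
/-- `f^i`: equal to `f` on `B` and to `Θ_B f` off `B`. -/
def inner_part {N : ℕ} (lam : ℝ) (B : BallOrHalfSpace N) {V : Type*} [SMul ℝ V]
    (f : EuclideanSpace ℝ (Fin N) → V) : EuclideanSpace ℝ (Fin N) → V :=
  fun x => if x ∈ B.carrier then f x else B.theta lam f x

open Classical in
/-- `f^o`: equal to `Θ_B f` on `B` and to `f` off `B`. -/
def outer_part {N : ℕ} (lam : ℝ) (B : BallOrHalfSpace N) {V : Type*} [SMul ℝ V]
    (f : EuclideanSpace ℝ (Fin N) → V) : EuclideanSpace ℝ (Fin N) → V :=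
  fun x => if x ∈ B.carrier then B.theta lam f x else f x

end BallOrHalfSpace

/-- The integrand `conj f(x) · g(y) / |x - y|^lam` on `ℝ^N × ℝ^N`. -/
def rieszIntegrand {N : ℕ} (lam : ℝ) (f g : EuclideanSpace ℝ (Fin N) → ℂ)
    (p : EuclideanSpace ℝ (Fin N) × EuclideanSpace ℝ (Fin N)) : ℂ :=
  starRingEnd ℂ (f p.1) * g p.2 / ((‖p.1 - p.2‖ ^ lam : ℝ) : ℂ)

/-- `I_lam[f, g]`. -/
def rieszForm {N : ℕ} (lam : ℝ) (f g : EuclideanSpace ℝ (Fin N) → ℂ) : ℂ :=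
  ∫ p, rieszIntegrand lam f g p

/-- `I_lam[f] = I_lam[f, f]`. -/
def rieszEnergy {N : ℕ} (lam : ℝ) (f : EuclideanSpace ℝ (Fin N) → ℂ) : ℂ :=
  rieszForm lam f f

/-- The integrand `f(x) log (1 / |x - y|) g(y)` on `ℝ^N × ℝ^N`. -/
def logIntegrand {N : ℕ} (f g : EuclideanSpace ℝ (Fin N) → ℝ)
    (p : EuclideanSpace ℝ (Fin N) × EuclideanSpace ℝ (Fin N)) : ℝ :=
  f p.1 * Real.log (1 / ‖p.1 - p.2‖) * g p.2

/-- `J[f, g]` for real-valued functions. -/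
def logForm {N : ℕ} (f g : EuclideanSpace ℝ (Fin N) → ℝ) : ℝ :=
  (∫ p, logIntegrand f g p)
    - 1 / (2 * (N : ℝ)) * (∫ x, f x * Real.log (f x))
    - 1 / (2 * (N : ℝ)) * (∫ x, g x * Real.log (g x))

/-- `J[f] = J[f, f]`. -/
def logEnergy {N : ℕ} (f : EuclideanSpace ℝ (Fin N) → ℝ) : ℝ :=
  logForm f f

end ReflPos

end

/-!
All integrals over `ℝ^N` are rewritten on `B`: let `R` be the point map of `B`, which exchanges `B`
and its complement, and let `u = f` and `w = Θ f` on `B`, so that `w` encodes `f` off `B`. The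
conformal identity `|x - R y|² = scale(y)² Q(x, y)`, with `Q(x, y) = |x - y|² + ρ(x) ρ(y)` and a
function `ρ` which is positive exactly on `B`, shows that interactions inside `B` and inside its
complement both become the Riesz form on `B`, while interactions across the boundary become the form
`K` with kernel `Q^(-λ/2)`. As `f^i` corresponds to the pair `(u, u)` and `f^o` to `(w, w)`,
the difference of the two sides of the inequality is `K[u - w, u - w]`. In the logarithmic
case the kernel of `K` is `-(1/2) log Q`; the logarithms of the scale produced by the energy and by
the entropy cancel for a half-space trivially, and for a ball because the total mass is one. The
condition of equal masses says that `u - w` has mean zero on `B`. See `rieszReal_gain` and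
`LogClass.gain`.

*Positivity of `K`.* For a half-space and `λ > N - 2`, `Q(x, y)^(-λ/2)` is the inner product of two
features: Fourier transform along the hyperplane, and a superposition with positive density of
Laplace exponentials in the normal direction (`feature_reproducing`). Inversion about a boundary point
carries this over to balls (`hasFeature`). The case `λ = N - 2` follows in the limit, the logarithm
by differentiation at `λ = 0` on densities of mean zero, and general densities by truncation
(`reflectedRiesz_nonneg`, `reflectedLog_nonneg`).

*Absolute convergence.* For the Riesz energy of `f ∈ L^(2N/(2N-λ))` an elementary pointwise bound
replaces the Hardy–Littlewood–Sobolev inequality (`hls_pointwise`); on `B × B` one has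
`Q(x, y) ≥ |x - y|²`, so the energies of `f^i` and `f^o` are finite too. In the logarithmic case
Young's inequality bounds the energy by entropies and logarithmic moments, and the class of functions
of finite entropy is invariant under the passage from `f` to `f^i` and `f^o`.

*Strictness.* If `K[h, h] = 0`, then positivity of `K` makes the potential of `h` constant on a small
ball in `B`. Up to a translation this potential is `∫ g(y) |x - q(y)|^(-λ) dy` with `q(y)` outside a
larger ball. Applying the Laplacian again and again, all integrals `∫ g |x - q|^(-λ-2k)` with `k ≥ 1`
vanish, the constant factors being nonzero because `λ > N - 2`. By Weierstrass approximation in the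
variable `|x - q|^(-2)` the integrals of `g` against Gaussians centred near the origin vanish, and by
the Stone–Weierstrass theorem so does `g` (`ae_eq_zero_of_potential_const`).
-/

/-! ### Geometry of the reflection -/

namespace ReflPos.BallOrHalfSpace

variable {N : ℕ}

/-- The local scaling factor of the reflection: `r / |x - a|` for a ball, `1` for a half-space. At the
centre of a ball it is `r / 0 = 0`, so `0 < B.scale x` says that `x` is a point at which the
reflection is genuinely defined; this is the hypothesis of most lemmas below. -/
noncomputable def scale : BallOrHalfSpace N → EuclideanSpace ℝ (Fin N) → ℝ
  | ball a r _, x => r / ‖x - a‖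
  | halfSpace _ _ _, _ => 1

/-- A function which is positive exactly on `B` and vanishes on its boundary, normalized so that
`|x - Θ y|² = (scale y)² (|x - y|² + ρ(x) ρ(y))` for the point map `Θ` of `B`. -/
noncomputable def rho : BallOrHalfSpace N → EuclideanSpace ℝ (Fin N) → ℝ
  | ball a r _, x => (r ^ 2 - ‖x - a‖ ^ 2) / r
  | halfSpace e t _, x => 2 * (inner ℝ x e - t)

/-- The square of the distance from `x` to the reflection of `y`, with the conformal factor
`(scale y)²` removed. Unlike that distance it is symmetric. -/
noncomputable def Q (B : BallOrHalfSpace N) (x y : EuclideanSpace ℝ (Fin N)) : ℝ :=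
  ‖x - y‖ ^ 2 + B.rho x * B.rho y

theorem Q_comm (B : BallOrHalfSpace N) (x y : EuclideanSpace ℝ (Fin N)) :
    B.Q x y = B.Q y x := by
  rw [Q, Q, norm_sub_rev, mul_comm]

theorem mem_carrier_iff (B : BallOrHalfSpace N) (x : EuclideanSpace ℝ (Fin N)) :
    x ∈ B.carrier ↔ 0 < B.rho x := by
  cases B with
  | ball a r hr =>
    simp only [carrier, rho, Metric.mem_ball, dist_eq_norm]
    rw [div_pos_iff_of_pos_right hr, sub_pos, sq_lt_sq₀ (norm_nonneg _) hr.le]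
  | halfSpace e t he =>
    simp [carrier, rho]

theorem scale_nonneg (B : BallOrHalfSpace N) (x : EuclideanSpace ℝ (Fin N)) :
    0 ≤ B.scale x := by
  cases B with
  | ball a r hr => exact div_nonneg hr.le (norm_nonneg _)
  | halfSpace e t he => exact zero_le_one

theorem weight_eq (lam : ℝ) (B : BallOrHalfSpace N) (x : EuclideanSpace ℝ (Fin N)) :
    B.weight lam x = B.scale x ^ (2 * (N : ℝ) - lam) := by
  cases B with
  | ball a r hr => rfl
  | halfSpace e t he => simp [weight, scale]

theorem continuous_rho (B : BallOrHalfSpace N) : Continuous B.rho := by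
  cases B with
  | ball a r hr => unfold rho; fun_prop
  | halfSpace e t he => unfold rho; fun_prop

theorem measurable_scale (B : BallOrHalfSpace N) : Measurable B.scale := by
  cases B with
  | ball a r hr => unfold scale; fun_prop
  | halfSpace e t he => unfold scale; fun_prop

theorem measurable_reflect (B : BallOrHalfSpace N) : Measurable B.reflect := by
  cases B with
  | ball a r hr => unfold reflect; fun_prop
  | halfSpace e t he => unfold reflect; fun_prop

theorem isOpen_carrier (B : BallOrHalfSpace N) : IsOpen B.carrier := by
  have : B.carrier = B.rho ⁻¹' Set.Ioi 0 := by ext x; simp [mem_carrier_iff]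
  rw [this]; exact isOpen_Ioi.preimage B.continuous_rho

theorem continuous_Q (B : BallOrHalfSpace N) :
    Continuous fun p : EuclideanSpace ℝ (Fin N) × EuclideanSpace ℝ (Fin N) => B.Q p.1 p.2 := by
  have := B.continuous_rho
  unfold Q; fun_prop

theorem scale_pos_ball {a x : EuclideanSpace ℝ (Fin N)} {r : ℝ} {hr : 0 < r}
    (h : 0 < (ball a r hr).scale x) : 0 < ‖x - a‖ := by
  simp only [scale] at h
  exact (div_pos_iff_of_pos_left hr).1 h

theorem scale_mul_scale_reflect (B : BallOrHalfSpace N) {x : EuclideanSpace ℝ (Fin N)}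
    (h : 0 < B.scale x) : B.scale x * B.scale (B.reflect x) = 1 := by
  cases B with
  | ball a r hr =>
    have h1 := scale_pos_ball h
    simp only [scale, reflect, add_sub_cancel_right, norm_smul, norm_div, norm_pow, abs_norm,
      Real.norm_eq_abs, abs_of_pos hr]
    field_simp
  | halfSpace e t he => simp [scale]

theorem scale_reflect_pos (B : BallOrHalfSpace N) {x : EuclideanSpace ℝ (Fin N)}
    (h : 0 < B.scale x) : 0 < B.scale (B.reflect x) := by
  have := B.scale_mul_scale_reflect h
  exact (pos_iff_pos_of_mul_pos (by rw [this]; exact one_pos)).1 h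

theorem scale_reflect (B : BallOrHalfSpace N) {x : EuclideanSpace ℝ (Fin N)}
    (h : 0 < B.scale x) : B.scale (B.reflect x) = (B.scale x)⁻¹ :=
  eq_inv_of_mul_eq_one_right (B.scale_mul_scale_reflect h)

theorem reflect_reflect (B : BallOrHalfSpace N) {x : EuclideanSpace ℝ (Fin N)}
    (h : 0 < B.scale x) : B.reflect (B.reflect x) = x := by
  cases B with
  | ball a r hr =>
    have h1 := scale_pos_ball h
    simp only [reflect, add_sub_cancel_right, norm_smul, norm_div, norm_pow, abs_norm,
      Real.norm_eq_abs, abs_of_pos hr, smul_smul]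
    have : r ^ 2 / (r ^ 2 / ‖x - a‖ ^ 2 * ‖x - a‖) ^ 2 * (r ^ 2 / ‖x - a‖ ^ 2) = 1 := by
      field_simp
    rw [this]; simp
  | halfSpace e t he =>
    simp only [reflect, inner_add_left, inner_smul_left, real_inner_self_eq_norm_sq, he]
    rw [add_assoc, ← add_smul]
    simp
    left; ring

theorem rho_reflect (B : BallOrHalfSpace N) {x : EuclideanSpace ℝ (Fin N)}
    (h : 0 < B.scale x) : B.rho (B.reflect x) = -(B.scale x ^ 2 * B.rho x) := by
  cases B with
  | ball a r hr =>
    have h1 := scale_pos_ball h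
    simp only [rho, scale, reflect, add_sub_cancel_right, norm_smul, norm_div, norm_pow, abs_norm,
      Real.norm_eq_abs, abs_of_pos hr]
    field_simp
    ring
  | halfSpace e t he =>
    simp only [rho, scale, reflect, inner_add_left, inner_smul_left, real_inner_self_eq_norm_sq, he]
    simp
    ring

/-- The conformal identity behind the whole argument: it turns interactions across the boundary of `B`
into interactions on `B` with a symmetric kernel. -/
theorem norm_sub_reflect_sq (B : BallOrHalfSpace N) (x : EuclideanSpace ℝ (Fin N))
    {y : EuclideanSpace ℝ (Fin N)} (h : 0 < B.scale y) :
    ‖x - B.reflect y‖ ^ 2 = B.scale y ^ 2 * B.Q x y := by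
  cases B with
  | ball a r hr =>
    have h1 := scale_pos_ball h
    have e1 : x - (ball a r hr).reflect y = (x - a) - (r ^ 2 / ‖y - a‖ ^ 2) • (y - a) := by
      simp only [reflect]; abel
    have e2 : x - y = (x - a) - (y - a) := by abel
    rw [e1, Q, e2]
    simp only [scale, rho, norm_sub_sq_real (x - a), inner_smul_right, norm_smul, norm_div,
      norm_pow, abs_norm, Real.norm_eq_abs, abs_of_pos hr]
    field_simp
    ring
  | halfSpace e t he =>
    have e1 : x - (halfSpace e t he).reflect y = (x - y) - (2 * (t - inner ℝ y e)) • e := by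
      simp only [reflect]; abel
    rw [e1, Q, norm_sub_sq_real (x - y)]
    simp only [scale, rho, inner_smul_right, norm_smul, mul_pow, Real.norm_eq_abs, sq_abs, he,
      inner_sub_left]
    ring

theorem norm_reflect_sub_reflect (B : BallOrHalfSpace N) {x y : EuclideanSpace ℝ (Fin N)}
    (hx : 0 < B.scale x) (hy : 0 < B.scale y) :
    ‖B.reflect x - B.reflect y‖ = B.scale x * B.scale y * ‖x - y‖ := by
  have h0 := mul_nonneg (mul_nonneg (B.scale_nonneg x) (B.scale_nonneg y)) (norm_nonneg (x - y))
  rw [← sq_eq_sq₀ (norm_nonneg _) h0, B.norm_sub_reflect_sq _ hy, Q, B.rho_reflect hx,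
    norm_sub_rev, B.norm_sub_reflect_sq y hx, Q, norm_sub_rev]
  ring

/-- The reflection is conformal, so its derivative is `scale²` times a linear isometry; only the
absolute value of its determinant is needed. -/
theorem hasFDerivAt_reflect (B : BallOrHalfSpace N) {x : EuclideanSpace ℝ (Fin N)}
    (h : 0 < B.scale x) :
    ∃ L : EuclideanSpace ℝ (Fin N) →L[ℝ] EuclideanSpace ℝ (Fin N),
      HasFDerivAt B.reflect L x ∧ |L.det| = B.scale x ^ (2 * N) := by
  have key : ∀ (K : Submodule ℝ (EuclideanSpace ℝ (Fin N))),
      |(K.reflection : EuclideanSpace ℝ (Fin N) →L[ℝ] EuclideanSpace ℝ (Fin N)).det| = 1 := by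
    intro K
    have h2 : (K.reflection : EuclideanSpace ℝ (Fin N) →L[ℝ] EuclideanSpace ℝ (Fin N)).toLinearMap *
        (K.reflection : EuclideanSpace ℝ (Fin N) →L[ℝ] EuclideanSpace ℝ (Fin N)).toLinearMap = 1 := by
      ext1 v
      exact Submodule.reflection_reflection K v
    have h3 := congrArg LinearMap.det h2
    rw [map_mul, map_one] at h3
    exact (pow_eq_one_iff_of_nonneg (abs_nonneg _) two_ne_zero).1 (by rw [sq_abs, sq]; exact h3)
  cases B with
  | ball a r hr =>
    have h1 := scale_pos_ball h
    have hx : x ≠ a := fun hh => by simp [hh] at h1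
    refine ⟨_, (EuclideanGeometry.hasFDerivAt_inversion (R := r) hx).congr_of_eventuallyEq
      (Filter.Eventually.of_forall fun z => ?_), ?_⟩
    · simp [reflect, EuclideanGeometry.inversion, dist_eq_norm, div_pow]
    · rw [ContinuousLinearMap.det, ContinuousLinearMap.toLinearMap_smul, LinearMap.det_smul,
        abs_mul]
      have := key (ℝ ∙ (x - a))ᗮ
      rw [ContinuousLinearMap.det] at this
      rw [this]
      simp only [finrank_euclideanSpace, Fintype.card_fin, scale, dist_eq_norm, mul_one]
      rw [abs_of_nonneg (by positivity), pow_mul]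
  | halfSpace e t he =>
    refine ⟨((ℝ ∙ e)ᗮ.reflection : EuclideanSpace ℝ (Fin N) →L[ℝ] _), ?_, ?_⟩
    · have e1 : (halfSpace e t he).reflect =
          fun y => ((ℝ ∙ e)ᗮ.reflection : EuclideanSpace ℝ (Fin N) →L[ℝ] _) y + (2 * t) • e := by
        ext1 y
        have := Submodule.reflection_orthogonal_apply (K := ℝ ∙ e) y
        simp only [reflect]
        erw [this]
        rw [Submodule.reflection_singleton_apply, real_inner_comm]
        simp only [he]
        module
      rw [e1]
      exact (ContinuousLinearMap.hasFDerivAt _).add_const _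
    · rw [key]; simp [scale]

end ReflPos.BallOrHalfSpace

/-! ### Change of variables: everything in terms of the data on `B` -/

namespace ReflPos.BallOrHalfSpace

variable {N : ℕ}

theorem ae_rho_ne_zero [NeZero N] (B : BallOrHalfSpace N) :
    ∀ᵐ x : EuclideanSpace ℝ (Fin N), B.rho x ≠ 0 := by
  have : Nontrivial (EuclideanSpace ℝ (Fin N)) := inferInstance
  cases B with
  | ball a r hr =>
    refine measure_mono_null ?_ (Measure.addHaar_sphere volume a r)
    intro x hx
    simp only [rho, Set.mem_compl_iff, Set.mem_ofPred_eq, not_not, div_eq_zero_iff, hr.ne',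
      or_false, sub_eq_zero] at hx
    rw [mem_sphere_iff_norm, (sq_eq_sq₀ hr.le (norm_nonneg _)).1 hx]
  | halfSpace e t he =>
    have h1 : volume (((ℝ ∙ e)ᗮ : Submodule ℝ (EuclideanSpace ℝ (Fin N))) :
        Set (EuclideanSpace ℝ (Fin N))) = 0 := by
      refine Measure.addHaar_submodule volume _ fun h => ?_
      have : e ∈ (ℝ ∙ e)ᗮ := by rw [h]; trivial
      rw [Submodule.mem_orthogonal_singleton_iff_inner_right, inner_self_eq_zero] at this
      simp [this] at he
    rw [← measure_preimage_add_right volume (-(t • e))] at h1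
    refine measure_mono_null ?_ h1
    intro x hx
    simp only [rho, Set.mem_compl_iff, Set.mem_ofPred_eq, not_not] at hx
    simp only [Set.mem_preimage, SetLike.mem_coe,
      Submodule.mem_orthogonal_singleton_iff_inner_right, inner_add_right, inner_neg_right,
      inner_smul_right, real_inner_self_eq_norm_sq, he]
    rw [real_inner_comm]; linarith

theorem ae_scale_pos [NeZero N] (B : BallOrHalfSpace N) :
    ∀ᵐ x : EuclideanSpace ℝ (Fin N), 0 < B.scale x := by
  have : Nontrivial (EuclideanSpace ℝ (Fin N)) := inferInstance
  cases B with
  | ball a r hr =>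
    filter_upwards [Measure.ae_ne volume a] with x hx
    exact div_pos hr (norm_pos_iff.2 (sub_ne_zero.2 hx))
  | halfSpace e t he => simp [scale]

/-- The Jacobian of the reflection. -/
noncomputable def jac (B : BallOrHalfSpace N) (x : EuclideanSpace ℝ (Fin N)) : ℝ :=
  B.scale x ^ (2 * N)

theorem jac_nonneg (B : BallOrHalfSpace N) (x : EuclideanSpace ℝ (Fin N)) : 0 ≤ B.jac x :=
  pow_nonneg (B.scale_nonneg x) _

theorem measurable_jac (B : BallOrHalfSpace N) : Measurable B.jac :=
  B.measurable_scale.pow_const _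

theorem measurableSet_carrier (B : BallOrHalfSpace N) : MeasurableSet B.carrier :=
  B.isOpen_carrier.measurableSet

/-- Lebesgue measure on `B`. -/
noncomputable def vol (B : BallOrHalfSpace N) : Measure (EuclideanSpace ℝ (Fin N)) :=
  volume.restrict B.carrier

instance (B : BallOrHalfSpace N) : SigmaFinite B.vol := by unfold vol; infer_instance

/-- Lebesgue measure on `B` weighted by the Jacobian, whose image under the reflection is Lebesgue
measure on the complement of `B`. -/
noncomputable def jacVol (B : BallOrHalfSpace N) : Measure (EuclideanSpace ℝ (Fin N)) :=
  B.vol.withDensity fun x => ENNReal.ofReal (B.jac x)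

instance (B : BallOrHalfSpace N) : SigmaFinite B.jacVol := by
  unfold jacVol; infer_instance

theorem ae_vol_scale_pos [NeZero N] (B : BallOrHalfSpace N) : ∀ᵐ x ∂B.vol, 0 < B.scale x :=
  ae_restrict_of_ae B.ae_scale_pos

theorem ae_vol_rho_pos (B : BallOrHalfSpace N) : ∀ᵐ x ∂B.vol, 0 < B.rho x := by
  filter_upwards [ae_restrict_mem B.measurableSet_carrier] with x hx
  exact (B.mem_carrier_iff x).1 hx

theorem ae_vol_jac_pos [NeZero N] (B : BallOrHalfSpace N) : ∀ᵐ x ∂B.vol, 0 < B.jac x := by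
  filter_upwards [B.ae_vol_scale_pos] with x hx
  exact pow_pos hx _

/-- The reflection exchanges `B` and its complement up to null sets: the boundary, where `ρ = 0`, and
the centre of a ball, where the scale vanishes. -/
theorem map_reflect_jacVol [NeZero N] (B : BallOrHalfSpace N) :
    B.jacVol.map B.reflect = volume.restrict B.carrierᶜ := by
  set S : Set (EuclideanSpace ℝ (Fin N)) := B.carrier ∩ {x | 0 < B.scale x} with hS
  have hSm : MeasurableSet S :=
    B.measurableSet_carrier.inter (measurableSet_lt measurable_const B.measurable_scale)
  choose! L hL hdet using fun (x : EuclideanSpace ℝ (Fin N)) (h : 0 < B.scale x) =>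
    B.hasFDerivAt_reflect h
  have h1 := map_withDensity_abs_det_fderiv_eq_addHaar volume hSm.nullMeasurableSet
    (f := B.reflect) (f' := L) (fun x hx => (hL x hx.2).hasFDerivWithinAt)
    (fun x hx y hy hxy => by
      rw [← B.reflect_reflect hx.2, hxy, B.reflect_reflect hy.2])
  have h2 : volume.restrict S = B.vol := by
    rw [vol, hS]
    refine Measure.restrict_congr_set ?_
    filter_upwards [B.ae_scale_pos] with x hx
    exact propext ⟨fun h => h.1, fun h => ⟨h, hx⟩⟩
  have h3 : (volume.restrict S).withDensity (fun x => ENNReal.ofReal |(L x).det|) = B.jacVol := by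
    rw [jacVol, ← h2]
    refine withDensity_congr_ae ?_
    filter_upwards [ae_restrict_mem hSm] with x hx
    rw [hdet x hx.2, jac]
  rw [h3] at h1
  rw [h1]
  refine Measure.restrict_congr_set ?_
  filter_upwards [B.ae_scale_pos, B.ae_rho_ne_zero] with x hx hr
  refine propext ⟨?_, fun h => ?_⟩
  · rintro ⟨y, hy, rfl⟩
    change ¬ _
    rw [mem_carrier_iff, B.rho_reflect hy.2, not_lt, neg_nonpos]
    exact mul_nonneg (sq_nonneg _) ((B.mem_carrier_iff y).1 hy.1).le
  · refine ⟨B.reflect x, ⟨?_, B.scale_reflect_pos hx⟩, B.reflect_reflect hx⟩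
    change ¬ _ at h
    rw [mem_carrier_iff, not_lt] at h
    rw [mem_carrier_iff, B.rho_reflect hx, ← mul_neg]
    exact mul_pos (pow_pos hx 2) (neg_pos.2 (lt_of_le_of_ne h hr))

theorem volume_eq [NeZero N] (B : BallOrHalfSpace N) :
    (volume : Measure (EuclideanSpace ℝ (Fin N))) = B.vol + B.jacVol.map B.reflect := by
  rw [map_reflect_jacVol, vol, Measure.restrict_add_restrict_compl B.measurableSet_carrier]

theorem vol_absolutelyContinuous_jacVol [NeZero N] (B : BallOrHalfSpace N) :
    B.vol ≪ B.jacVol := by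
  refine withDensity_absolutelyContinuous' B.measurable_jac.ennreal_ofReal.aemeasurable ?_
  filter_upwards [B.ae_vol_jac_pos] with x hx
  simpa using hx

theorem jacVol_absolutelyContinuous_vol (B : BallOrHalfSpace N) : B.jacVol ≪ B.vol :=
  withDensity_absolutelyContinuous _ _

theorem vol_absolutelyContinuous (B : BallOrHalfSpace N) : B.vol ≪ volume :=
  Measure.absolutelyContinuous_of_le Measure.restrict_le_self

theorem quasiMeasurePreserving_reflect_vol [NeZero N] (B : BallOrHalfSpace N) :
    Measure.QuasiMeasurePreserving B.reflect B.vol volume := by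
  refine ⟨B.measurable_reflect, ?_⟩
  refine (B.vol_absolutelyContinuous_jacVol.map B.measurable_reflect).trans ?_
  rw [map_reflect_jacVol]
  exact Measure.absolutelyContinuous_of_le Measure.restrict_le_self

theorem map_reflect_reflect_jacVol [NeZero N] (B : BallOrHalfSpace N) :
    (B.jacVol.map B.reflect).map B.reflect = B.jacVol := by
  rw [Measure.map_map B.measurable_reflect B.measurable_reflect]
  conv_rhs => rw [← Measure.map_id (μ := B.jacVol)]
  refine Measure.map_congr ?_
  filter_upwards [B.jacVol_absolutelyContinuous_vol.ae_le B.ae_vol_scale_pos] with x hx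
  exact B.reflect_reflect hx

/-- The reflection preserves null sets, so that it may be applied to functions defined almost
everywhere. -/
theorem quasiMeasurePreserving_reflect [NeZero N] (B : BallOrHalfSpace N) :
    Measure.QuasiMeasurePreserving B.reflect volume volume := by
  refine ⟨B.measurable_reflect, ?_⟩
  conv_lhs => rw [B.volume_eq]
  rw [Measure.map_add _ _ B.measurable_reflect, map_reflect_reflect_jacVol]
  refine Measure.AbsolutelyContinuous.add_left B.quasiMeasurePreserving_reflect_vol.2 ?_
  exact B.jacVol_absolutelyContinuous_vol.trans B.vol_absolutelyContinuous

theorem ae_iff_ae_vol [NeZero N] (B : BallOrHalfSpace N) {p : EuclideanSpace ℝ (Fin N) → Prop} :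
    (∀ᵐ x, p x) ↔ (∀ᵐ x ∂B.vol, p x) ∧ ∀ᵐ x ∂B.vol, p (B.reflect x) := by
  constructor
  · intro h
    exact ⟨B.vol_absolutelyContinuous.ae_le h, B.quasiMeasurePreserving_reflect_vol.ae h⟩
  · rintro ⟨h1, h2⟩
    have h3 : ∀ᵐ x ∂(B.jacVol.map B.reflect), p x := by
      have h4 : ∀ᵐ x ∂(B.jacVol.map B.reflect), p (B.reflect (B.reflect x)) := by
        have h5 : Measure.QuasiMeasurePreserving B.reflect (B.jacVol.map B.reflect) B.vol :=
          ⟨B.measurable_reflect, by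
            rw [map_reflect_reflect_jacVol]; exact B.jacVol_absolutelyContinuous_vol⟩
        exact h5.ae h2
      rw [map_reflect_jacVol] at h4 ⊢
      filter_upwards [h4, ae_restrict_of_ae B.ae_scale_pos] with x hx hs
      rwa [B.reflect_reflect hs] at hx
    rw [B.volume_eq]
    exact (ae_add_measure_iff).2 ⟨h1, h3⟩

section Integrals

variable {α : Type*} [MeasurableSpace α]

theorem integrable_withDensity_ofReal {μ : Measure α} {J : α → ℝ} (hJ : Measurable J)
    (hJ0 : ∀ x, 0 ≤ J x) {G : α → ℝ} :
    Integrable G (μ.withDensity fun x => ENNReal.ofReal (J x)) ↔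
      Integrable (fun x => J x * G x) μ := by
  rw [integrable_withDensity_iff_integrable_smul' hJ.ennreal_ofReal (by simp)]
  simp [ENNReal.toReal_ofReal (hJ0 _)]

theorem integral_withDensity_ofReal {μ : Measure α} {J : α → ℝ} (hJ : Measurable J)
    (hJ0 : ∀ x, 0 ≤ J x) (G : α → ℝ) :
    ∫ x, G x ∂(μ.withDensity fun x => ENNReal.ofReal (J x)) = ∫ x, J x * G x ∂μ := by
  rw [integral_withDensity_eq_integral_toReal_smul hJ.ennreal_ofReal (by simp)]
  simp [ENNReal.toReal_ofReal (hJ0 _)]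

end Integrals

theorem integrable_iff_vol [NeZero N] (B : BallOrHalfSpace N) {G : EuclideanSpace ℝ (Fin N) → ℝ}
    (hG : AEStronglyMeasurable G volume) :
    Integrable G ↔ Integrable G B.vol ∧ Integrable (fun x => B.jac x * G (B.reflect x)) B.vol := by
  have h1 : AEStronglyMeasurable G (B.jacVol.map B.reflect) := by
    rw [map_reflect_jacVol]; exact hG.restrict
  conv_lhs => rw [B.volume_eq]
  rw [integrable_add_measure, integrable_map_measure h1 B.measurable_reflect.aemeasurable, jacVol,
    integrable_withDensity_ofReal B.measurable_jac B.jac_nonneg]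
  rfl

theorem integral_eq_vol [NeZero N] (B : BallOrHalfSpace N) {G : EuclideanSpace ℝ (Fin N) → ℝ}
    (hG : Integrable G volume) :
    ∫ x, G x = ∫ x, G x ∂B.vol + ∫ x, B.jac x * G (B.reflect x) ∂B.vol := by
  have h1 : AEStronglyMeasurable G (B.jacVol.map B.reflect) := by
    rw [map_reflect_jacVol]; exact hG.1.restrict
  have hG' := hG
  rw [B.volume_eq, integrable_add_measure] at hG'
  conv_lhs => rw [B.volume_eq]
  rw [integral_add_measure hG'.1 hG'.2, integral_map B.measurable_reflect.aemeasurable h1, jacVol,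
    integral_withDensity_ofReal B.measurable_jac B.jac_nonneg]

theorem setIntegral_compl [NeZero N] (B : BallOrHalfSpace N) {G : EuclideanSpace ℝ (Fin N) → ℝ}
    (hG : AEStronglyMeasurable G volume) :
    ∫ x in B.carrierᶜ, G x = ∫ x, B.jac x * G (B.reflect x) ∂B.vol := by
  have h1 : AEStronglyMeasurable G (B.jacVol.map B.reflect) := by
    rw [map_reflect_jacVol]; exact hG.restrict
  rw [← map_reflect_jacVol, integral_map B.measurable_reflect.aemeasurable h1, jacVol,
    integral_withDensity_ofReal B.measurable_jac B.jac_nonneg]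

/-- Lebesgue measure on the product splits into the four blocks `B × B`, `B × Bᶜ`, `Bᶜ × B` and
`Bᶜ × Bᶜ`, each of them an image of `B × B`. -/
theorem volume_prod_eq [NeZero N] (B : BallOrHalfSpace N) :
    (volume : Measure (EuclideanSpace ℝ (Fin N) × EuclideanSpace ℝ (Fin N))) =
      (B.vol.prod B.vol +
        ((B.vol.prod B.vol).withDensity (fun p => ENNReal.ofReal (B.jac p.2))).map
          (fun p => (p.1, B.reflect p.2))) +
      (((B.vol.prod B.vol).withDensity (fun p => ENNReal.ofReal (B.jac p.1))).map
          (fun p => (B.reflect p.1, p.2)) +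
        ((B.vol.prod B.vol).withDensity (fun p => ENNReal.ofReal (B.jac p.1 * B.jac p.2))).map
          (fun p => (B.reflect p.1, B.reflect p.2))) := by
  have hR := B.measurable_reflect
  have hJ := B.measurable_jac.ennreal_ofReal
  have e1 : B.vol.prod (B.jacVol.map B.reflect) =
      ((B.vol.prod B.vol).withDensity (fun p => ENNReal.ofReal (B.jac p.2))).map
          (fun p => (p.1, B.reflect p.2)) := by
    rw [← prod_withDensity_right hJ]
    have := Measure.map_prod_map B.vol B.jacVol measurable_id hR
    rw [Measure.map_id] at this
    exact this
  have e2 : (B.jacVol.map B.reflect).prod B.vol =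
      ((B.vol.prod B.vol).withDensity (fun p => ENNReal.ofReal (B.jac p.1))).map
          (fun p => (B.reflect p.1, p.2)) := by
    rw [← prod_withDensity_left hJ]
    have := Measure.map_prod_map B.jacVol B.vol hR measurable_id
    rw [Measure.map_id] at this
    exact this
  have e3 : (B.jacVol.map B.reflect).prod (B.jacVol.map B.reflect) =
      ((B.vol.prod B.vol).withDensity (fun p => ENNReal.ofReal (B.jac p.1 * B.jac p.2))).map
          (fun p => (B.reflect p.1, B.reflect p.2)) := by
    simp_rw [ENNReal.ofReal_mul (B.jac_nonneg _)]
    rw [← prod_withDensity hJ hJ]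
    exact Measure.map_prod_map B.jacVol B.jacVol hR hR
  rw [← e1, ← e2, ← e3, Measure.volume_eq_prod, ← Measure.prod_add, ← Measure.prod_add,
    ← Measure.add_prod, ← B.volume_eq]

theorem integrable_prod_iff_vol [NeZero N] (B : BallOrHalfSpace N)
    {G : EuclideanSpace ℝ (Fin N) × EuclideanSpace ℝ (Fin N) → ℝ}
    (hG : AEStronglyMeasurable G volume) :
    Integrable G ↔
      (Integrable G (B.vol.prod B.vol) ∧
        Integrable (fun p => B.jac p.2 * G (p.1, B.reflect p.2)) (B.vol.prod B.vol)) ∧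
      (Integrable (fun p => B.jac p.1 * G (B.reflect p.1, p.2)) (B.vol.prod B.vol) ∧
        Integrable (fun p => B.jac p.1 * B.jac p.2 * G (B.reflect p.1, B.reflect p.2))
          (B.vol.prod B.vol)) := by
  have hR := B.measurable_reflect
  have hJ := B.measurable_jac
  have hG' := hG
  rw [B.volume_prod_eq, aestronglyMeasurable_add_measure_iff, aestronglyMeasurable_add_measure_iff,
    aestronglyMeasurable_add_measure_iff] at hG'
  obtain ⟨⟨-, h1⟩, h2, h3⟩ := hG'
  conv_lhs => rw [B.volume_prod_eq]
  rw [integrable_add_measure, integrable_add_measure, integrable_add_measure,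
    integrable_map_measure h1 (by fun_prop), integrable_map_measure h2 (by fun_prop),
    integrable_map_measure h3 (by fun_prop),
    integrable_withDensity_ofReal (by fun_prop) (fun _ => B.jac_nonneg _),
    integrable_withDensity_ofReal (by fun_prop) (fun _ => B.jac_nonneg _),
    integrable_withDensity_ofReal (by fun_prop)
      (fun _ => mul_nonneg (B.jac_nonneg _) (B.jac_nonneg _))]
  rfl

theorem integral_prod_eq_vol [NeZero N] (B : BallOrHalfSpace N)
    {G : EuclideanSpace ℝ (Fin N) × EuclideanSpace ℝ (Fin N) → ℝ}
    (hG : Integrable G volume) :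
    ∫ p, G p =
      (∫ p, G p ∂(B.vol.prod B.vol) +
        ∫ p, B.jac p.2 * G (p.1, B.reflect p.2) ∂(B.vol.prod B.vol)) +
      (∫ p, B.jac p.1 * G (B.reflect p.1, p.2) ∂(B.vol.prod B.vol) +
        ∫ p, B.jac p.1 * B.jac p.2 * G (B.reflect p.1, B.reflect p.2)
          ∂(B.vol.prod B.vol)) := by
  have hR := B.measurable_reflect
  have hJ := B.measurable_jac
  have hG' := hG
  rw [B.volume_prod_eq, integrable_add_measure, integrable_add_measure,
    integrable_add_measure] at hG'
  obtain ⟨⟨h0, h1⟩, h2, h3⟩ := hG'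
  conv_lhs => rw [B.volume_prod_eq]
  rw [integral_add_measure (h0.add_measure h1) (h2.add_measure h3), integral_add_measure h0 h1,
    integral_add_measure h2 h3,
    integral_map (by fun_prop) h1.1, integral_map (by fun_prop) h2.1,
    integral_map (by fun_prop) h3.1,
    integral_withDensity_ofReal (by fun_prop) (fun _ => B.jac_nonneg _),
    integral_withDensity_ofReal (by fun_prop) (fun _ => B.jac_nonneg _),
    integral_withDensity_ofReal (by fun_prop)
      (fun _ => mul_nonneg (B.jac_nonneg _) (B.jac_nonneg _))]

end ReflPos.BallOrHalfSpace

/-! ### The Hardy–Littlewood–Sobolev bound on the diagonal -/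

namespace ReflPos

variable {N : ℕ}

/-- The profile `|z|^(-λ)` near the origin, cut off to `|z|^(-2N)` at infinity. It is integrable for
`λ < N`. -/
noncomputable def hlsProfile (N : ℕ) (lam : ℝ) (z : EuclideanSpace ℝ (Fin N)) : ℝ :=
  if ‖z‖ < 1 then ‖z‖ ^ (-lam) else ‖z‖ ^ (-(2 * (N : ℝ)))

theorem hlsProfile_nonneg (lam : ℝ) (z : EuclideanSpace ℝ (Fin N)) : 0 ≤ hlsProfile N lam z := by
  unfold hlsProfile; split_ifs <;> positivity

theorem measurable_hlsProfile (lam : ℝ) : Measurable (hlsProfile N lam) := by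
  unfold hlsProfile
  exact Measurable.ite (measurableSet_lt measurable_norm measurable_const) (by fun_prop)
    (by fun_prop)

theorem integrable_hlsProfile [NeZero N] {lam : ℝ} (hlam : lam < N) :
    Integrable (hlsProfile N lam) := by
  have hN : 1 ≤ N := NeZero.one_le
  have hN' : (1 : ℝ) ≤ N := by exact_mod_cast hN
  rw [← integrableOn_univ, ← Set.union_compl_self (Metric.ball (0 : EuclideanSpace ℝ (Fin N)) 1)]
  refine IntegrableOn.union ?_ ?_
  · refine integrableOn_ball_of_norm_le_rpow (C := 1) (α := lam) (by simpa using hN)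
      (by simpa using hlam) ?_ (measurable_hlsProfile lam).aestronglyMeasurable
    filter_upwards [ae_restrict_mem measurableSet_ball] with x hx
    rw [mem_ball_zero_iff] at hx
    rw [Real.norm_of_nonneg (hlsProfile_nonneg _ _), hlsProfile, if_pos hx, one_mul]
  · have h1 := integrable_one_add_norm (μ := (volume : Measure (EuclideanSpace ℝ (Fin N))))
      (r := 2 * N) (by simp; linarith)
    refine Integrable.mono' ((h1.const_mul ((2 : ℝ) ^ (2 * (N : ℝ)))).integrableOn)
      (measurable_hlsProfile lam).aestronglyMeasurable ?_
    filter_upwards [ae_restrict_mem measurableSet_ball.compl] with x hx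
    rw [Set.mem_compl_iff, mem_ball_zero_iff, not_lt] at hx
    rw [Real.norm_of_nonneg (hlsProfile_nonneg _ _), hlsProfile, if_neg hx.not_gt]
    rw [Real.rpow_neg (norm_nonneg _), Real.rpow_neg (by positivity), ← div_eq_mul_inv,
      inv_eq_one_div, div_le_div_iff₀ (by positivity) (by positivity), one_mul,
      ← Real.mul_rpow (by norm_num) (by positivity)]
    exact Real.rpow_le_rpow (by positivity) (by linarith) (by positivity)

/-- A pointwise bound which replaces the Hardy–Littlewood–Sobolev inequality when only finiteness of
the diagonal energy is at stake. With `p = 2N/(2N - λ)` and `z` rescaled by `a^(p/N)`, inside the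
unit ball `b ≤ a` suffices, and outside of it Young's inequality with exponent `p` applies. The
right-hand side is integrable over `x, y` for `a = f x`, `b = f y`, `z = x - y` with `f ∈ L^p`. -/
theorem hls_pointwise [NeZero N] {lam : ℝ} (h0 : 0 < lam) (hlam : lam < N) {a b : ℝ}
    (hb : 0 ≤ b) (hba : b ≤ a) (z : EuclideanSpace ℝ (Fin N)) :
    a * b * ‖z‖ ^ (-lam) ≤
      (a ^ (2 * (N : ℝ) / (2 * N - lam))) ^ 2 *
        hlsProfile N lam ((a ^ (2 * (N : ℝ) / (2 * N - lam))) ^ (1 / (N : ℝ)) • z) +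
      a ^ (2 * (N : ℝ) / (2 * N - lam)) * b ^ (2 * (N : ℝ) / (2 * N - lam)) := by
  have hN' : (0 : ℝ) < N := by exact_mod_cast NeZero.pos N
  have hd : 0 < 2 * (N : ℝ) - lam := by linarith
  rcases (hb.trans hba).eq_or_lt with ha | ha
  · rw [← ha, zero_mul, zero_mul]
    have := hlsProfile_nonneg (N := N) lam
    positivity [this (((0 : ℝ) ^ (2 * (N : ℝ) / (2 * N - lam))) ^ (1 / (N : ℝ)) • z)]
  set p := 2 * (N : ℝ) / (2 * N - lam) with hp
  have hp0 : 0 < p := by positivity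
  rcases (norm_nonneg z).eq_or_lt with hz | hz
  · rw [← hz, Real.zero_rpow (by linarith), mul_zero]
    have := hlsProfile_nonneg (N := N) lam ((a ^ p) ^ (1 / (N : ℝ)) • z)
    positivity
  have hs : ‖(a ^ p) ^ (1 / (N : ℝ)) • z‖ = a ^ (p / N) * ‖z‖ := by
    rw [norm_smul, Real.norm_of_nonneg (by positivity), ← Real.rpow_mul ha.le]
    congr 2; ring
  have hsq : (a ^ p) ^ 2 = a ^ (2 * p) := by
    rw [← Real.rpow_natCast, ← Real.rpow_mul ha.le]; congr 1; push_cast; ring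
  rw [hlsProfile, hs]
  split_ifs with hlt
  · rw [Real.mul_rpow (by positivity) hz.le, ← Real.rpow_mul ha.le, hsq, ← mul_assoc,
      ← Real.rpow_add ha]
    have : 2 * p + p / N * -lam = (2 : ℕ) := by
      rw [hp]; push_cast; field_simp; ring
    rw [this, Real.rpow_natCast]
    have h1 : a * b * ‖z‖ ^ (-lam) ≤ a ^ 2 * ‖z‖ ^ (-lam) := by
      gcongr; nlinarith
    have : 0 ≤ a ^ p * b ^ p := by positivity
    linarith
  · rw [Real.mul_rpow (by positivity) hz.le, ← Real.rpow_mul ha.le, hsq, ← mul_assoc,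
      ← Real.rpow_add ha]
    have : 2 * p + p / N * -(2 * N) = 0 := by field_simp; ring
    rw [this, Real.rpow_zero, one_mul]
    have hpq : p.HolderConjugate (2 * N / lam) := by
      rw [Real.holderConjugate_iff]
      constructor
      · rw [hp, lt_div_iff₀ hd]; linarith
      · rw [hp]; field_simp; ring
    have h1 := Real.young_inequality_of_nonneg (mul_nonneg ha.le hb)
      (Real.rpow_nonneg hz.le (-lam)) hpq
    refine h1.trans ?_
    rw [← Real.rpow_mul hz.le, Real.mul_rpow ha.le hb, add_comm]
    have e : -lam * (2 * N / lam) = -(2 * (N : ℝ)) := by field_simp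
    rw [e]
    refine add_le_add (div_le_self (by positivity) hpq.symm.lt.le)
      (div_le_self (by positivity) hpq.lt.le)

/-- Integrating the rescaled profile in its space variable produces `(A x)⁻¹`, which cancels one of the
two factors `A x`. -/
theorem integrable_hls_bound [NeZero N] {lam : ℝ} (hlam : lam < N)
    {A : EuclideanSpace ℝ (Fin N) → ℝ} (hA : Integrable A) (hA0 : ∀ x, 0 ≤ A x) :
    Integrable (fun p : EuclideanSpace ℝ (Fin N) × EuclideanSpace ℝ (Fin N) =>
      A p.1 ^ 2 * hlsProfile N lam (A p.1 ^ (1 / (N : ℝ)) • (p.1 - p.2)) + A p.1 * A p.2) := by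
  have hN0 : (N : ℝ) ≠ 0 := by exact_mod_cast NeZero.ne N
  refine Integrable.add ?_ (hA.mul_prod hA)
  have hψ := integrable_hlsProfile hlam
  have hm : AEStronglyMeasurable (fun p : EuclideanSpace ℝ (Fin N) × EuclideanSpace ℝ (Fin N) =>
      A p.1 ^ 2 * hlsProfile N lam (A p.1 ^ (1 / (N : ℝ)) • (p.1 - p.2)))
      (volume.prod volume) := by
    have h1 : AEMeasurable (fun p : EuclideanSpace ℝ (Fin N) × EuclideanSpace ℝ (Fin N) => A p.1)
      (volume.prod volume) := hA.1.comp_fst.aemeasurable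
    refine AEMeasurable.aestronglyMeasurable ?_
    refine AEMeasurable.mul (h1.pow_const 2) ((measurable_hlsProfile lam).comp_aemeasurable ?_)
    exact (h1.pow_const _).smul (by fun_prop)
  rw [Measure.volume_eq_prod]
  refine (integrable_prod_iff hm).2 ⟨?_, ?_⟩
  · refine Filter.Eventually.of_forall fun x => ?_
    rcases (hA0 x).eq_or_lt with h | h
    · simp [← h]
    · exact (((_root_.MeasureTheory.integrable_comp_smul_iff volume _
        (Real.rpow_pos_of_pos h (1 / (N : ℝ))).ne').2 hψ).comp_sub_left x).const_mul (A x ^ 2)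
  · have : ∀ x, (∫ y, ‖A x ^ 2 * hlsProfile N lam (A x ^ (1 / (N : ℝ)) • (x - y))‖) =
        A x * ∫ z, hlsProfile N lam z := by
      intro x
      simp_rw [norm_mul, Real.norm_of_nonneg (hlsProfile_nonneg lam _),
        Real.norm_of_nonneg (sq_nonneg (A x))]
      rw [integral_const_mul,
        integral_sub_left_eq_self (fun z => hlsProfile N lam (A x ^ (1 / (N : ℝ)) • z)),
        Measure.integral_comp_smul_of_nonneg volume _ _ (hR := Real.rpow_nonneg (hA0 x) _),
        finrank_euclideanSpace, Fintype.card_fin, ← Real.rpow_natCast (_ ^ (_ : ℝ)),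
        ← Real.rpow_mul (hA0 x), one_div_mul_cancel hN0, Real.rpow_one, smul_eq_mul, ← mul_assoc]
      rcases (hA0 x).eq_or_lt with h | h
      · simp [← h]
      · field_simp
    simp only [this]
    exact hA.mul_const _

theorem integrable_hls_diag [NeZero N] {lam : ℝ} (h0 : 0 < lam) (hlam : lam < N)
    {f : EuclideanSpace ℝ (Fin N) → ℝ}
    (hf : MemLp f (ENNReal.ofReal (2 * (N : ℝ) / (2 * (N : ℝ) - lam))) volume) :
    Integrable (fun p : EuclideanSpace ℝ (Fin N) × EuclideanSpace ℝ (Fin N) =>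
      |f p.1| * |f p.2| * ‖p.1 - p.2‖ ^ (-lam)) := by
  have hN' : (0 : ℝ) < N := by exact_mod_cast NeZero.pos N
  have hd : 0 < 2 * (N : ℝ) - lam := by linarith
  have hp0 : 0 < 2 * (N : ℝ) / (2 * N - lam) := by positivity
  have hA : Integrable (fun x => |f x| ^ (2 * (N : ℝ) / (2 * N - lam))) := by
    have := hf.integrable_norm_rpow (by simpa using hp0) (by simp)
    rwa [ENNReal.toReal_ofReal hp0.le] at this
  have hH := integrable_hls_bound hlam hA (fun x => by positivity)
  refine Integrable.mono' (hH.add hH.swap) ?_ ?_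
  · have h1 : AEStronglyMeasurable (fun x => |f x|) volume := hf.1.norm
    have h2 : AEStronglyMeasurable
      (fun p : EuclideanSpace ℝ (Fin N) × EuclideanSpace ℝ (Fin N) => |f p.1| * |f p.2|)
      (volume.prod volume) := h1.comp_fst.mul h1.comp_snd
    exact h2.mul (Measurable.aestronglyMeasurable (by fun_prop))
  · refine Filter.Eventually.of_forall fun p => ?_
    rw [Real.norm_of_nonneg (by positivity)]
    have hpos : ∀ x y : EuclideanSpace ℝ (Fin N), 0 ≤
      (|f x| ^ (2 * (N : ℝ) / (2 * N - lam))) ^ 2 *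
        hlsProfile N lam ((|f x| ^ (2 * (N : ℝ) / (2 * N - lam))) ^ (1 / (N : ℝ)) • (x - y)) +
      |f x| ^ (2 * (N : ℝ) / (2 * N - lam)) * |f y| ^ (2 * (N : ℝ) / (2 * N - lam)) := by
      intro x y
      have := hlsProfile_nonneg (N := N) lam
        ((|f x| ^ (2 * (N : ℝ) / (2 * N - lam))) ^ (1 / (N : ℝ)) • (x - y))
      positivity
    simp only [Pi.add_apply, Function.comp_apply, Prod.fst_swap, Prod.snd_swap]
    -- the bound is asymmetric, so the larger of the two values plays the role of `a`
    rcases le_total |f p.2| |f p.1| with h | h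
    · exact (hls_pointwise h0 hlam (abs_nonneg _) h _).trans (le_add_of_nonneg_right (hpos _ _))
    · rw [norm_sub_rev, mul_comm |f p.1|]
      exact (hls_pointwise h0 hlam (abs_nonneg _) h _).trans (le_add_of_nonneg_left (hpos _ _))

end ReflPos

/-! ### A subordination integral -/

namespace ReflPos

open Set in
/-- The Cauchy–Schlömilch substitution: `v = α u - β / u` maps the half-line onto the line, and the
involution `u ↦ β / (α u)` shows that the two terms of `dv = (α + β / u²) du` contribute equally. -/
theorem integral_exp_neg_sq_sub_div {α β : ℝ} (hα : 0 < α) (hβ : 0 < β) :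
    ∫ u in Ioi (0 : ℝ), Real.exp (-(α * u - β / u) ^ 2) = √Real.pi / (2 * α) := by
  set g : ℝ → ℝ := fun u => α * u - β / u with hg
  set F : ℝ → ℝ := fun u => Real.exp (-(g u) ^ 2) with hF
  have hder : ∀ u ∈ Ioi (0 : ℝ), HasDerivWithinAt g (α + β / u ^ 2) (Ioi 0) u := by
    intro u hu
    have hu0 : u ≠ 0 := (mem_Ioi.1 hu).ne'
    have h1 := ((hasDerivAt_id u).const_mul α).sub ((hasDerivAt_inv hu0).const_mul β)
    refine (h1.congr_deriv ?_).hasDerivWithinAt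
    field_simp; ring
  have hmono : StrictMonoOn g (Ioi 0) := by
    intro u hu v hv huv
    have h1 : α * u < α * v := by gcongr
    have h2 : β / v < β / u := div_lt_div_of_pos_left hβ hu huv
    simp only [hg]; linarith
  have himg : g '' Ioi 0 = univ := by
    refine eq_univ_of_forall fun v => ?_
    have h4 : 0 < 4 * α * β := by positivity
    have hs : |v| < √(v ^ 2 + 4 * α * β) := by
      rw [← Real.sqrt_sq_eq_abs]; exact Real.sqrt_lt_sqrt (sq_nonneg _) (by linarith)
    have hp : 0 < v + √(v ^ 2 + 4 * α * β) := by linarith [neg_abs_le v]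
    have hsq := Real.sq_sqrt (by positivity : 0 ≤ v ^ 2 + 4 * α * β)
    set S := √(v ^ 2 + 4 * α * β)
    have hu : 0 < (v + S) / (2 * α) := div_pos hp (by positivity)
    have hq : β = (α * ((v + S) / (2 * α)) - v) * ((v + S) / (2 * α)) := by
      field_simp
      linear_combination -hsq
    refine ⟨(v + S) / (2 * α), hu, ?_⟩
    simp only [hg]
    rw [div_eq_of_eq_mul hu.ne' hq]
    ring
  have hgauss : Integrable (fun v : ℝ => Real.exp (-v ^ 2)) := by
    simpa using integrable_exp_neg_mul_sq one_pos
  have hpos : ∀ u ∈ Ioi (0 : ℝ), |α + β / u ^ 2| = α + β / u ^ 2 := fun u hu =>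
    abs_of_pos (by have := mem_Ioi.1 hu; positivity)
  have h1 := integral_image_eq_integral_abs_deriv_smul measurableSet_Ioi hder hmono.injOn
    (fun v => Real.exp (-v ^ 2))
  have h2 := (integrableOn_image_iff_integrableOn_abs_deriv_smul measurableSet_Ioi hder
    hmono.injOn (fun v => Real.exp (-v ^ 2))).1 (by rw [himg]; exact hgauss.integrableOn)
  rw [himg, Measure.restrict_univ] at h1
  have h1' : ∫ v : ℝ, Real.exp (-v ^ 2) = √Real.pi := by simpa using integral_gaussian 1
  rw [h1', setIntegral_congr_fun measurableSet_Ioi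
    (g := fun u => α * F u + β / u ^ 2 * F u)
    (fun u hu => by simp only [hpos u hu, smul_eq_mul, hF, add_mul])] at h1
  have h2' : IntegrableOn (fun u => (α + β / u ^ 2) * F u) (Ioi 0) :=
    h2.congr_fun (fun u hu => by simp only [hpos u hu, smul_eq_mul, hF]) measurableSet_Ioi
  have hFm : Measurable F := by simp only [hF, hg]; fun_prop
  have i1 : IntegrableOn (fun u => α * F u) (Ioi 0) := by
    refine Integrable.mono' h2' (by fun_prop) ?_
    filter_upwards [ae_restrict_mem measurableSet_Ioi] with u hu
    have := mem_Ioi.1 hu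
    have hFp : 0 ≤ F u := (Real.exp_pos _).le
    rw [Real.norm_of_nonneg (by positivity), add_mul]
    exact le_add_of_nonneg_right (by positivity)
  have i2 : IntegrableOn (fun u => β / u ^ 2 * F u) (Ioi 0) := by
    refine Integrable.mono' h2' (by fun_prop) ?_
    filter_upwards [ae_restrict_mem measurableSet_Ioi] with u hu
    have := mem_Ioi.1 hu
    have hFp : 0 ≤ F u := (Real.exp_pos _).le
    rw [Real.norm_of_nonneg (by positivity), add_mul]
    exact le_add_of_nonneg_left (by positivity)
  rw [integral_add i1 i2, integral_const_mul] at h1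
  -- the involution `u ↦ β / (α u)` changes the sign of `g`
  have hinv : ∀ u ∈ Ioi (0 : ℝ), HasDerivWithinAt (fun u => β / α / u) (-(β / α / u ^ 2))
      (Ioi 0) u := by
    intro u hu
    have hu0 : u ≠ 0 := (mem_Ioi.1 hu).ne'
    have h1 := (hasDerivAt_inv hu0).const_mul (β / α)
    refine (h1.congr_deriv ?_).hasDerivWithinAt
    field_simp
  have hc : 0 < β / α := by positivity
  have hinj : InjOn (fun u : ℝ => β / α / u) (Ioi 0) := by
    intro u hu v hv huv
    have hu' := mem_Ioi.1 hu
    have hv' := mem_Ioi.1 hv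
    simp only at huv
    field_simp at huv
    exact huv.symm
  have himg2 : (fun u : ℝ => β / α / u) '' Ioi 0 = Ioi 0 := by
    ext v
    constructor
    · rintro ⟨u, hu, rfl⟩
      have := mem_Ioi.1 hu
      exact div_pos hc this
    · intro hv
      have := mem_Ioi.1 hv
      exact ⟨β / α / v, div_pos hc this, by field_simp⟩
  have h3 := integral_image_eq_integral_abs_deriv_smul measurableSet_Ioi hinv hinj F
  have h3' : ∫ u in Ioi (0 : ℝ), |(-(β / α / u ^ 2))| • F (β / α / u) =
      ∫ u in Ioi (0 : ℝ), α⁻¹ * (β / u ^ 2 * F u) := by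
    refine setIntegral_congr_fun measurableSet_Ioi fun u hu => ?_
    have hu' := mem_Ioi.1 hu
    have e : g (β / α / u) = -g u := by simp only [hg]; field_simp; ring
    simp only [hF, e, abs_neg, smul_eq_mul, neg_sq]
    rw [abs_of_pos (by positivity)]; field_simp
  rw [himg2, h3', integral_const_mul] at h3
  have h4 : ∫ u in Ioi (0 : ℝ), β / u ^ 2 * F u = α * ∫ u in Ioi (0 : ℝ), F u := by
    rw [h3]; field_simp
  rw [h4] at h1
  rw [eq_div_iff (by positivity)]
  change (∫ u in Ioi (0 : ℝ), F u) * (2 * α) = _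
  linarith

open Set in
/-- The Laplace transform of the `1/2`-stable density. The substitution `t = u ^ (-2)` reduces it to
`integral_exp_neg_sq_sub_div`. -/
theorem integral_subordination {s b : ℝ} (hs : 0 < s) (hb : 0 < b) :
    ∫ t in Ioi (0 : ℝ), t ^ (-(3 / 2) : ℝ) * Real.exp (-(s ^ 2 * t) - 1 / (4 * t) * b ^ 2) =
      2 * √Real.pi / b * Real.exp (-(s * b)) := by
  have h := integral_comp_rpow_Ioi
    (fun t : ℝ => t ^ (-(3 / 2) : ℝ) * Real.exp (-(s ^ 2 * t) - 1 / (4 * t) * b ^ 2))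
    (p := -2) (by norm_num)
  rw [← h, setIntegral_congr_fun measurableSet_Ioi
    (g := fun u => 2 * Real.exp (-(s * b)) * Real.exp (-(b / 2 * u - s / u) ^ 2)) ?_,
    integral_const_mul, integral_exp_neg_sq_sub_div (by positivity) hs]
  · field_simp
  · intro u hu
    have hu' := mem_Ioi.1 hu
    have e1 : (u ^ (-2 : ℝ)) ^ (-(3 / 2) : ℝ) = u ^ (3 : ℝ) := by
      rw [← Real.rpow_mul hu'.le]; norm_num
    have e2 : u ^ (-2 : ℝ) = (u ^ 2)⁻¹ := by
      rw [Real.rpow_neg hu'.le]; norm_num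
    have e3 : u ^ (-2 - 1 : ℝ) * u ^ (3 : ℝ) = 1 := by
      rw [← Real.rpow_add hu']; norm_num
    simp only [smul_eq_mul, e1]
    rw [mul_assoc, ← mul_assoc (u ^ (-2 - 1 : ℝ)), e3, one_mul, e2, mul_assoc 2, ← Real.exp_add]
    norm_num
    field_simp
    ring

end ReflPos

/-! ### Laplace–Fourier features for the reflected Riesz kernel -/

namespace ReflPos

section Feature

variable (d : ℕ) (lam : ℝ)

/-- The frequency space: `ξ ∈ ℝ^d` dual to the directions along the hyperplane, and `w > 0`
parametrizing a superposition of masses. -/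
noncomputable def freqMeasure : Measure (EuclideanSpace ℝ (Fin d) × ℝ) :=
  (volume : Measure (EuclideanSpace ℝ (Fin d))).prod (volume.restrict (Set.Ioi 0))

instance : SigmaFinite (freqMeasure d) := by unfold freqMeasure; infer_instance

/-- The decay rate `√(w + |ξ|²)` in the direction normal to the hyperplane. -/
noncomputable def energy {d : ℕ} (ω : EuclideanSpace ℝ (Fin d) × ℝ) : ℝ := √(ω.2 + ‖ω.1‖ ^ 2)

theorem ae_freqMeasure_pos : ∀ᵐ ω ∂(freqMeasure d), 0 < ω.2 := by
  unfold freqMeasure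
  have : ∀ᵐ w ∂(volume.restrict (Set.Ioi (0 : ℝ))), 0 < w := ae_restrict_mem measurableSet_Ioi
  exact Measure.quasiMeasurePreserving_snd.ae this

open Complex in
/-- The integrand over `(ω, t)` whose two iterated integrals are, up to constants, the Riesz kernel
`(s² + |z|²)^(-λ/2)` (the integral over `ω` first: Gaussian Fourier transform and Gamma integral) and
its Laplace–Fourier form (the integral over `t` first: subordination), for `κ = (λ - d + 1) / 2`. -/
noncomputable def heatIntegrand {d : ℕ} (κ s : ℝ) (z : EuclideanSpace ℝ (Fin d))
    (ω : EuclideanSpace ℝ (Fin d) × ℝ) (t : ℝ) : ℂ :=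
  ((t ^ (-(3 / 2) : ℝ) * Real.exp (-(s ^ 2 * t)) : ℝ) : ℂ) *
    (cexp (-((1 / (4 * t) : ℝ) : ℂ) * ‖ω.1‖ ^ 2 + I * (inner ℝ z ω.1 : ℝ)) *
      ((ω.2 ^ (κ - 1) * Real.exp (-(1 / (4 * t) * ω.2)) : ℝ) : ℂ))

variable {d}

theorem integrable_gauss_phase {t : ℝ} (ht : 0 < t) (z : EuclideanSpace ℝ (Fin d)) :
    Integrable fun ξ : EuclideanSpace ℝ (Fin d) =>
      Complex.exp (-((1 / (4 * t) : ℝ) : ℂ) * ‖ξ‖ ^ 2 + Complex.I * (inner ℝ z ξ : ℝ)) :=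
  GaussianFourier.integrable_cexp_neg_mul_sq_norm_add (by
    rw [Complex.ofReal_re]; positivity) _ _

theorem norm_gauss_phase (t : ℝ) (z ξ : EuclideanSpace ℝ (Fin d)) :
    ‖Complex.exp (-((1 / (4 * t) : ℝ) : ℂ) * ‖ξ‖ ^ 2 + Complex.I * (inner ℝ z ξ : ℝ))‖ =
      Real.exp (-(1 / (4 * t)) * ‖ξ‖ ^ 2) := by
  rw [Complex.norm_exp]
  congr 1
  simp [← Complex.ofReal_pow]

theorem integrable_gamma_factor {κ t : ℝ} (hκ : 0 < κ) (ht : 0 < t) :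
    Integrable (fun w : ℝ => w ^ (κ - 1) * Real.exp (-(1 / (4 * t) * w)))
      (volume.restrict (Set.Ioi 0)) := by
  have := integrableOn_rpow_mul_exp_neg_mul_rpow (p := 1) (s := κ - 1) (b := 1 / (4 * t))
    (by linarith) one_pos (by positivity)
  simpa [IntegrableOn] using this

theorem integral_gamma_factor {κ t : ℝ} (hκ : 0 < κ) (ht : 0 < t) :
    ∫ w in Set.Ioi (0 : ℝ), w ^ (κ - 1) * Real.exp (-(1 / (4 * t) * w)) =
      (4 * t) ^ κ * Real.Gamma κ := by
  rw [Real.integral_rpow_mul_exp_neg_mul_Ioi hκ (by positivity), one_div_one_div]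

theorem integrable_heatIntegrand_left {κ t : ℝ} (hκ : 0 < κ) (ht : 0 < t) (s : ℝ)
    (z : EuclideanSpace ℝ (Fin d)) :
    Integrable (fun ω => heatIntegrand κ s z ω t) (freqMeasure d) :=
  ((integrable_gauss_phase ht z).mul_prod (integrable_gamma_factor hκ ht).ofReal).const_mul _

theorem rpow_combine {lam t : ℝ} (ht : 0 < t) {κ : ℝ} (hκ : κ = (lam - d + 1) / 2) :
    t ^ (-(3 / 2) : ℝ) * ((4 * Real.pi * t) ^ ((d : ℝ) / 2) * ((4 * t) ^ κ * Real.Gamma κ)) =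
      (4 * Real.pi) ^ ((d : ℝ) / 2) * 4 ^ κ * Real.Gamma κ * t ^ (lam / 2 - 1) := by
  rw [Real.mul_rpow (by positivity) ht.le, Real.mul_rpow (by norm_num) ht.le]
  have : t ^ (lam / 2 - 1) = t ^ (-(3 / 2) : ℝ) * t ^ ((d : ℝ) / 2) * t ^ κ := by
    rw [← Real.rpow_add ht, ← Real.rpow_add ht, hκ]; congr 1; ring
  rw [this]; ring

theorem integral_heatIntegrand_left {lam : ℝ} {κ t : ℝ} (hκ : 0 < κ)
    (hκ' : κ = (lam - d + 1) / 2) (ht : 0 < t) (s : ℝ) (z : EuclideanSpace ℝ (Fin d)) :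
    ∫ ω, heatIntegrand κ s z ω t ∂(freqMeasure d) =
      (((4 * Real.pi) ^ ((d : ℝ) / 2) * 4 ^ κ * Real.Gamma κ *
        (t ^ (lam / 2 - 1) * Real.exp (-((s ^ 2 + ‖z‖ ^ 2) * t))) : ℝ) : ℂ) := by
  have hb : 0 < (((1 / (4 * t) : ℝ) : ℂ)).re := by rw [Complex.ofReal_re]; positivity
  unfold heatIntegrand freqMeasure
  rw [integral_const_mul, integral_prod_mul
    (fun ξ : EuclideanSpace ℝ (Fin d) =>
      Complex.exp (-((1 / (4 * t) : ℝ) : ℂ) * ‖ξ‖ ^ 2 + Complex.I * (inner ℝ z ξ : ℝ)))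
    (fun w : ℝ => ((w ^ (κ - 1) * Real.exp (-(1 / (4 * t) * w)) : ℝ) : ℂ)),
    integral_complex_ofReal, integral_gamma_factor hκ ht,
    GaussianFourier.integral_cexp_neg_mul_sq_norm_add hb]
  have e1 : (Real.pi / ((1 / (4 * t) : ℝ) : ℂ)) ^ ((Module.finrank ℝ (EuclideanSpace ℝ (Fin d)) : ℂ) / 2)
      = (((4 * Real.pi * t) ^ ((d : ℝ) / 2) : ℝ) : ℂ) := by
    rw [Complex.ofReal_cpow (by positivity), finrank_euclideanSpace, Fintype.card_fin]
    congr 1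
    · push_cast; field_simp
    · push_cast; rfl
  have e2 : Complex.exp (Complex.I ^ 2 * (‖z‖ : ℂ) ^ 2 / (4 * ((1 / (4 * t) : ℝ) : ℂ))) =
      ((Real.exp (-(‖z‖ ^ 2 * t)) : ℝ) : ℂ) := by
    rw [Complex.ofReal_exp, Complex.I_sq]
    congr 1
    push_cast; field_simp
  rw [e1, e2, ← Complex.ofReal_mul, ← Complex.ofReal_mul, ← Complex.ofReal_mul]
  congr 1
  have e3 : Real.exp (-((s ^ 2 + ‖z‖ ^ 2) * t)) =
      Real.exp (-(s ^ 2 * t)) * Real.exp (-(‖z‖ ^ 2 * t)) := by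
    rw [← Real.exp_add]; congr 1; ring
  rw [e3, mul_left_comm, mul_comm, ← mul_assoc _ (t ^ (lam / 2 - 1)), ← rpow_combine ht hκ']
  ring

theorem integral_norm_heatIntegrand_left {lam : ℝ} {κ t : ℝ} (hκ : 0 < κ)
    (hκ' : κ = (lam - d + 1) / 2) (ht : 0 < t) (s : ℝ) (z : EuclideanSpace ℝ (Fin d)) :
    ∫ ω, ‖heatIntegrand κ s z ω t‖ ∂(freqMeasure d) =
      (4 * Real.pi) ^ ((d : ℝ) / 2) * 4 ^ κ * Real.Gamma κ *
        (t ^ (lam / 2 - 1) * Real.exp (-(s ^ 2 * t))) := by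
  have h1 := integral_heatIntegrand_left hκ hκ' ht s (0 : EuclideanSpace ℝ (Fin d))
  have h2 : ∫ ω, heatIntegrand κ s (0 : EuclideanSpace ℝ (Fin d)) ω t ∂(freqMeasure d) =
      ((∫ ω, ‖heatIntegrand κ s z ω t‖ ∂(freqMeasure d) : ℝ) : ℂ) := by
    rw [← integral_complex_ofReal]
    refine integral_congr_ae ?_
    filter_upwards [ae_freqMeasure_pos d] with ω hω
    unfold heatIntegrand
    rw [norm_mul, norm_mul, norm_gauss_phase, Complex.norm_real, Complex.norm_real,
      Real.norm_of_nonneg (by positivity), Real.norm_of_nonneg (by positivity)]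
    push_cast
    simp
  rw [h2] at h1
  have := Complex.ofReal_injective h1
  simpa using this

theorem integrable_heatIntegrand {lam : ℝ} {κ s : ℝ} (hlam : 0 < lam) (hκ : 0 < κ)
    (hκ' : κ = (lam - d + 1) / 2) (hs : 0 < s) (z : EuclideanSpace ℝ (Fin d)) :
    Integrable (Function.uncurry (heatIntegrand κ s z))
      ((freqMeasure d).prod (volume.restrict (Set.Ioi 0))) := by
  have hm : Measurable (Function.uncurry (heatIntegrand κ s z)) := by
    unfold heatIntegrand Function.uncurry
    fun_prop
  refine (integrable_prod_iff' hm.aestronglyMeasurable).2 ⟨?_, ?_⟩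
  · filter_upwards [ae_restrict_mem measurableSet_Ioi] with t ht
    exact integrable_heatIntegrand_left hκ ht s z
  · have h1 := integrableOn_rpow_mul_exp_neg_mul_rpow (p := 1) (s := lam / 2 - 1) (b := s ^ 2)
      (by linarith) one_pos (by positivity)
    have h2 : IntegrableOn (fun t : ℝ => (4 * Real.pi) ^ ((d : ℝ) / 2) * 4 ^ κ * Real.Gamma κ *
        (t ^ (lam / 2 - 1) * Real.exp (-(s ^ 2 * t)))) (Set.Ioi 0) := by
      have := h1.const_mul ((4 * Real.pi) ^ ((d : ℝ) / 2) * 4 ^ κ * Real.Gamma κ)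
      simpa [IntegrableOn] using this
    refine h2.congr_fun (fun t ht => ?_) measurableSet_Ioi
    exact (integral_norm_heatIntegrand_left hκ hκ' ht s z).symm

theorem integral_heatIntegrand_right {κ s : ℝ} (hs : 0 < s) (z : EuclideanSpace ℝ (Fin d))
    {ω : EuclideanSpace ℝ (Fin d) × ℝ} (hω : 0 < ω.2) :
    ∫ t in Set.Ioi (0 : ℝ), heatIntegrand κ s z ω t =
      ((2 * √Real.pi : ℝ) : ℂ) * (((ω.2 ^ (κ - 1) / energy ω * Real.exp (-(s * energy ω)) : ℝ) : ℂ) *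
        Complex.exp (Complex.I * (inner ℝ z ω.1 : ℝ))) := by
  have hE : 0 < energy ω := Real.sqrt_pos.2 (by positivity)
  have hE2 : energy ω ^ 2 = ω.2 + ‖ω.1‖ ^ 2 := Real.sq_sqrt (by positivity)
  have h1 : ∀ t, heatIntegrand κ s z ω t =
      ((t ^ (-(3 / 2) : ℝ) * Real.exp (-(s ^ 2 * t) - 1 / (4 * t) * energy ω ^ 2) : ℝ) : ℂ) *
        (((ω.2 ^ (κ - 1) : ℝ) : ℂ) * Complex.exp (Complex.I * (inner ℝ z ω.1 : ℝ))) := by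
    intro t
    unfold heatIntegrand
    rw [Complex.exp_add, hE2]
    have e : Complex.exp (-((1 / (4 * t) : ℝ) : ℂ) * (‖ω.1‖ : ℂ) ^ 2) =
        ((Real.exp (-(1 / (4 * t) * ‖ω.1‖ ^ 2)) : ℝ) : ℂ) := by
      rw [Complex.ofReal_exp]; congr 1; push_cast; ring
    have e2 : Real.exp (-(s ^ 2 * t) - 1 / (4 * t) * (ω.2 + ‖ω.1‖ ^ 2)) =
        Real.exp (-(s ^ 2 * t)) * Real.exp (-(1 / (4 * t) * ‖ω.1‖ ^ 2)) *
          Real.exp (-(1 / (4 * t) * ω.2)) := by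
      rw [← Real.exp_add, ← Real.exp_add]; congr 1; ring
    rw [e, e2]
    push_cast; ring
  simp_rw [h1]
  rw [integral_mul_const, integral_complex_ofReal, integral_subordination hs hE]
  push_cast; ring

/-- The constant relating the Riesz kernel to its Laplace–Fourier form. -/
noncomputable def featureConst (d : ℕ) (lam : ℝ) : ℝ :=
  (4 * Real.pi) ^ ((d : ℝ) / 2) * 4 ^ ((lam - d + 1) / 2) * Real.Gamma ((lam - d + 1) / 2) *
    Real.Gamma (lam / 2) / (2 * √Real.pi)

theorem featureConst_pos {lam : ℝ} (hlam : 0 < lam) (hκ : (d : ℝ) - 1 < lam) :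
    0 < featureConst d lam := by
  have := Real.Gamma_pos_of_pos (by linarith : 0 < (lam - d + 1) / 2)
  have := Real.Gamma_pos_of_pos (by linarith : 0 < lam / 2)
  unfold featureConst; positivity

/-- The Riesz kernel at height `s > 0` is a superposition of the functions `exp (-s E(ω) + i z · ξ)` with
a positive density. Positivity, that is `κ = (λ - d + 1) / 2 > 0`, is the condition `λ > N - 2` for
`d = N - 1`. -/
theorem laplaceFourier_representation {lam s : ℝ} (hlam : 0 < lam) (hκ : (d : ℝ) - 1 < lam)
    (hs : 0 < s) (z : EuclideanSpace ℝ (Fin d)) :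
    Integrable (fun ω => ((ω.2 ^ ((lam - d + 1) / 2 - 1) / energy ω *
        Real.exp (-(s * energy ω)) : ℝ) : ℂ) * Complex.exp (Complex.I * (inner ℝ z ω.1 : ℝ)))
      (freqMeasure d) ∧
    ∫ ω, ((ω.2 ^ ((lam - d + 1) / 2 - 1) / energy ω * Real.exp (-(s * energy ω)) : ℝ) : ℂ) *
        Complex.exp (Complex.I * (inner ℝ z ω.1 : ℝ)) ∂(freqMeasure d) =
      ((featureConst d lam * (s ^ 2 + ‖z‖ ^ 2) ^ (-lam / 2) : ℝ) : ℂ) := by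
  set κ := (lam - d + 1) / 2 with hκ'
  have hκ0 : 0 < κ := by rw [hκ']; linarith
  have hint := integrable_heatIntegrand hlam hκ0 hκ' hs z
  have hpi : (0 : ℝ) < 2 * √Real.pi := by positivity
  have hpi' : ((2 * √Real.pi : ℝ) : ℂ) ≠ 0 := by exact_mod_cast hpi.ne'
  have hr : ∀ᵐ ω ∂(freqMeasure d), (∫ t in Set.Ioi (0 : ℝ), heatIntegrand κ s z ω t) =
      ((2 * √Real.pi : ℝ) : ℂ) * (((ω.2 ^ (κ - 1) / energy ω * Real.exp (-(s * energy ω)) : ℝ) : ℂ) *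
        Complex.exp (Complex.I * (inner ℝ z ω.1 : ℝ))) := by
    filter_upwards [ae_freqMeasure_pos d] with ω hω
    exact integral_heatIntegrand_right hs z hω
  constructor
  · have h1 := (hint.integral_prod_left.congr hr).const_mul (((2 * √Real.pi : ℝ) : ℂ)⁻¹)
    simpa only [inv_mul_cancel_left₀ hpi'] using h1
  · have h1 := integral_integral_swap hint
    rw [integral_congr_ae hr, integral_const_mul, setIntegral_congr_fun measurableSet_Ioi
      (fun t ht => integral_heatIntegrand_left hκ0 hκ' ht s z), integral_complex_ofReal,
      integral_const_mul, Real.integral_rpow_mul_exp_neg_mul_Ioi (by positivity)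
        (by positivity)] at h1
    rw [← mul_right_inj' hpi', h1, ← Complex.ofReal_mul]
    congr 1
    rw [featureConst, ← hκ', one_div, Real.inv_rpow (by positivity),
      ← Real.rpow_neg (by positivity), neg_div]
    field_simp

/-- The feature map: a point at height `a` above the hyperplane with tangential coordinate `z` is sent to
a function of the frequency. The square root of the positive density of the Laplace–Fourier form is
distributed evenly between the two points. -/
noncomputable def feature (lam a : ℝ) (z : EuclideanSpace ℝ (Fin d))
    (ω : EuclideanSpace ℝ (Fin d) × ℝ) : ℂ :=
  ((√(ω.2 ^ ((lam - d + 1) / 2 - 1) / energy ω / featureConst d lam) *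
    Real.exp (-(a * energy ω)) : ℝ) : ℂ) * Complex.exp (-(Complex.I * (inner ℝ z ω.1 : ℝ)))

/-- Heights add up under reflection, hence `a + a'`: the inner products of the features reproduce the
Riesz kernel between a point and the mirror image of another one. -/
theorem feature_reproducing {lam a a' : ℝ} (hlam : 0 < lam) (hκ : (d : ℝ) - 1 < lam)
    (ha : 0 < a) (ha' : 0 < a') (z z' : EuclideanSpace ℝ (Fin d)) :
    Integrable (fun ω => starRingEnd ℂ (feature lam a z ω) * feature lam a' z' ω)
      (freqMeasure d) ∧
    ∫ ω, starRingEnd ℂ (feature lam a z ω) * feature lam a' z' ω ∂(freqMeasure d) =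
      ((((a + a') ^ 2 + ‖z - z'‖ ^ 2) ^ (-lam / 2) : ℝ) : ℂ) := by
  have hC := featureConst_pos hlam hκ
  obtain ⟨h1, h2⟩ := laplaceFourier_representation hlam hκ (add_pos ha ha') (z - z')
  have h3 : ∀ᵐ ω ∂(freqMeasure d),
      (((featureConst d lam)⁻¹ : ℝ) : ℂ) * ((((ω.2 ^ ((lam - d + 1) / 2 - 1) / energy ω *
        Real.exp (-((a + a') * energy ω)) : ℝ) : ℂ) *
        Complex.exp (Complex.I * (inner ℝ (z - z') ω.1 : ℝ)))) =
      starRingEnd ℂ (feature lam a z ω) * feature lam a' z' ω := by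
    filter_upwards [ae_freqMeasure_pos d] with ω hω
    have hE : 0 < energy ω := Real.sqrt_pos.2 (by positivity)
    have hw : 0 ≤ ω.2 ^ ((lam - d + 1) / 2 - 1) / energy ω / featureConst d lam := by positivity
    unfold feature
    rw [map_mul, Complex.conj_ofReal, ← Complex.exp_conj, map_neg, map_mul, Complex.conj_I,
      Complex.conj_ofReal, mul_mul_mul_comm, ← Complex.exp_add, ← mul_assoc, ← Complex.ofReal_mul,
      ← Complex.ofReal_mul]
    congr 1
    · congr 1
      rw [mul_mul_mul_comm, Real.mul_self_sqrt hw, ← Real.exp_add]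
      have : -((a + a') * energy ω) = -(a * energy ω) + -(a' * energy ω) := by ring
      rw [this]; field_simp
    · congr 1
      rw [inner_sub_left]; push_cast; ring
  refine ⟨(h1.const_mul _).congr h3, ?_⟩
  rw [← integral_congr_ae h3, integral_const_mul, h2, ← Complex.ofReal_mul]
  congr 1
  field_simp

end Feature

end ReflPos

/-! ### Kernels with a feature map, and the passage to balls -/

namespace ReflPos

/-- A kernel `k x y = ⟨Φ x, Φ y⟩` is positive semidefinite on densities with finite total mass and
finite mass on the diagonal; the latter conditions justify the use of Fubini's theorem. -/
theorem integral_nonneg_of_feature {X Ω : Type*} [MeasurableSpace X] [MeasurableSpace Ω]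
    {μ : Measure X} [SFinite μ] {ν : Measure Ω} [SFinite ν] {Φ : X → Ω → ℂ}
    (hΦ : Measurable (Function.uncurry Φ)) {k : X → X → ℝ} {S : Set X}
    (hint : ∀ x ∈ S, ∀ y ∈ S, Integrable (fun ω => starRingEnd ℂ (Φ x ω) * Φ y ω) ν)
    (hk : ∀ x ∈ S, ∀ y ∈ S, ∫ ω, starRingEnd ℂ (Φ x ω) * Φ y ω ∂ν = (k x y : ℂ))
    {h : X → ℝ} (hS : ∀ x, x ∉ S → h x = 0) (h1 : Integrable h μ)
    (h2 : Integrable (fun x => h x * k x x) μ) :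
    0 ≤ ∫ p, h p.1 * h p.2 * k p.1 p.2 ∂(μ.prod μ) := by
  have hconj : Measurable (starRingEnd ℂ) := Complex.continuous_conj.measurable
  set G : (X × X) → Ω → ℂ := fun p ω =>
    ((h p.1 * h p.2 : ℝ) : ℂ) * (starRingEnd ℂ (Φ p.1 ω) * Φ p.2 ω) with hG
  have hsq : ∀ x ∈ S, Integrable (fun ω => ‖Φ x ω‖ ^ 2) ν ∧ ∫ ω, ‖Φ x ω‖ ^ 2 ∂ν = k x x := by
    intro x hx
    have e : ∀ ω, starRingEnd ℂ (Φ x ω) * Φ x ω = ((‖Φ x ω‖ ^ 2 : ℝ) : ℂ) := by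
      intro ω; rw [Complex.conj_mul']; push_cast; rfl
    have i1 := hint x hx x hx
    have i2 := hk x hx x hx
    simp_rw [e] at i1 i2
    rw [integral_complex_ofReal] at i2
    exact ⟨by simpa only [RCLike.re_to_complex, Complex.ofReal_re] using i1.re, Complex.ofReal_injective i2⟩
  have hGm : AEStronglyMeasurable (Function.uncurry G) ((μ.prod μ).prod ν) := by
    have m1 : AEStronglyMeasurable (fun p : X × X => h p.1 * h p.2) (μ.prod μ) :=
      h1.1.comp_fst.mul h1.1.comp_snd
    have m2 : AEStronglyMeasurable (fun q : (X × X) × Ω => h q.1.1 * h q.1.2)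
      ((μ.prod μ).prod ν) := m1.comp_fst
    have m3 : Measurable (fun q : (X × X) × Ω => starRingEnd ℂ (Φ q.1.1 q.2) * Φ q.1.2 q.2) := by
      have m4 : Measurable fun q : (X × X) × Ω => Φ q.1.1 q.2 :=
        hΦ.comp (by fun_prop : Measurable fun q : (X × X) × Ω => (q.1.1, q.2))
      have m5 : Measurable fun q : (X × X) × Ω => Φ q.1.2 q.2 :=
        hΦ.comp (by fun_prop : Measurable fun q : (X × X) × Ω => (q.1.2, q.2))
      exact (hconj.comp m4).mul m5
    exact (Complex.continuous_ofReal.comp_aestronglyMeasurable m2).mul m3.aestronglyMeasurable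
  have hGi : Integrable (Function.uncurry G) ((μ.prod μ).prod ν) := by
    refine (integrable_prod_iff hGm).2 ⟨?_, ?_⟩
    · refine Filter.Eventually.of_forall fun p => ?_
      simp only [Function.uncurry, hG]
      by_cases hx : p.1 ∈ S
      · by_cases hy : p.2 ∈ S
        · exact (hint _ hx _ hy).const_mul _
        · simp [hS _ hy]
      · simp [hS _ hx]
    · have hb : Integrable (fun p : X × X => 1 / 2 * (‖h p.1 * k p.1 p.1‖ * ‖h p.2‖ +
          ‖h p.1‖ * ‖h p.2 * k p.2 p.2‖)) (μ.prod μ) :=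
        ((h2.norm.mul_prod h1.norm).add (h1.norm.mul_prod h2.norm)).const_mul _
      refine Integrable.mono' hb hGm.norm.integral_prod_right' ?_
      refine Filter.Eventually.of_forall fun p => ?_
      rw [Real.norm_of_nonneg (integral_nonneg fun _ => norm_nonneg _)]
      simp only [Function.uncurry, hG]
      by_cases hx : p.1 ∈ S
      · by_cases hy : p.2 ∈ S
        · obtain ⟨i1, e1⟩ := hsq _ hx
          obtain ⟨i2, e2⟩ := hsq _ hy
          have hle : ∫ ω, ‖((h p.1 * h p.2 : ℝ) : ℂ) *
              (starRingEnd ℂ (Φ p.1 ω) * Φ p.2 ω)‖ ∂ν ≤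
              ∫ ω, ‖h p.1 * h p.2‖ * (1 / 2 * (‖Φ p.1 ω‖ ^ 2 + ‖Φ p.2 ω‖ ^ 2)) ∂ν := by
            refine integral_mono ((hint _ hx _ hy).const_mul _).norm
              (((i1.add i2).const_mul _).const_mul _) fun ω => ?_
            simp only [norm_mul, Complex.norm_real, RCLike.norm_conj]
            refine mul_le_mul_of_nonneg_left ?_ (by positivity)
            nlinarith [sq_nonneg (‖Φ p.1 ω‖ - ‖Φ p.2 ω‖)]
          refine hle.trans ?_
          rw [integral_const_mul, integral_const_mul, integral_add i1 i2, e1, e2]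
          have k1 : 0 ≤ k p.1 p.1 := e1 ▸ integral_nonneg fun _ => by positivity
          have k2 : 0 ≤ k p.2 p.2 := e2 ▸ integral_nonneg fun _ => by positivity
          rw [norm_mul, norm_mul, norm_mul, Real.norm_of_nonneg k1, Real.norm_of_nonneg k2]
          exact le_of_eq (by ring)
        · simp [hS _ hy]
      · simp [hS _ hx]
  have hswap := integral_integral_swap hGi
  have hL : ∀ p : X × X, ∫ ω, G p ω ∂ν = ((h p.1 * h p.2 * k p.1 p.2 : ℝ) : ℂ) := by
    intro p
    simp only [hG]
    rw [integral_const_mul]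
    by_cases hx : p.1 ∈ S
    · by_cases hy : p.2 ∈ S
      · rw [hk _ hx _ hy]; push_cast; ring
      · simp [hS _ hy]
    · simp [hS _ hx]
  have hR : ∀ ω, ∫ p, G p ω ∂(μ.prod μ) = ((‖∫ x, (h x : ℂ) * Φ x ω ∂μ‖ ^ 2 : ℝ) : ℂ) := by
    intro ω
    have e : ∀ p : X × X, G p ω =
        (starRingEnd ℂ ((h p.1 : ℂ) * Φ p.1 ω)) * ((h p.2 : ℂ) * Φ p.2 ω) := by
      intro p
      simp only [hG, map_mul, Complex.conj_ofReal]; push_cast; ring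
    simp_rw [e]
    rw [integral_prod_mul (fun x => starRingEnd ℂ ((h x : ℂ) * Φ x ω))
      (fun x => (h x : ℂ) * Φ x ω), integral_conj, Complex.conj_mul']
    push_cast; rfl
  simp_rw [hL, hR] at hswap
  rw [integral_complex_ofReal, integral_complex_ofReal] at hswap
  rw [Complex.ofReal_injective hswap]
  exact integral_nonneg fun _ => by positivity

variable {N : ℕ}

/-- Coordinates on the hyperplane orthogonal to a unit vector, as a copy of `ℝ^(N-1)`. -/
theorem exists_transverse_projection [NeZero N] {e : EuclideanSpace ℝ (Fin N)} (he : ‖e‖ = 1) :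
    ∃ π : EuclideanSpace ℝ (Fin N) →L[ℝ] EuclideanSpace ℝ (Fin (N - 1)),
      ∀ x, ‖π x‖ ^ 2 = ‖x‖ ^ 2 - inner ℝ x e ^ 2 := by
  have hN : N - 1 + 1 = N := Nat.sub_add_cancel NeZero.one_le
  have : Fact (Module.finrank ℝ (EuclideanSpace ℝ (Fin N)) = N - 1 + 1) := ⟨by simp [hN]⟩
  have he0 : e ≠ 0 := by intro h; simp [h] at he
  let b := OrthonormalBasis.fromOrthogonalSpanSingleton (𝕜 := ℝ) (N - 1) he0
  refine ⟨(b.repr : (ℝ ∙ e)ᗮ →L[ℝ] EuclideanSpace ℝ (Fin (N - 1))) ∘L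
    (ℝ ∙ e)ᗮ.orthogonalProjectionOnto, fun x => ?_⟩
  have h1 : ‖((b.repr : (ℝ ∙ e)ᗮ →L[ℝ] EuclideanSpace ℝ (Fin (N - 1))) ∘L
    (ℝ ∙ e)ᗮ.orthogonalProjectionOnto) x‖ = ‖(ℝ ∙ e)ᗮ.orthogonalProjectionOnto x‖ :=
    b.repr.norm_map _
  have h2 := Submodule.norm_sq_eq_add_norm_sq_projection x (ℝ ∙ e)
  have h3 : ‖(ℝ ∙ e).orthogonalProjectionOnto x‖ ^ 2 = inner ℝ x e ^ 2 := by
    have : ((ℝ ∙ e).orthogonalProjectionOnto x : EuclideanSpace ℝ (Fin N)) = inner ℝ e x • e :=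
      Submodule.starProjection_unit_singleton ℝ he x
    rw [Submodule.coe_norm, this, norm_smul, he, mul_one, Real.norm_eq_abs, sq_abs,
      real_inner_comm]
  rw [h1]; linarith

/-- The reflected Riesz kernel of `B` is given on `B` by a measurable feature map. -/
def HasFeature (B : BallOrHalfSpace N) (lam : ℝ) : Prop :=
  ∃ Φ : EuclideanSpace ℝ (Fin N) → EuclideanSpace ℝ (Fin (N - 1)) × ℝ → ℂ,
    Measurable (Function.uncurry Φ) ∧ ∀ x y, 0 < B.rho x → 0 < B.rho y →
      Integrable (fun ω => starRingEnd ℂ (Φ x ω) * Φ y ω) (freqMeasure (N - 1)) ∧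
      ∫ ω, starRingEnd ℂ (Φ x ω) * Φ y ω ∂(freqMeasure (N - 1)) =
        ((B.Q x y ^ (-lam / 2) : ℝ) : ℂ)

theorem hasFeature_halfSpace [NeZero N] {lam : ℝ} (hlam : 0 < lam) (hN : (N : ℝ) - 2 < lam)
    (e : EuclideanSpace ℝ (Fin N)) (t : ℝ) (he : ‖e‖ = 1) :
    HasFeature (BallOrHalfSpace.halfSpace e t he) lam := by
  obtain ⟨π, hπ⟩ := exists_transverse_projection he
  have hd : ((N - 1 : ℕ) : ℝ) - 1 < lam := by
    rw [Nat.cast_sub NeZero.one_le]; push_cast; linarith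
  refine ⟨fun x ω => feature lam (inner ℝ x e - t) (π x) ω, ?_, fun x y hx hy => ?_⟩
  · unfold feature energy Function.uncurry
    fun_prop
  · simp only [BallOrHalfSpace.rho] at hx hy
    obtain ⟨h1, h2⟩ := feature_reproducing hlam hd (a := inner ℝ x e - t) (a' := inner ℝ y e - t)
      (by linarith) (by linarith) (π x) (π y)
    refine ⟨h1, h2.trans ?_⟩
    congr 2
    rw [← map_sub, hπ, BallOrHalfSpace.Q, inner_sub_left]
    simp only [BallOrHalfSpace.rho]
    ring

/-- Feature maps are transported by maps which act conformally on the kernels `Q`. -/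
theorem HasFeature.transport {B B' : BallOrHalfSpace N} {lam : ℝ} (h : HasFeature B' lam)
    {i : EuclideanSpace ℝ (Fin N) → EuclideanSpace ℝ (Fin N)} (hi : Measurable i)
    {c : EuclideanSpace ℝ (Fin N) → ℝ} (hc : Measurable c)
    (hB : ∀ x, 0 < B.rho x → 0 < c x ∧ 0 < B'.rho (i x))
    (hQ : ∀ x y, 0 < B.rho x → 0 < B.rho y → B.Q x y = c x * c y * B'.Q (i x) (i y)) :
    HasFeature B lam := by
  obtain ⟨Φ, hm, hΦ⟩ := h
  refine ⟨fun x ω => ((c x ^ (-lam / 2) : ℝ) : ℂ) * Φ (i x) ω, ?_, fun x y hx hy => ?_⟩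
  · have : Measurable fun q : EuclideanSpace ℝ (Fin N) × (EuclideanSpace ℝ (Fin (N - 1)) × ℝ) =>
        Φ (i q.1) q.2 := hm.comp ((hi.comp measurable_fst).prodMk measurable_snd)
    unfold Function.uncurry
    fun_prop
  · obtain ⟨hcx, hix⟩ := hB x hx
    obtain ⟨hcy, hiy⟩ := hB y hy
    obtain ⟨h1, h2⟩ := hΦ (i x) (i y) hix hiy
    have e : ∀ ω, starRingEnd ℂ (((c x ^ (-lam / 2) : ℝ) : ℂ) * Φ (i x) ω) *
        (((c y ^ (-lam / 2) : ℝ) : ℂ) * Φ (i y) ω) =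
        ((c x ^ (-lam / 2) * c y ^ (-lam / 2) : ℝ) : ℂ) *
          (starRingEnd ℂ (Φ (i x) ω) * Φ (i y) ω) := by
      intro ω; rw [map_mul, Complex.conj_ofReal]; push_cast; ring
    simp_rw [e]
    refine ⟨h1.const_mul _, ?_⟩
    have hQ0 : 0 ≤ B'.Q (i x) (i y) := by
      unfold BallOrHalfSpace.Q; positivity
    rw [integral_const_mul, h2, ← Complex.ofReal_mul, hQ x y hx hy,
      Real.mul_rpow (by positivity) hQ0, Real.mul_rpow hcx.le hcy.le]

/-- Every ball reduces to a half-space, by inversion about a point of its boundary. -/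
theorem hasFeature [NeZero N] {lam : ℝ} (hlam : 0 < lam) (hN : (N : ℝ) - 2 < lam)
    (B : BallOrHalfSpace N) : HasFeature B lam := by
  cases B with
  | halfSpace e t he => exact hasFeature_halfSpace hlam hN e t he
  | ball a r hr =>
    have : Nontrivial (EuclideanSpace ℝ (Fin N)) := inferInstance
    obtain ⟨e, he⟩ := exists_norm_eq (EuclideanSpace ℝ (Fin N)) zero_le_one
    -- the centre of inversion is a point of the sphere bounding the ball
    set p := a - r • e with hp
    have hrho : ∀ x, (BallOrHalfSpace.ball a r hr).rho x =
        2 * inner ℝ (x - p) e - ‖x - p‖ ^ 2 / r := by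
      intro x
      have : x - a = (x - p) - r • e := by rw [hp]; abel
      simp only [BallOrHalfSpace.rho, this, norm_sub_sq_real, norm_smul, he, inner_smul_right,
        Real.norm_eq_abs, abs_of_pos hr]
      field_simp; ring
    have hne : ∀ x, 0 < (BallOrHalfSpace.ball a r hr).rho x → 0 < ‖x - p‖ := by
      intro x hx
      rw [norm_pos_iff]
      intro h0
      rw [hrho, h0] at hx
      simp at hx
    have hrho' : ∀ x, 0 < (BallOrHalfSpace.ball a r hr).rho x →
        (BallOrHalfSpace.halfSpace e (1 / (2 * r)) he).rho ((‖x - p‖ ^ 2)⁻¹ • (x - p)) =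
          (BallOrHalfSpace.ball a r hr).rho x / ‖x - p‖ ^ 2 := by
      intro x hx
      have := hne x hx
      rw [hrho]
      simp only [BallOrHalfSpace.rho, inner_smul_left]
      simp
      field_simp
    refine HasFeature.transport (hasFeature_halfSpace hlam hN e (1 / (2 * r)) he)
      (i := fun x => (‖x - p‖ ^ 2)⁻¹ • (x - p)) (by fun_prop) (c := fun x => ‖x - p‖ ^ 2)
      (by fun_prop) (fun x hx => ⟨pow_pos (hne x hx) 2, ?_⟩) (fun x y hx hy => ?_)
    · rw [hrho' x hx]
      exact div_pos hx (pow_pos (hne x hx) 2)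
    · have h1 := hne x hx
      have h2 := hne y hy
      have e2 : x - y = (x - p) - (y - p) := by abel
      rw [BallOrHalfSpace.Q, BallOrHalfSpace.Q, hrho' x hx, hrho' y hy, e2,
        norm_sub_sq_real ((‖x - p‖ ^ 2)⁻¹ • (x - p)), norm_sub_sq_real (x - p)]
      simp only [norm_smul, inner_smul_left, inner_smul_right, norm_inv, norm_pow, abs_norm,
        Real.norm_eq_abs]
      simp
      field_simp
      ring

end ReflPos

/-! ### Positivity of the reflected forms -/

namespace ReflPos

variable {N : ℕ}

/-- Densities which are bounded, and supported in a bounded set at a positive distance from the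
boundary of `B`. On their support `Q` is bounded from above and away from zero. -/
structure IsTame (B : BallOrHalfSpace N) (M : ℝ) (h : EuclideanSpace ℝ (Fin N) → ℝ) : Prop where
  pos : 0 < M
  meas : Measurable h
  le_rho : ∀ x, h x ≠ 0 → M⁻¹ ≤ B.rho x
  rho_le : ∀ x, h x ≠ 0 → B.rho x ≤ M
  norm_le : ∀ x, h x ≠ 0 → ‖x‖ ≤ M
  bound : ∀ x, |h x| ≤ M

namespace IsTame

variable {B : BallOrHalfSpace N} {M : ℝ} {h : EuclideanSpace ℝ (Fin N) → ℝ}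

theorem integrable (H : IsTame B M h) : Integrable h B.vol := by
  have h1 : IntegrableOn (fun _ : EuclideanSpace ℝ (Fin N) => M) (Metric.closedBall 0 M) volume :=
    integrableOn_const measure_closedBall_lt_top.ne
  have h2 := (integrable_indicator_iff measurableSet_closedBall).2 h1
  refine Integrable.mono' (h2.restrict) H.meas.aestronglyMeasurable
    (Filter.Eventually.of_forall fun x => ?_)
  by_cases hx : h x = 0
  · rw [hx, norm_zero]
    exact Set.indicator_nonneg (fun _ _ => H.pos.le) _
  · rw [Set.indicator_of_mem (by simpa using H.norm_le x hx)]
    exact H.bound x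

theorem le_Q (H : IsTame B M h) {x y : EuclideanSpace ℝ (Fin N)} (hx : h x ≠ 0) (hy : h y ≠ 0) :
    M⁻¹ ^ 2 ≤ B.Q x y := by
  have h1 := H.le_rho x hx
  have h2 := H.le_rho y hy
  have : 0 < M⁻¹ := inv_pos.2 H.pos
  unfold BallOrHalfSpace.Q
  nlinarith [sq_nonneg ‖x - y‖, mul_le_mul h1 h2 this.le (this.le.trans h1)]

theorem Q_le (H : IsTame B M h) {x y : EuclideanSpace ℝ (Fin N)} (hx : h x ≠ 0) (hy : h y ≠ 0) :
    B.Q x y ≤ 5 * M ^ 2 := by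
  have h1 := H.rho_le x hx
  have h2 := H.rho_le y hy
  have h3 : 0 < M⁻¹ := inv_pos.2 H.pos
  have h4 := h3.le.trans (H.le_rho y hy)
  have h5 : ‖x - y‖ ≤ 2 * M := (norm_sub_le _ _).trans (by
    linarith [H.norm_le x hx, H.norm_le y hy])
  unfold BallOrHalfSpace.Q
  nlinarith [mul_le_mul h1 h2 h4 H.pos.le, norm_nonneg (x - y)]

theorem exists_log_bound (H : IsTame B M h) : ∃ L, 0 ≤ L ∧ ∀ x y, h x ≠ 0 → h y ≠ 0 →
    0 < B.Q x y ∧ |Real.log (B.Q x y)| ≤ L := by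
  have h0 : 0 < M⁻¹ ^ 2 := pow_pos (inv_pos.2 H.pos) 2
  refine ⟨max |Real.log (M⁻¹ ^ 2)| |Real.log (5 * M ^ 2)|, by positivity, fun x y hx hy => ?_⟩
  have h1 := h0.trans_le (H.le_Q hx hy)
  exact ⟨h1, abs_le_max_abs_abs (Real.log_le_log h0 (H.le_Q hx hy))
    (Real.log_le_log h1 (H.Q_le hx hy))⟩

theorem integrable_kernel (H : IsTame B M h)
    {k : EuclideanSpace ℝ (Fin N) → EuclideanSpace ℝ (Fin N) → ℝ}
    (hk : Measurable (Function.uncurry k)) {C : ℝ}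
    (hC : ∀ x y, h x ≠ 0 → h y ≠ 0 → |k x y| ≤ C) :
    Integrable (fun p : _ × _ => h p.1 * h p.2 * k p.1 p.2) (B.vol.prod B.vol) := by
  have hk' : Measurable fun p : EuclideanSpace ℝ (Fin N) × EuclideanSpace ℝ (Fin N) =>
    k p.1 p.2 := hk
  have hm := H.meas
  have h1 := (H.integrable.norm.mul_prod H.integrable.norm).mul_const C
  refine Integrable.mono' h1 (by fun_prop) (Filter.Eventually.of_forall fun p => ?_)
  by_cases hx : h p.1 = 0
  · simp [hx]
  by_cases hy : h p.2 = 0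
  · simp [hy]
  rw [norm_mul, norm_mul]
  exact mul_le_mul_of_nonneg_left (hC _ _ hx hy) (by positivity)

end IsTame

theorem measurable_Q (B : BallOrHalfSpace N) :
    Measurable fun p : EuclideanSpace ℝ (Fin N) × EuclideanSpace ℝ (Fin N) => B.Q p.1 p.2 :=
  B.continuous_Q.measurable

theorem rpow_le_exp_of_abs_log_le {q L s t : ℝ} (hq : 0 < q) (hL : |Real.log q| ≤ L)
    (hs : |s| ≤ t) : q ^ s ≤ Real.exp (L * t) := by
  rw [Real.rpow_def_of_pos hq]
  refine Real.exp_le_exp.2 ((le_abs_self _).trans ?_)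
  rw [abs_mul]
  exact mul_le_mul hL hs (abs_nonneg _) ((abs_nonneg _).trans hL)

/-- Above the critical exponent, positivity comes directly from the feature map. -/
theorem IsTame.riesz_nonneg_of_lt [NeZero N] {B : BallOrHalfSpace N} {M lam : ℝ}
    {h : EuclideanSpace ℝ (Fin N) → ℝ} (H : IsTame B M h) (hlam : 0 < lam)
    (hN : (N : ℝ) - 2 < lam) :
    0 ≤ ∫ p, h p.1 * h p.2 * B.Q p.1 p.2 ^ (-lam / 2) ∂(B.vol.prod B.vol) := by
  obtain ⟨Φ, hm, hΦ⟩ := hasFeature hlam hN B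
  obtain ⟨L, hL0, hL⟩ := H.exists_log_bound
  have hpos : ∀ x, h x ≠ 0 → 0 < B.rho x := fun x hx =>
    (inv_pos.2 H.pos).trans_le (H.le_rho x hx)
  suffices hdiag : Integrable (fun x => h x * B.Q x x ^ (-lam / 2)) B.vol from
    integral_nonneg_of_feature (μ := B.vol) (ν := freqMeasure (N - 1)) hm (S := {x | h x ≠ 0})
      (k := fun x y => B.Q x y ^ (-lam / 2))
      (fun x hx y hy => (hΦ x y (hpos x hx) (hpos y hy)).1)
      (fun x hx y hy => (hΦ x y (hpos x hx) (hpos y hy)).2)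
      (fun x hx => not_not.1 hx) H.integrable hdiag
  have hm := H.meas
  have hQ : Measurable fun x => B.Q x x :=
    (B.continuous_Q.comp (continuous_id.prodMk continuous_id)).measurable
  refine Integrable.mono' (H.integrable.norm.mul_const (Real.exp (L * (lam / 2))))
    (hm.mul (hQ.pow_const _)).aestronglyMeasurable (Filter.Eventually.of_forall fun x => ?_)
  by_cases hx : h x = 0
  · simp [hx]
  obtain ⟨q0, q1⟩ := hL x x hx hx
  rw [norm_mul, Real.norm_of_nonneg (Real.rpow_nonneg q0.le _)]
  refine mul_le_mul_of_nonneg_left (rpow_le_exp_of_abs_log_le q0 q1 ?_) (norm_nonneg _)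
  rw [abs_le]; constructor <;> linarith

open Filter Topology in
/-- The critical exponent `λ = N - 2` is reached as a limit from above. -/
theorem IsTame.riesz_nonneg [NeZero N] {B : BallOrHalfSpace N} {M lam : ℝ}
    {h : EuclideanSpace ℝ (Fin N) → ℝ} (H : IsTame B M h) (hlam : 0 < lam)
    (hN : (N : ℝ) - 2 ≤ lam) :
    0 ≤ ∫ p, h p.1 * h p.2 * B.Q p.1 p.2 ^ (-lam / 2) ∂(B.vol.prod B.vol) := by
  obtain ⟨L, hL0, hL⟩ := H.exists_log_bound
  have hm := H.meas
  have hQ := measurable_Q B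
  have hlim : Tendsto (fun n : ℕ => lam + 1 / ((n : ℝ) + 1)) atTop (𝓝 lam) := by
    simpa using tendsto_one_div_add_atTop_nhds_zero_nat.const_add lam
  have key := tendsto_integral_of_dominated_convergence
    (μ := B.vol.prod B.vol)
    (F := fun n (p : EuclideanSpace ℝ (Fin N) × EuclideanSpace ℝ (Fin N)) =>
      h p.1 * h p.2 * B.Q p.1 p.2 ^ (-(lam + 1 / ((n : ℝ) + 1)) / 2))
    (f := fun p => h p.1 * h p.2 * B.Q p.1 p.2 ^ (-lam / 2))
    (fun p => ‖h p.1‖ * ‖h p.2‖ * Real.exp (L * ((lam + 1) / 2)))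
    (fun n => Measurable.aestronglyMeasurable (by fun_prop))
    ((H.integrable.norm.mul_prod H.integrable.norm).mul_const _)
    (fun n => Eventually.of_forall fun p => ?_) (Eventually.of_forall fun p => ?_)
  · refine ge_of_tendsto' key fun n => ?_
    have : (0 : ℝ) < 1 / ((n : ℝ) + 1) := by positivity
    exact H.riesz_nonneg_of_lt (by linarith) (by linarith)
  · by_cases hx : h p.1 = 0
    · simp [hx]
    by_cases hy : h p.2 = 0
    · simp [hy]
    obtain ⟨q0, q1⟩ := hL _ _ hx hy
    rw [norm_mul, norm_mul, Real.norm_of_nonneg (Real.rpow_nonneg q0.le _)]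
    refine mul_le_mul_of_nonneg_left (rpow_le_exp_of_abs_log_le q0 q1 ?_) (by positivity)
    have h1 : (0 : ℝ) < 1 / ((n : ℝ) + 1) := by positivity
    have h2 : 1 / ((n : ℝ) + 1) ≤ 1 := by
      rw [div_le_one (by positivity)]; linarith [(n.cast_nonneg : (0 : ℝ) ≤ n)]
    rw [abs_le]; constructor <;> linarith
  · by_cases hx : h p.1 = 0
    · simp [hx]
    by_cases hy : h p.2 = 0
    · simp [hy]
    obtain ⟨q0, q1⟩ := hL _ _ hx hy
    refine Tendsto.const_mul _ (Tendsto.rpow tendsto_const_nhds ?_ (Or.inl q0.ne'))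
    exact (hlim.neg).div_const 2

theorem abs_exp_sub_one_le_mul_exp (x : ℝ) : |Real.exp x - 1| ≤ |x| * Real.exp |x| := by
  rcases le_total 0 x with hx | hx
  · rw [abs_of_nonneg hx, abs_of_nonneg (by linarith [Real.add_one_le_exp x])]
    have h1 := Real.add_one_le_exp (-x)
    have h2 : Real.exp (-x) * Real.exp x = 1 := by rw [← Real.exp_add]; simp
    nlinarith [Real.exp_pos x]
  · rw [abs_of_nonpos hx, abs_of_nonpos (by linarith [Real.exp_le_one_iff.2 hx])]
    have h1 := Real.add_one_le_exp x
    have h2 : 1 ≤ Real.exp (-x) := Real.one_le_exp (by linarith)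
    nlinarith

open Filter Topology in
/-- The logarithm is the limit of the difference quotients `(Q^(-ε/2) - 1) / ε`, and the constant
`-1` does not contribute because the density has mean zero. -/
theorem IsTame.log_nonneg [NeZero N] {B : BallOrHalfSpace N} {M : ℝ}
    {h : EuclideanSpace ℝ (Fin N) → ℝ} (H : IsTame B M h) (hN : (N : ℝ) - 2 ≤ 0)
    (h0 : ∫ x, h x ∂B.vol = 0) :
    0 ≤ ∫ p, h p.1 * h p.2 * (-(1 / 2) * Real.log (B.Q p.1 p.2)) ∂(B.vol.prod B.vol) := by
  obtain ⟨L, hL0, hL⟩ := H.exists_log_bound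
  have hm := H.meas
  have hQ := measurable_Q B
  have hlim : Tendsto (fun n : ℕ => 1 / ((n : ℝ) + 1)) atTop (𝓝[≠] 0) :=
    tendsto_nhdsWithin_iff.2 ⟨tendsto_one_div_add_atTop_nhds_zero_nat,
      Eventually.of_forall fun n => (Nat.one_div_pos_of_nat (α := ℝ)).ne'⟩
  have key := tendsto_integral_of_dominated_convergence
    (μ := B.vol.prod B.vol)
    (F := fun n (p : EuclideanSpace ℝ (Fin N) × EuclideanSpace ℝ (Fin N)) =>
      h p.1 * h p.2 * ((1 / ((n : ℝ) + 1))⁻¹ * (B.Q p.1 p.2 ^ (-(1 / ((n : ℝ) + 1)) / 2) - 1)))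
    (f := fun p => h p.1 * h p.2 * (-(1 / 2) * Real.log (B.Q p.1 p.2)))
    (fun p => ‖h p.1‖ * ‖h p.2‖ * (L / 2 * Real.exp (L / 2)))
    (fun n => Measurable.aestronglyMeasurable (by fun_prop))
    ((H.integrable.norm.mul_prod H.integrable.norm).mul_const _)
    (fun n => Eventually.of_forall fun p => ?_) (Eventually.of_forall fun p => ?_)
  · refine ge_of_tendsto' key fun n => ?_
    have hn : (0 : ℝ) < 1 / ((n : ℝ) + 1) := by positivity
    have e : ∀ p : EuclideanSpace ℝ (Fin N) × EuclideanSpace ℝ (Fin N),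
        h p.1 * h p.2 * ((1 / ((n : ℝ) + 1))⁻¹ * (B.Q p.1 p.2 ^ (-(1 / ((n : ℝ) + 1)) / 2) - 1)) =
        (1 / ((n : ℝ) + 1))⁻¹ * (h p.1 * h p.2 * B.Q p.1 p.2 ^ (-(1 / ((n : ℝ) + 1)) / 2)
          - h p.1 * h p.2) := by
      intro p; ring
    have i1 := H.integrable_kernel (k := fun x y => B.Q x y ^ (-(1 / ((n : ℝ) + 1)) / 2))
      (C := Real.exp (L * (1 / ((n : ℝ) + 1)))) (by unfold Function.uncurry; fun_prop)
      (fun x y hx hy => by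
        obtain ⟨q0, q1⟩ := hL _ _ hx hy
        rw [abs_of_nonneg (Real.rpow_nonneg q0.le _)]
        refine rpow_le_exp_of_abs_log_le q0 q1 ?_
        rw [abs_le]; constructor <;> linarith)
    simp_rw [e]
    rw [integral_const_mul, integral_sub i1 (H.integrable.mul_prod H.integrable),
      integral_prod_mul, h0, mul_zero, sub_zero]
    exact mul_nonneg (inv_nonneg.2 hn.le) (H.riesz_nonneg_of_lt hn (by linarith))
  · by_cases hx : h p.1 = 0
    · simp [hx]
    by_cases hy : h p.2 = 0
    · simp [hy]
    obtain ⟨q0, q1⟩ := hL _ _ hx hy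
    have h1 : (0 : ℝ) < 1 / ((n : ℝ) + 1) := by positivity
    have h2 : 1 / ((n : ℝ) + 1) ≤ 1 := by
      rw [div_le_one (by positivity)]; linarith [(n.cast_nonneg : (0 : ℝ) ≤ n)]
    set ε := 1 / ((n : ℝ) + 1)
    rw [norm_mul, norm_mul]
    refine mul_le_mul_of_nonneg_left ?_ (by positivity)
    rw [norm_mul, Real.norm_of_nonneg (inv_nonneg.2 h1.le), Real.rpow_def_of_pos q0,
      inv_mul_le_iff₀ h1, Real.norm_eq_abs]
    refine (abs_exp_sub_one_le_mul_exp _).trans ?_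
    have e : |Real.log (B.Q p.1 p.2) * (-ε / 2)| = ε * (|Real.log (B.Q p.1 p.2)| / 2) := by
      rw [abs_mul, abs_div, abs_neg, abs_of_pos h1, abs_of_pos (two_pos : (0 : ℝ) < 2)]; ring
    rw [e, mul_assoc]
    refine mul_le_mul_of_nonneg_left ?_ h1.le
    have h3 : |Real.log (B.Q p.1 p.2)| / 2 ≤ L / 2 := by linarith
    refine mul_le_mul h3 (Real.exp_le_exp.2 ?_) (Real.exp_pos _).le (by positivity)
    refine le_trans ?_ h3
    exact mul_le_of_le_one_left (by positivity) h2
  · by_cases hx : h p.1 = 0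
    · simp [hx]
    by_cases hy : h p.2 = 0
    · simp [hy]
    obtain ⟨q0, q1⟩ := hL _ _ hx hy
    refine Tendsto.const_mul _ ?_
    have hd : HasDerivAt (fun t : ℝ => B.Q p.1 p.2 ^ (-t / 2))
        (-(1 / 2) * Real.log (B.Q p.1 p.2)) 0 := by
      have := ((hasDerivAt_id (0 : ℝ)).neg.div_const 2).const_rpow q0
      refine this.congr_deriv ?_
      simp
      ring
    have := (hasDerivAt_iff_tendsto_slope_zero.1 hd).comp hlim
    simpa [Function.comp_def] using this

section Truncation

variable (B : BallOrHalfSpace N) (h : EuclideanSpace ℝ (Fin N) → ℝ)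

/-- The sets on which `h` is cut off to a tame density. They exhaust `B` up to a null set. -/
def tameSet (n : ℕ) : Set (EuclideanSpace ℝ (Fin N)) :=
  {x | ((n : ℝ) + 1)⁻¹ ≤ B.rho x ∧ B.rho x ≤ (n : ℝ) + 1 ∧ ‖x‖ ≤ (n : ℝ) + 1 ∧ |h x| ≤ (n : ℝ) + 1}

variable {B h}

theorem measurableSet_tameSet (hm : Measurable h) (n : ℕ) : MeasurableSet (tameSet B h n) := by
  have h1 := B.continuous_rho.measurable
  refine (measurableSet_le measurable_const h1).inter ((measurableSet_le h1 measurable_const).inter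
    ((measurableSet_le measurable_norm measurable_const).inter
      (measurableSet_le hm.norm measurable_const)))

open Filter in
theorem eventually_mem_tameSet {x : EuclideanSpace ℝ (Fin N)} (hx : 0 < B.rho x) :
    ∀ᶠ n : ℕ in atTop, x ∈ tameSet B h n := by
  have h0 : Tendsto (fun n : ℕ => (n : ℝ) + 1) atTop atTop :=
    tendsto_atTop_add_const_right _ _ tendsto_natCast_atTop_atTop
  filter_upwards [h0.eventually_ge_atTop (B.rho x)⁻¹, h0.eventually_ge_atTop (B.rho x),
    h0.eventually_ge_atTop ‖x‖, h0.eventually_ge_atTop |h x|] with n h1 h2 h3 h4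
  exact ⟨inv_le_of_inv_le₀ hx h1, h2, h3, h4⟩

open Filter in
theorem tendsto_indicator_tameSet {x : EuclideanSpace ℝ (Fin N)} (hx : 0 < B.rho x)
    (g : EuclideanSpace ℝ (Fin N) → ℝ) :
    Tendsto (fun n => (tameSet B h n).indicator g x) atTop (nhds (g x)) := by
  refine tendsto_const_nhds.congr' ?_
  filter_upwards [eventually_mem_tameSet (h := h) hx] with n hn
  rw [Set.indicator_of_mem hn]

theorem isTame_indicator (hm : Measurable h) (n : ℕ) :
    IsTame B ((n : ℝ) + 1) ((tameSet B h n).indicator h) where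
  pos := by positivity
  meas := hm.indicator (measurableSet_tameSet hm n)
  le_rho x hx := (Set.mem_of_indicator_ne_zero hx).1
  rho_le x hx := (Set.mem_of_indicator_ne_zero hx).2.1
  norm_le x hx := (Set.mem_of_indicator_ne_zero hx).2.2.1
  bound x := by
    by_cases hx : x ∈ tameSet B h n
    · rw [Set.indicator_of_mem hx]; exact hx.2.2.2
    · rw [Set.indicator_of_notMem hx, abs_zero]; positivity

theorem ae_prod_rho_pos (B : BallOrHalfSpace N) :
    ∀ᵐ p ∂(B.vol.prod B.vol), 0 < B.rho p.1 ∧ 0 < B.rho p.2 :=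
  (Measure.quasiMeasurePreserving_fst.ae B.ae_vol_rho_pos).and
    (Measure.quasiMeasurePreserving_snd.ae B.ae_vol_rho_pos)

open Filter in
/-- Positivity extends from tame densities to all densities of finite energy, by truncation. -/
theorem integral_nonneg_of_tame_measurable
    {k : EuclideanSpace ℝ (Fin N) → EuclideanSpace ℝ (Fin N) → ℝ}
    (hk : Measurable (Function.uncurry k))
    (H : ∀ M g, IsTame B M g → 0 ≤ ∫ p, g p.1 * g p.2 * k p.1 p.2 ∂(B.vol.prod B.vol))
    (hm : Measurable h)
    (hi : Integrable (fun p : _ × _ => h p.1 * h p.2 * k p.1 p.2) (B.vol.prod B.vol)) :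
    0 ≤ ∫ p, h p.1 * h p.2 * k p.1 p.2 ∂(B.vol.prod B.vol) := by
  have hk' : Measurable fun p : EuclideanSpace ℝ (Fin N) × EuclideanSpace ℝ (Fin N) =>
    k p.1 p.2 := hk
  have key := tendsto_integral_of_dominated_convergence
    (μ := B.vol.prod B.vol)
    (F := fun n (p : EuclideanSpace ℝ (Fin N) × EuclideanSpace ℝ (Fin N)) =>
      (tameSet B h n).indicator h p.1 * (tameSet B h n).indicator h p.2 * k p.1 p.2)
    (f := fun p => h p.1 * h p.2 * k p.1 p.2)
    (fun p => ‖h p.1 * h p.2 * k p.1 p.2‖)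
    (fun n => by
      have := (isTame_indicator (B := B) hm n).meas
      exact Measurable.aestronglyMeasurable (by fun_prop))
    hi.norm (fun n => Eventually.of_forall fun p => ?_) ?_
  · exact ge_of_tendsto' key fun n => H _ _ (isTame_indicator hm n)
  · rw [norm_mul, norm_mul, norm_mul, norm_mul]
    gcongr <;> exact norm_indicator_le_norm_self _ _
  · filter_upwards [ae_prod_rho_pos B] with p hp
    exact ((tendsto_indicator_tameSet hp.1 h).mul (tendsto_indicator_tameSet hp.2 h)).mul_const _

open Filter in
/-- The same for densities of mean zero. To keep the mean equal to zero, the positive and the negative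
part are truncated separately and each is weighted by the truncated mass of the other; the limit is
the original density times the common mass of the two parts. -/
theorem integral_nonneg_of_tame_meanZero_measurable
    {k : EuclideanSpace ℝ (Fin N) → EuclideanSpace ℝ (Fin N) → ℝ}
    (hk : Measurable (Function.uncurry k))
    (H : ∀ M g, IsTame B M g → ∫ x, g x ∂B.vol = 0 →
      0 ≤ ∫ p, g p.1 * g p.2 * k p.1 p.2 ∂(B.vol.prod B.vol))
    (hm : Measurable h) (h1 : Integrable h B.vol) (h0 : ∫ x, h x ∂B.vol = 0)
    (hi : Integrable (fun p : _ × _ => h p.1 * h p.2 * k p.1 p.2) (B.vol.prod B.vol)) :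
    0 ≤ ∫ p, h p.1 * h p.2 * k p.1 p.2 ∂(B.vol.prod B.vol) := by
  have hk' : Measurable fun p : EuclideanSpace ℝ (Fin N) × EuclideanSpace ℝ (Fin N) =>
    k p.1 p.2 := hk
  set hp : EuclideanSpace ℝ (Fin N) → ℝ := fun x => max (h x) 0 with hhp
  set hn : EuclideanSpace ℝ (Fin N) → ℝ := fun x => max (-h x) 0 with hhn
  have hpn : ∀ x, hp x - hn x = h x := fun x => by
    simp only [hhp, hhn]
    rcases le_total 0 (h x) with hx | hx
    · rw [max_eq_left hx, max_eq_right (by linarith)]; ring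
    · rw [max_eq_right hx, max_eq_left (by linarith)]; ring
  have hpa : ∀ x, hp x + hn x = |h x| := fun x => by
    simp only [hhp, hhn]
    rcases le_total 0 (h x) with hx | hx
    · rw [max_eq_left hx, max_eq_right (by linarith), abs_of_nonneg hx]; ring
    · rw [max_eq_right hx, max_eq_left (by linarith), abs_of_nonpos hx]; ring
  have hp0 : ∀ x, 0 ≤ hp x := fun x => le_max_right _ _
  have hn0 : ∀ x, 0 ≤ hn x := fun x => le_max_right _ _
  have ip : Integrable hp B.vol := h1.pos_part
  have in' : Integrable hn B.vol := h1.neg_part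
  set E := tameSet B h with hE
  have hEm : ∀ n, MeasurableSet (E n) := measurableSet_tameSet hm
  set α : ℕ → ℝ := fun n => ∫ x, (E n).indicator hp x ∂B.vol with hα
  set β : ℕ → ℝ := fun n => ∫ x, (E n).indicator hn x ∂B.vol with hβ
  set a := ∫ x, hp x ∂B.vol with ha
  set b := ∫ x, hn x ∂B.vol with hb
  have hab : a = b := by
    have := integral_sub ip in'
    simp only [hpn, h0] at this
    linarith
  have limit : ∀ g : EuclideanSpace ℝ (Fin N) → ℝ, Integrable g B.vol →
      Tendsto (fun n => ∫ x, (E n).indicator g x ∂B.vol) atTop (nhds (∫ x, g x ∂B.vol)) := by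
    intro g hg
    refine tendsto_integral_of_dominated_convergence (fun x => ‖g x‖)
      (fun n => (hg.indicator (hEm n)).1) hg.norm
      (fun n => Eventually.of_forall fun x => norm_indicator_le_norm_self _ _) ?_
    filter_upwards [B.ae_vol_rho_pos] with x hx
    exact tendsto_indicator_tameSet hx g
  have hαl : Tendsto α atTop (nhds a) := limit hp ip
  have hβl : Tendsto β atTop (nhds a) := by rw [hab]; exact limit hn in'
  have hαle : ∀ n, α n ≤ a := fun n => integral_mono (ip.indicator (hEm n)) ip fun x =>
    Set.indicator_le_self' (fun y _ => hp0 y) x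
  have hβle : ∀ n, β n ≤ a := fun n => hab ▸ integral_mono (in'.indicator (hEm n)) in' fun x =>
    Set.indicator_le_self' (fun y _ => hn0 y) x
  have hα0 : ∀ n, 0 ≤ α n := fun n => integral_nonneg fun x =>
    Set.indicator_nonneg (fun y _ => hp0 y) x
  have hβ0 : ∀ n, 0 ≤ β n := fun n => integral_nonneg fun x =>
    Set.indicator_nonneg (fun y _ => hn0 y) x
  have ha0 : 0 ≤ a := (hα0 0).trans (hαle 0)
  set g : ℕ → EuclideanSpace ℝ (Fin N) → ℝ := fun n x =>
    β n * (E n).indicator hp x - α n * (E n).indicator hn x with hg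
  have hgm : ∀ n, Measurable (g n) := fun n =>
    (((hm.max measurable_const).indicator (hEm n)).const_mul _).sub
      (((hm.neg.max measurable_const).indicator (hEm n)).const_mul _)
  have hgE : ∀ n x, g n x ≠ 0 → x ∈ E n := by
    intro n x hx
    by_contra hc
    exact hx (by simp only [hg, Set.indicator_of_notMem hc]; ring)
  have hgle : ∀ n x, |g n x| ≤ a * |h x| := by
    intro n x
    by_cases hx : x ∈ E n
    · simp only [hg, Set.indicator_of_mem hx]
      refine (abs_sub _ _).trans ?_
      rw [abs_mul, abs_mul, abs_of_nonneg (hβ0 n), abs_of_nonneg (hα0 n), abs_of_nonneg (hp0 x),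
        abs_of_nonneg (hn0 x), ← hpa x, mul_add]
      exact add_le_add (mul_le_mul_of_nonneg_right (hβle n) (hp0 x))
        (mul_le_mul_of_nonneg_right (hαle n) (hn0 x))
    · simp only [hg, Set.indicator_of_notMem hx]
      simpa using mul_nonneg ha0 (abs_nonneg (h x))
  have htame : ∀ n : ℕ, IsTame B (((n : ℝ) + 1) * (a + 1)) (g n) := by
    intro n
    have h1 : (n : ℝ) + 1 ≤ ((n : ℝ) + 1) * (a + 1) :=
      le_mul_of_one_le_right (by positivity) (by linarith)
    refine ⟨by positivity, hgm n, fun x hx => ?_, fun x hx => (hgE n x hx).2.1.trans h1,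
      fun x hx => (hgE n x hx).2.2.1.trans h1, fun x => ?_⟩
    · exact (inv_anti₀ (by positivity) h1).trans (hgE n x hx).1
    · by_cases hx : g n x = 0
      · rw [hx, abs_zero]; positivity
      · have := (hgE n x hx).2.2.2
        refine (hgle n x).trans ?_
        nlinarith [abs_nonneg (h x)]
  have hg0 : ∀ n, ∫ x, g n x ∂B.vol = 0 := by
    intro n
    simp only [hg]
    rw [integral_sub ((ip.indicator (hEm n)).const_mul _) ((in'.indicator (hEm n)).const_mul _),
      integral_const_mul, integral_const_mul]
    change β n * α n - α n * β n = 0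
    ring
  have key := tendsto_integral_of_dominated_convergence
    (μ := B.vol.prod B.vol)
    (F := fun n (p : EuclideanSpace ℝ (Fin N) × EuclideanSpace ℝ (Fin N)) =>
      g n p.1 * g n p.2 * k p.1 p.2)
    (f := fun p => (a * h p.1) * (a * h p.2) * k p.1 p.2)
    (fun p => a ^ 2 * ‖h p.1 * h p.2 * k p.1 p.2‖)
    (fun n => by
      have := hgm n
      exact Measurable.aestronglyMeasurable (by fun_prop))
    (hi.norm.const_mul _) (fun n => Eventually.of_forall fun p => ?_) ?_
  · have h2 := ge_of_tendsto' key fun n => H _ _ (htame n) (hg0 n)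
    have e : ∀ p : EuclideanSpace ℝ (Fin N) × EuclideanSpace ℝ (Fin N),
        (a * h p.1) * (a * h p.2) * k p.1 p.2 = a ^ 2 * (h p.1 * h p.2 * k p.1 p.2) := by
      intro p; ring
    simp_rw [e] at h2
    rw [integral_const_mul] at h2
    -- if the common mass is zero, then so is the density
    rcases ha0.eq_or_lt with hz | hz
    · have hpz := (integral_eq_zero_iff_of_nonneg hp0 ip).1 hz.symm
      have hnz := (integral_eq_zero_iff_of_nonneg hn0 in').1 (hab.symm.trans hz.symm)
      have hz' : ∀ᵐ x ∂B.vol, h x = 0 := by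
        filter_upwards [hpz, hnz] with x h3 h4
        rw [← hpn x, h3, h4]; simp
      refine le_of_eq (integral_eq_zero_of_ae ?_).symm
      filter_upwards [Measure.quasiMeasurePreserving_fst.ae hz'] with p hp
      simp [hp]
    · exact nonneg_of_mul_nonneg_right h2 (pow_pos hz 2)
  · rw [norm_mul, norm_mul, norm_mul, norm_mul]
    calc ‖g n p.1‖ * ‖g n p.2‖ * ‖k p.1 p.2‖ ≤ (a * |h p.1|) * (a * |h p.2|) * ‖k p.1 p.2‖ := by
          have := hgle n p.1
          have := hgle n p.2
          gcongr <;> assumption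
      _ = _ := by simp only [Real.norm_eq_abs]; ring
  · filter_upwards [ae_prod_rho_pos B] with p hpos
    have hx : ∀ x, 0 < B.rho x → Tendsto (fun n => g n x) atTop (nhds (a * h x)) := by
      intro x hx
      have := ((hβl.mul (tendsto_indicator_tameSet (h := h) hx hp)).sub
        (hαl.mul (tendsto_indicator_tameSet (h := h) hx hn)))
      rw [← mul_sub, hpn] at this
      exact this
    exact ((hx _ hpos.1).mul (hx _ hpos.2)).mul_const _

theorem integral_congr_kernel {h' : EuclideanSpace ℝ (Fin N) → ℝ} (hh : h =ᵐ[B.vol] h')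
    (k : EuclideanSpace ℝ (Fin N) → EuclideanSpace ℝ (Fin N) → ℝ) :
    (fun p : _ × _ => h p.1 * h p.2 * k p.1 p.2) =ᵐ[B.vol.prod B.vol]
      fun p => h' p.1 * h' p.2 * k p.1 p.2 := by
  filter_upwards [Measure.quasiMeasurePreserving_fst.ae hh,
    Measure.quasiMeasurePreserving_snd.ae hh] with p h1 h2
  rw [h1, h2]

end Truncation

/-- The reflected Riesz form is nonnegative at every density of finite energy. -/
theorem reflectedRiesz_nonneg [NeZero N] {B : BallOrHalfSpace N} {lam : ℝ}
    (hlam : 0 < lam) (hN : (N : ℝ) - 2 ≤ lam) {h : EuclideanSpace ℝ (Fin N) → ℝ}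
    (hm : AEStronglyMeasurable h B.vol)
    (hi : Integrable (fun p : _ × _ => h p.1 * h p.2 * B.Q p.1 p.2 ^ (-lam / 2))
      (B.vol.prod B.vol)) :
    0 ≤ ∫ p, h p.1 * h p.2 * B.Q p.1 p.2 ^ (-lam / 2) ∂(B.vol.prod B.vol) := by
  have hQ := measurable_Q B
  have hc := integral_congr_kernel hm.ae_eq_mk (fun x y => B.Q x y ^ (-lam / 2))
  rw [integral_congr_ae hc]
  exact integral_nonneg_of_tame_measurable (k := fun x y => B.Q x y ^ (-lam / 2))
    (by unfold Function.uncurry; fun_prop) (fun M g H => H.riesz_nonneg hlam hN)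
    hm.stronglyMeasurable_mk.measurable (hi.congr hc)

/-- The reflected logarithmic form is nonnegative at every density of mean zero and finite energy. -/
theorem reflectedLog_nonneg [NeZero N] {B : BallOrHalfSpace N}
    (hN : (N : ℝ) - 2 ≤ 0) {h : EuclideanSpace ℝ (Fin N) → ℝ}
    (h1 : Integrable h B.vol) (h0 : ∫ x, h x ∂B.vol = 0)
    (hi : Integrable (fun p : _ × _ => h p.1 * h p.2 * (-(1 / 2) * Real.log (B.Q p.1 p.2)))
      (B.vol.prod B.vol)) :
    0 ≤ ∫ p, h p.1 * h p.2 * (-(1 / 2) * Real.log (B.Q p.1 p.2)) ∂(B.vol.prod B.vol) := by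
  have hQ := measurable_Q B
  have hm := h1.1
  have hc := integral_congr_kernel hm.ae_eq_mk (fun x y => -(1 / 2) * Real.log (B.Q x y))
  rw [integral_congr_ae hc]
  exact integral_nonneg_of_tame_meanZero_measurable
    (k := fun x y => -(1 / 2) * Real.log (B.Q x y))
    (by unfold Function.uncurry; fun_prop) (fun M g H hg => H.log_nonneg hN hg)
    hm.stronglyMeasurable_mk.measurable (h1.congr hm.ae_eq_mk)
    (by rw [← integral_congr_ae hm.ae_eq_mk, h0]) (hi.congr hc)

end ReflPos

/-! ### Potentials which are constant on a ball -/

namespace ReflPos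

open Filter Metric
open scoped BoundedContinuousFunction RealInnerProductSpace

section Uniqueness

variable {N : ℕ} {Y : Type*} [MeasurableSpace Y] {μ : Measure Y}

/-- Weierstrass approximation turns vanishing moments into vanishing integrals. -/
theorem integral_mul_comp_eq_zero_of_moments {w v : Y → ℝ} {D : ℝ} (hw : Integrable w μ)
    (hvm : AEStronglyMeasurable v μ) (hv : ∀ᵐ y ∂μ, v y ∈ Set.Icc 0 D)
    (hmom : ∀ k : ℕ, ∫ y, w y * v y ^ k ∂μ = 0) {χ : ℝ → ℝ} (hχ : ContinuousOn χ (Set.Icc 0 D)) :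
    ∫ y, w y * χ (v y) ∂μ = 0 := by
  by_cases hi : Integrable (fun y => w y * χ (v y)) μ
  swap
  · exact integral_undef hi
  have hk : ∀ k : ℕ, Integrable (fun y => w y * v y ^ k) μ := by
    intro k
    refine hw.mul_bdd (c := D ^ k) (hvm.pow k) ?_
    filter_upwards [hv] with y hy
    rw [Real.norm_eq_abs, abs_of_nonneg (pow_nonneg hy.1 k)]
    exact pow_le_pow_left₀ hy.1 hy.2 k
  have hpi : ∀ p : Polynomial ℝ, Integrable (fun y => w y * p.eval (v y)) μ := by
    intro p
    simp_rw [Polynomial.eval_eq_sum_range, Finset.mul_sum]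
    refine integrable_finsetSum _ fun k _ => ?_
    refine ((hk k).const_mul (p.coeff k)).congr (Eventually.of_forall fun y => ?_)
    simp only; ring
  have hp0 : ∀ p : Polynomial ℝ, ∫ y, w y * p.eval (v y) ∂μ = 0 := by
    intro p
    have e : ∀ y, w y * p.eval (v y) =
        ∑ k ∈ Finset.range (p.natDegree + 1), p.coeff k * (w y * v y ^ k) := by
      intro y
      rw [Polynomial.eval_eq_sum_range, Finset.mul_sum]
      exact Finset.sum_congr rfl fun k _ => by ring
    simp_rw [e]
    rw [integral_finsetSum _ fun k _ => (hk k).const_mul _]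
    exact Finset.sum_eq_zero fun k _ => by rw [integral_const_mul, hmom, mul_zero]
  have hle : ∀ ε > 0, |∫ y, w y * χ (v y) ∂μ| ≤ ε * ∫ y, |w y| ∂μ := by
    intro ε hε
    obtain ⟨p, hp⟩ := exists_polynomial_near_of_continuousOn 0 D χ hχ ε hε
    have e : ∫ y, w y * χ (v y) ∂μ = ∫ y, (w y * χ (v y) - w y * p.eval (v y)) ∂μ := by
      rw [integral_sub hi (hpi p), hp0, sub_zero]
    rw [e, ← integral_const_mul, ← Real.norm_eq_abs]
    refine norm_integral_le_of_norm_le (hw.abs.const_mul ε) ?_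
    filter_upwards [hv] with y hy
    rw [← mul_sub, Real.norm_eq_abs, abs_mul, mul_comm, abs_sub_comm]
    exact mul_le_mul_of_nonneg_right (hp _ hy).le (abs_nonneg _)
  have hlim : Tendsto (fun ε : ℝ => ε * ∫ y, |w y| ∂μ) (nhdsWithin 0 (Set.Ioi 0)) (nhds 0) := by
    have : Tendsto (fun ε : ℝ => ε * ∫ y, |w y| ∂μ) (nhds 0) (nhds (0 * ∫ y, |w y| ∂μ)) :=
      tendsto_id.mul_const _
    rw [zero_mul] at this
    exact this.mono_left nhdsWithin_le_nhds
  have := ge_of_tendsto hlim (eventually_mem_nhdsWithin.mono fun ε hε => hle ε hε)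
  exact abs_nonpos_iff.1 this

variable {q : Y → EuclideanSpace ℝ (Fin N)} {g : Y → ℝ} {δ : ℝ}

theorem half_norm_le_norm_sub {x p : EuclideanSpace ℝ (Fin N)} (hx : x ∈ ball 0 δ)
    (hp : 2 * δ ≤ ‖p‖) : ‖p‖ / 2 ≤ ‖x - p‖ ∧ δ ≤ ‖x - p‖ := by
  have hx' : ‖x‖ < δ := by simpa using hx
  have := norm_sub_norm_le p x
  rw [norm_sub_rev] at this
  constructor <;> linarith

theorem norm_sub_sq_rpow_le {x p : EuclideanSpace ℝ (Fin N)} (hδ : 0 < δ) (hx : x ∈ ball 0 δ)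
    (hp : 2 * δ ≤ ‖p‖) {a : ℝ} (ha : a ≤ 0) :
    (‖x - p‖ ^ 2) ^ a ≤ 4 ^ (-a) * (‖p‖ ^ 2) ^ a := by
  have h1 := (half_norm_le_norm_sub hx hp).1
  have hp0 : 0 < ‖p‖ := by linarith
  have h2 : (‖p‖ / 2) ^ 2 ≤ ‖x - p‖ ^ 2 := by gcongr
  refine (Real.rpow_le_rpow_of_nonpos (by positivity) h2 ha).trans (le_of_eq ?_)
  have : (‖p‖ / 2) ^ 2 = 4⁻¹ * ‖p‖ ^ 2 := by ring
  rw [this, Real.mul_rpow (by norm_num) (by positivity), Real.inv_rpow (by norm_num),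
    Real.rpow_neg (by norm_num)]

theorem integrable_potential (hq : Measurable q) (hδ : 0 < δ) (hqδ : ∀ᵐ y ∂μ, 2 * δ ≤ ‖q y‖)
    (hg : AEStronglyMeasurable g μ) {a : ℝ} (ha : a ≤ 0)
    (hI : Integrable (fun y => g y * (‖q y‖ ^ 2) ^ a) μ) {x : EuclideanSpace ℝ (Fin N)}
    (hx : x ∈ ball 0 δ) : Integrable (fun y => g y * (‖x - q y‖ ^ 2) ^ a) μ := by
  refine (hI.abs.const_mul (4 ^ (-a))).mono' (hg.mul
    (by fun_prop : Measurable fun y => (‖x - q y‖ ^ 2) ^ a).aestronglyMeasurable) ?_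
  filter_upwards [hqδ] with y hy
  have := norm_sub_sq_rpow_le hδ hx hy ha
  have h0 : 0 ≤ (‖x - q y‖ ^ 2) ^ a := by positivity
  have h1 : 0 ≤ (‖q y‖ ^ 2) ^ a := by positivity
  rw [Real.norm_eq_abs, abs_mul, abs_mul, abs_of_nonneg h0, abs_of_nonneg h1]
  calc |g y| * (‖x - q y‖ ^ 2) ^ a ≤ |g y| * (4 ^ (-a) * (‖q y‖ ^ 2) ^ a) := by gcongr
    _ = _ := by ring

theorem integrable_rpow_of_le (hq : Measurable q) (hδ : 0 < δ) (hqδ : ∀ᵐ y ∂μ, 2 * δ ≤ ‖q y‖)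
    {a b : ℝ} (hab : b ≤ a)
    (hI : Integrable (fun y => g y * (‖q y‖ ^ 2) ^ a) μ) :
    Integrable (fun y => g y * (‖q y‖ ^ 2) ^ b) μ := by
  refine (hI.mul_bdd (c := ((2 * δ) ^ 2) ^ (b - a))
    (by fun_prop : Measurable fun y => (‖q y‖ ^ 2) ^ (b - a)).aestronglyMeasurable ?_).congr ?_
  · filter_upwards [hqδ] with y hy
    rw [Real.norm_eq_abs, abs_of_nonneg (by positivity)]
    exact Real.rpow_le_rpow_of_nonpos (by positivity) (by gcongr) (by linarith)
  · filter_upwards [hqδ] with y hy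
    have : 0 < ‖q y‖ := by linarith
    rw [mul_assoc, ← Real.rpow_add (by positivity)]
    congr 2; ring

theorem hasDerivAt_norm_line_sq (x e p : EuclideanSpace ℝ (Fin N)) (τ : ℝ) :
    HasDerivAt (fun τ : ℝ => ‖x + τ • e - p‖ ^ 2) (2 * ⟪x + τ • e - p, e⟫) τ := by
  have : HasDerivAt (fun τ : ℝ => x + τ • e - p) e τ := by
    simpa using (((hasDerivAt_id τ).smul_const e).const_add x).sub_const p
  exact this.norm_sq

/-- Differentiation under the integral sign of an integral that does not depend on the
parameter. -/
theorem integral_deriv_eq_zero {F F' : ℝ → Y → ℝ} {η c : ℝ} {bound : Y → ℝ} (hη : 0 < η)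
    (hF : ∀ τ ∈ ball 0 η, Integrable (F τ) μ) (hc : ∀ τ ∈ ball 0 η, ∫ y, F τ y ∂μ = c)
    (hF' : AEStronglyMeasurable (F' 0) μ)
    (hb : ∀ᵐ y ∂μ, ∀ τ ∈ ball (0 : ℝ) η, ‖F' τ y‖ ≤ bound y) (hbi : Integrable bound μ)
    (hd : ∀ᵐ y ∂μ, ∀ τ ∈ ball (0 : ℝ) η, HasDerivAt (F · y) (F' τ y) τ) :
    ∫ y, F' 0 y ∂μ = 0 := by
  have hs : ball (0 : ℝ) η ∈ nhds 0 := ball_mem_nhds 0 hη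
  have h := (hasDerivAt_integral_of_dominated_loc_of_deriv_le hs
    (by filter_upwards [hs] with τ hτ using (hF τ hτ).1) (hF 0 (mem_ball_self hη)) hF' hb hbi
    hd).2
  have h2 : HasDerivAt (fun τ => ∫ y, F τ y ∂μ) 0 0 :=
    (hasDerivAt_const (0 : ℝ) c).congr_of_eventuallyEq (by filter_upwards [hs] with τ hτ using hc τ hτ)
  exact h.unique h2

theorem line_mem_ball {x e : EuclideanSpace ℝ (Fin N)} (he : ‖e‖ = 1) {τ : ℝ}
    (hτ : τ ∈ ball 0 (δ - ‖x‖)) : x + τ • e ∈ ball 0 δ := by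
  rw [mem_ball_zero_iff] at hτ ⊢
  have := norm_add_le x (τ • e)
  rw [norm_smul, he, mul_one] at this
  linarith

/-- If `x ↦ ∫ g (ψ(|x - q|²) + m)` is constant near `0`, where `ψ' = κ s ^ b`, then applying the
Laplacian gives `(N + 2 b) ∫ g |x - q| ^ (2 b) = 0`. -/
theorem potential_laplacian_eq_zero (hq : Measurable q) (hδ : 0 < δ)
    (hqδ : ∀ᵐ y ∂μ, 2 * δ ≤ ‖q y‖) (hg : AEStronglyMeasurable g μ) {b κ c : ℝ} (hb : b ≤ -1)
    (hN : (N : ℝ) + 2 * b ≠ 0) (hκ : κ ≠ 0) {ψ : ℝ → ℝ} {m : Y → ℝ}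
    (hψ : ∀ s > 0, HasDerivAt ψ (κ * s ^ b) s)
    (hI : Integrable (fun y => g y * (‖q y‖ ^ 2) ^ (b + 1)) μ)
    (hψI : ∀ x ∈ ball (0 : EuclideanSpace ℝ (Fin N)) δ,
      Integrable (fun y => g y * (ψ (‖x - q y‖ ^ 2) + m y)) μ)
    (hc : ∀ x ∈ ball (0 : EuclideanSpace ℝ (Fin N)) δ, ∫ y, g y * (ψ (‖x - q y‖ ^ 2) + m y) ∂μ = c)
    {x : EuclideanSpace ℝ (Fin N)} (hx : x ∈ ball 0 δ) :
    ∫ y, g y * (‖x - q y‖ ^ 2) ^ b ∂μ = 0 := by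
  have hI' := hI.abs
  have bnd : ∀ z ∈ ball (0 : EuclideanSpace ℝ (Fin N)) δ, ∀ y, 2 * δ ≤ ‖q y‖ →
      |g y| * (‖z - q y‖ ^ 2) ^ (b + 1) ≤ 4 ^ (-(b + 1)) * |g y * (‖q y‖ ^ 2) ^ (b + 1)| := by
    intro z hz y hy
    rw [abs_mul, abs_of_nonneg (by positivity : 0 ≤ (‖q y‖ ^ 2) ^ (b + 1))]
    have := norm_sub_sq_rpow_le hδ hz hy (by linarith : b + 1 ≤ 0)
    calc _ ≤ |g y| * (4 ^ (-(b + 1)) * (‖q y‖ ^ 2) ^ (b + 1)) := by gcongr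
      _ = _ := by ring
  have split : ∀ z ∈ ball (0 : EuclideanSpace ℝ (Fin N)) δ, ∀ y, 2 * δ ≤ ‖q y‖ →
      (‖z - q y‖ ^ 2) ^ (b + 1) = (‖z - q y‖ ^ 2) ^ b * ‖z - q y‖ ^ 2 := by
    intro z hz y hy
    have := (half_norm_le_norm_sub hz hy).2
    rw [Real.rpow_add (by have : 0 < ‖z - q y‖ := by linarith
                          positivity), Real.rpow_one]
  have splitb : ∀ z ∈ ball (0 : EuclideanSpace ℝ (Fin N)) δ, ∀ y, 2 * δ ≤ ‖q y‖ →
      (‖z - q y‖ ^ 2) ^ b = (‖z - q y‖ ^ 2) ^ (b - 1) * ‖z - q y‖ ^ 2 := by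
    intro z hz y hy
    have := (half_norm_le_norm_sub hz hy).2
    have h0 : 0 < ‖z - q y‖ ^ 2 := by
      have : 0 < ‖z - q y‖ := by linarith
      positivity
    nth_rewrite 3 [← Real.rpow_one (‖z - q y‖ ^ 2)]
    rw [← Real.rpow_add h0]; congr 1; ring
  -- the gradient of the potential vanishes
  have grad : ∀ e : EuclideanSpace ℝ (Fin N), ‖e‖ = 1 → ∀ z ∈ ball (0 : EuclideanSpace ℝ (Fin N)) δ,
      Integrable (fun y => g y * ((‖z - q y‖ ^ 2) ^ b * ⟪z - q y, e⟫)) μ ∧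
      ∫ y, g y * ((‖z - q y‖ ^ 2) ^ b * ⟪z - q y, e⟫) ∂μ = 0 := by
    intro e he z hz
    have hb1 : ∀ z ∈ ball (0 : EuclideanSpace ℝ (Fin N)) δ, ∀ y, 2 * δ ≤ ‖q y‖ →
        |g y * ((‖z - q y‖ ^ 2) ^ b * ⟪z - q y, e⟫)| ≤
          δ⁻¹ * (4 ^ (-(b + 1)) * |g y * (‖q y‖ ^ 2) ^ (b + 1)|) := by
      intro z hz y hy
      refine le_trans ?_ (mul_le_mul_of_nonneg_left (bnd z hz y hy) (by positivity))
      rw [split z hz y hy, abs_mul, abs_mul,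
        abs_of_nonneg (by positivity : 0 ≤ (‖z - q y‖ ^ 2) ^ b)]
      have h1 := abs_real_inner_le_norm (z - q y) e
      rw [he, mul_one] at h1
      have h2 : ‖z - q y‖ ≤ δ⁻¹ * ‖z - q y‖ ^ 2 := by
        have := (half_norm_le_norm_sub hz hy).2
        rw [inv_mul_eq_div, le_div_iff₀ hδ]; nlinarith [norm_nonneg (z - q y)]
      calc |g y| * ((‖z - q y‖ ^ 2) ^ b * |⟪z - q y, e⟫|)
          ≤ |g y| * ((‖z - q y‖ ^ 2) ^ b * (δ⁻¹ * ‖z - q y‖ ^ 2)) := by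
            gcongr; exact h1.trans h2
        _ = _ := by ring
    have hm : ∀ z, AEStronglyMeasurable (fun y => g y * ((‖z - q y‖ ^ 2) ^ b * ⟪z - q y, e⟫)) μ :=
      fun z => hg.mul (by fun_prop :
        Measurable fun y => (‖z - q y‖ ^ 2) ^ b * ⟪z - q y, e⟫).aestronglyMeasurable
    refine ⟨((hI'.const_mul _).const_mul _).mono' (hm z)
      (by filter_upwards [hqδ] with y hy using hb1 z hz y hy), ?_⟩
    have hη : 0 < δ - ‖z‖ := by rw [mem_ball_zero_iff] at hz; linarith
    have key := integral_deriv_eq_zero (μ := μ) (F := fun τ y => g y * (ψ (‖z + τ • e - q y‖ ^ 2) + m y))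
      (F' := fun τ y => g y * (κ * (‖z + τ • e - q y‖ ^ 2) ^ b * (2 * ⟪z + τ • e - q y, e⟫)))
      (c := c) (bound := fun y => (2 * |κ|) *
        (δ⁻¹ * (4 ^ (-(b + 1)) * |g y * (‖q y‖ ^ 2) ^ (b + 1)|))) hη
      (fun τ hτ => hψI _ (line_mem_ball he hτ)) (fun τ hτ => hc _ (line_mem_ball he hτ))
      (hg.mul (by fun_prop : Measurable fun y =>
        κ * (‖z + (0 : ℝ) • e - q y‖ ^ 2) ^ b * (2 * ⟪z + (0 : ℝ) • e - q y, e⟫)).aestronglyMeasurable)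
      (by
        filter_upwards [hqδ] with y hy τ hτ
        have := hb1 _ (line_mem_ball he hτ) y hy
        have e1 : g y * (κ * (‖z + τ • e - q y‖ ^ 2) ^ b * (2 * ⟪z + τ • e - q y, e⟫)) =
          (2 * κ) * (g y * ((‖z + τ • e - q y‖ ^ 2) ^ b * ⟪z + τ • e - q y, e⟫)) := by ring
        rw [e1, Real.norm_eq_abs, abs_mul, abs_mul, abs_two]
        gcongr)
      (((hI'.const_mul _).const_mul _).const_mul _)
      (by
        filter_upwards [hqδ] with y hy τ hτ
        have h1 := (half_norm_le_norm_sub (line_mem_ball he hτ) hy).2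
        have h2 : 0 < ‖z + τ • e - q y‖ ^ 2 := by
          have : 0 < ‖z + τ • e - q y‖ := by linarith
          positivity
        exact (((hψ _ h2).comp τ (hasDerivAt_norm_line_sq z e (q y) τ)).add_const (m y)).const_mul (g y))
    have e2 : ∀ y, g y * (κ * (‖z + (0 : ℝ) • e - q y‖ ^ 2) ^ b * (2 * ⟪z + (0 : ℝ) • e - q y, e⟫))
        = (2 * κ) * (g y * ((‖z - q y‖ ^ 2) ^ b * ⟪z - q y, e⟫)) := by
      intro y; rw [zero_smul, add_zero]; ring
    simp_rw [e2] at key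
    rw [integral_const_mul] at key
    exact (mul_eq_zero.1 key).resolve_left (by positivity)
  have hIb : Integrable (fun y => g y * (‖x - q y‖ ^ 2) ^ b) μ :=
    integrable_potential hq hδ hqδ hg (by linarith)
      (integrable_rpow_of_le hq hδ hqδ (by linarith) hI) hx
  -- the pure second derivatives vanish
  have hess : ∀ e : EuclideanSpace ℝ (Fin N), ‖e‖ = 1 →
      Integrable (fun y => g y * ((‖x - q y‖ ^ 2) ^ (b - 1) * ⟪x - q y, e⟫ ^ 2)) μ ∧
      ∫ y, g y * ((‖x - q y‖ ^ 2) ^ b) ∂μ +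
        2 * b * ∫ y, g y * ((‖x - q y‖ ^ 2) ^ (b - 1) * ⟪x - q y, e⟫ ^ 2) ∂μ = 0 := by
    intro e he
    have hb2 : ∀ z ∈ ball (0 : EuclideanSpace ℝ (Fin N)) δ, ∀ y, 2 * δ ≤ ‖q y‖ →
        |g y * (‖z - q y‖ ^ 2) ^ b| ≤
          δ⁻¹ ^ 2 * (4 ^ (-(b + 1)) * |g y * (‖q y‖ ^ 2) ^ (b + 1)|) := by
      intro z hz y hy
      refine le_trans ?_ (mul_le_mul_of_nonneg_left (bnd z hz y hy) (by positivity))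
      rw [split z hz y hy, abs_mul,
        abs_of_nonneg (by positivity : 0 ≤ (‖z - q y‖ ^ 2) ^ b)]
      have h2 : 1 ≤ δ⁻¹ ^ 2 * ‖z - q y‖ ^ 2 := by
        have := (half_norm_le_norm_sub hz hy).2
        rw [← mul_pow]
        refine one_le_pow₀ ?_
        rwa [inv_mul_eq_div, one_le_div hδ]
      calc |g y| * (‖z - q y‖ ^ 2) ^ b = |g y| * (‖z - q y‖ ^ 2) ^ b * 1 := (mul_one _).symm
        _ ≤ |g y| * (‖z - q y‖ ^ 2) ^ b * (δ⁻¹ ^ 2 * ‖z - q y‖ ^ 2) := by gcongr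
        _ = _ := by ring
    have hb3 : ∀ z ∈ ball (0 : EuclideanSpace ℝ (Fin N)) δ, ∀ y, 2 * δ ≤ ‖q y‖ →
        |g y * ((‖z - q y‖ ^ 2) ^ (b - 1) * ⟪z - q y, e⟫ ^ 2)| ≤
          δ⁻¹ ^ 2 * (4 ^ (-(b + 1)) * |g y * (‖q y‖ ^ 2) ^ (b + 1)|) := by
      intro z hz y hy
      refine le_trans ?_ (hb2 z hz y hy)
      rw [splitb z hz y hy, abs_mul,
        abs_of_nonneg (by positivity : 0 ≤ (‖z - q y‖ ^ 2) ^ (b - 1) * ⟪z - q y, e⟫ ^ 2), abs_mul,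
        abs_of_nonneg (by positivity : 0 ≤ (‖z - q y‖ ^ 2) ^ (b - 1) * ‖z - q y‖ ^ 2)]
      have h1 := abs_real_inner_le_norm (z - q y) e
      rw [he, mul_one] at h1
      have : ⟪z - q y, e⟫ ^ 2 ≤ ‖z - q y‖ ^ 2 := by
        rw [← sq_abs]; gcongr
      gcongr
    have hi3 : Integrable (fun y => g y * ((‖x - q y‖ ^ 2) ^ (b - 1) * ⟪x - q y, e⟫ ^ 2)) μ :=
      ((hI'.const_mul _).const_mul _).mono' (hg.mul (by fun_prop :
        Measurable fun y => (‖x - q y‖ ^ 2) ^ (b - 1) * ⟪x - q y, e⟫ ^ 2).aestronglyMeasurable)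
        (by filter_upwards [hqδ] with y hy using hb3 x hx y hy)
    refine ⟨hi3, ?_⟩
    have hη : 0 < δ - ‖x‖ := by rw [mem_ball_zero_iff] at hx; linarith
    have key := integral_deriv_eq_zero (μ := μ)
      (F := fun τ y => g y * ((‖x + τ • e - q y‖ ^ 2) ^ b * ⟪x + τ • e - q y, e⟫))
      (F' := fun τ y => g y * (2 * ⟪x + τ • e - q y, e⟫ * b * (‖x + τ • e - q y‖ ^ 2) ^ (b - 1) *
        ⟪x + τ • e - q y, e⟫ + (‖x + τ • e - q y‖ ^ 2) ^ b * 1))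
      (c := 0) (bound := fun y => (2 * |b| + 1) *
        (δ⁻¹ ^ 2 * (4 ^ (-(b + 1)) * |g y * (‖q y‖ ^ 2) ^ (b + 1)|))) hη
      (fun τ hτ => (grad e he _ (line_mem_ball he hτ)).1)
      (fun τ hτ => (grad e he _ (line_mem_ball he hτ)).2)
      (hg.mul (by fun_prop : Measurable fun y =>
        2 * ⟪x + (0 : ℝ) • e - q y, e⟫ * b * (‖x + (0 : ℝ) • e - q y‖ ^ 2) ^ (b - 1) *
        ⟪x + (0 : ℝ) • e - q y, e⟫ + (‖x + (0 : ℝ) • e - q y‖ ^ 2) ^ b * 1).aestronglyMeasurable)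
      (by
        filter_upwards [hqδ] with y hy τ hτ
        have h2 := hb2 _ (line_mem_ball he hτ) y hy
        have h3 := hb3 _ (line_mem_ball he hτ) y hy
        set z := x + τ • e
        have e1 : g y * (2 * ⟪z - q y, e⟫ * b * (‖z - q y‖ ^ 2) ^ (b - 1) *
            ⟪z - q y, e⟫ + (‖z - q y‖ ^ 2) ^ b * 1) =
          (2 * b) * (g y * ((‖z - q y‖ ^ 2) ^ (b - 1) * ⟪z - q y, e⟫ ^ 2)) +
            g y * (‖z - q y‖ ^ 2) ^ b := by ring
        rw [e1, Real.norm_eq_abs]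
        refine (abs_add_le _ _).trans ?_
        rw [abs_mul, abs_mul, abs_two, add_mul, one_mul]
        gcongr)
      (((hI'.const_mul _).const_mul _).const_mul _)
      (by
        filter_upwards [hqδ] with y hy τ hτ
        have h1 := (half_norm_le_norm_sub (line_mem_ball he hτ) hy).2
        have h2 : ‖x + τ • e - q y‖ ^ 2 ≠ 0 := by
          have : 0 < ‖x + τ • e - q y‖ := by linarith
          positivity
        have hl : HasDerivAt (fun τ : ℝ => ⟪x + τ • e - q y, e⟫) 1 τ := by
          have : HasDerivAt (fun τ : ℝ => x + τ • e - q y) e τ := by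
            simpa using (((hasDerivAt_id τ).smul_const e).const_add x).sub_const (q y)
          have h := this.inner ℝ (hasDerivAt_const τ e)
          simpa [he] using h
        exact (((hasDerivAt_norm_line_sq x e (q y) τ).rpow_const (Or.inl h2)).mul hl).const_mul
          (g y))
    have e2 : ∀ y, g y * (2 * ⟪x + (0 : ℝ) • e - q y, e⟫ * b *
        (‖x + (0 : ℝ) • e - q y‖ ^ 2) ^ (b - 1) *
        ⟪x + (0 : ℝ) • e - q y, e⟫ + (‖x + (0 : ℝ) • e - q y‖ ^ 2) ^ b * 1)
        = g y * (‖x - q y‖ ^ 2) ^ b +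
          (2 * b) * (g y * ((‖x - q y‖ ^ 2) ^ (b - 1) * ⟪x - q y, e⟫ ^ 2)) := by
      intro y; rw [zero_smul, add_zero]; ring
    simp_rw [e2] at key
    rwa [integral_add hIb (hi3.const_mul _), integral_const_mul] at key
  -- summing over an orthonormal basis
  let E := EuclideanSpace.basisFun (Fin N) ℝ
  have hE : ∀ i, ‖E i‖ = 1 := fun i => E.orthonormal.1 i
  have hsum : ∑ i, ∫ y, g y * ((‖x - q y‖ ^ 2) ^ (b - 1) * ⟪x - q y, E i⟫ ^ 2) ∂μ =
      ∫ y, g y * (‖x - q y‖ ^ 2) ^ b ∂μ := by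
    rw [← integral_finsetSum _ fun i _ => (hess (E i) (hE i)).1]
    refine integral_congr_ae ?_
    filter_upwards [hqδ] with y hy
    rw [← Finset.mul_sum, ← Finset.mul_sum, E.sum_sq_inner_left, splitb x hx y hy]
  have h := Finset.sum_eq_zero (s := Finset.univ) fun i _ => (hess (E i) (hE i)).2
  rw [Finset.sum_add_distrib, ← Finset.mul_sum, hsum, Finset.sum_const, Finset.card_univ,
    Fintype.card_fin, nsmul_eq_mul, ← add_mul] at h
  exact (mul_eq_zero.1 h).resolve_left hN

end Uniqueness

end ReflPos

/-! ### Unique continuation for potentials -/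

namespace ReflPos

open Filter Metric
open scoped BoundedContinuousFunction RealInnerProductSpace

section Uniqueness

variable {N : ℕ} {Y : Type*} [MeasurableSpace Y] {μ : Measure Y}
  {q : Y → EuclideanSpace ℝ (Fin N)} {g : Y → ℝ} {δ : ℝ}

theorem continuousOn_rpow_mul_exp_neg_div (b : ℝ) (hb : b ≠ 0) {t : ℝ} (ht : 0 < t) (D : ℝ) :
    ContinuousOn (fun s : ℝ => s ^ b * Real.exp (-t / s)) (Set.Icc 0 D) := by
  intro s hs
  rcases hs.1.eq_or_lt with h0 | h0
  · subst h0
    have h1 : Tendsto (fun s : ℝ => s ^ b * Real.exp (-t / s)) (nhdsWithin 0 (Set.Ioi 0))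
        (nhds 0) := by
      have h := (tendsto_rpow_mul_exp_neg_mul_atTop_nhds_zero (-b) t ht).comp tendsto_inv_nhdsGT_zero
      refine h.congr' ?_
      filter_upwards [self_mem_nhdsWithin] with s hs
      have hs : 0 < s := hs
      simp only [Function.comp_apply]
      rw [Real.inv_rpow hs.le, Real.rpow_neg hs.le, inv_inv, div_eq_mul_inv]
    have h2 : ContinuousWithinAt (fun s : ℝ => s ^ b * Real.exp (-t / s)) (Set.Ioi 0) 0 := by
      unfold ContinuousWithinAt
      simpa [Real.zero_rpow hb] using h1
    have h3 := continuousWithinAt_insert_self.2 h2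
    refine h3.mono fun x hx => ?_
    rcases hx.1.eq_or_lt with h | h
    · exact Or.inl h.symm
    · exact Or.inr h
  · refine ContinuousAt.continuousWithinAt ?_
    exact (Real.continuousAt_rpow_const _ _ (Or.inl h0.ne')).mul
      (Real.continuous_exp.continuousAt.comp (continuousAt_const.div continuousAt_id h0.ne'))

/-- If all the inverse-power moments of `g` about `x` vanish, so do the Gaussian ones. -/
theorem gaussian_eq_zero_of_potentials (hq : Measurable q) (hδ : 0 < δ)
    (hqδ : ∀ᵐ y ∂μ, 2 * δ ≤ ‖q y‖) (hg : AEStronglyMeasurable g μ) {b : ℝ} (hb : b < 0)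
    (hI : Integrable (fun y => g y * (‖q y‖ ^ 2) ^ b) μ) {x : EuclideanSpace ℝ (Fin N)}
    (hx : x ∈ ball 0 δ) (h : ∀ k : ℕ, ∫ y, g y * (‖x - q y‖ ^ 2) ^ (b - k) ∂μ = 0)
    {t : ℝ} (ht : 0 < t) : ∫ y, g y * Real.exp (-t * ‖x - q y‖ ^ 2) ∂μ = 0 := by
  have hpos : ∀ᵐ y ∂μ, δ ≤ ‖x - q y‖ ∧ 0 < ‖x - q y‖ ^ 2 := by
    filter_upwards [hqδ] with y hy
    have := (half_norm_le_norm_sub hx hy).2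
    refine ⟨this, ?_⟩
    have : 0 < ‖x - q y‖ := by linarith
    positivity
  have key := integral_mul_comp_eq_zero_of_moments (μ := μ) (D := (δ ^ 2)⁻¹)
    (v := fun y => (‖x - q y‖ ^ 2)⁻¹)
    (integrable_potential hq hδ hqδ hg hb.le hI hx)
    (by fun_prop : Measurable fun y => (‖x - q y‖ ^ 2)⁻¹).aestronglyMeasurable
    (by
      filter_upwards [hpos] with y hy
      refine ⟨by positivity, inv_anti₀ (by positivity) (by have := hy.1; gcongr)⟩)
    (fun k => by
      rw [← h k]
      refine integral_congr_ae ?_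
      filter_upwards [hpos] with y hy
      rw [Real.rpow_sub_natCast hy.2.ne', inv_pow]
      ring)
    (continuousOn_rpow_mul_exp_neg_div b hb.ne ht _)
  rw [← key]
  refine integral_congr_ae ?_
  filter_upwards [hpos] with y hy
  have h1 : (‖x - q y‖ ^ 2) ^ b ≠ 0 := (Real.rpow_pos_of_pos hy.2 b).ne'
  rw [Real.inv_rpow hy.2.le, div_inv_eq_mul]
  field_simp

/-- The Gaussians `exp (-t |p|² + p · v)` with `t ≥ 0` and `|v| ≤ t δ`. They are closed under
multiplication. -/
def gaussians (N : ℕ) (δ : ℝ) : Set (EuclideanSpace ℝ (Fin N) →ᵇ ℝ) :=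
  {φ | ∃ (t : ℝ) (v : EuclideanSpace ℝ (Fin N)), 0 ≤ t ∧ ‖v‖ ≤ t * δ ∧
    ∀ p, φ p = Real.exp (-t * ‖p‖ ^ 2 + ⟪p, v⟫)}

theorem exists_gaussian {t : ℝ} {v : EuclideanSpace ℝ (Fin N)} (ht : 0 ≤ t) (hv : ‖v‖ ≤ t * δ) :
    ∃ φ ∈ gaussians N δ, ∀ p, φ p = Real.exp (-t * ‖p‖ ^ 2 + ⟪p, v⟫) := by
  refine ⟨BoundedContinuousFunction.ofNormedAddCommGroup
    (fun p => Real.exp (-t * ‖p‖ ^ 2 + ⟪p, v⟫)) (by fun_prop) (Real.exp (t * δ ^ 2))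
    fun p => ?_, ⟨t, v, ht, hv, fun p => rfl⟩, fun p => rfl⟩
  rw [Real.norm_eq_abs, Real.abs_exp, Real.exp_le_exp]
  have h1 := real_inner_le_norm p v
  have h2 : ‖p‖ * ‖v‖ ≤ ‖p‖ * (t * δ) := by gcongr
  nlinarith [mul_nonneg ht (sq_nonneg (‖p‖ - δ)), mul_nonneg ht (sq_nonneg (‖p‖)),
    mul_nonneg ht (sq_nonneg δ)]

/-- The Gaussians as a multiplicative submonoid. -/
noncomputable def gaussianSubmonoid (N : ℕ) (δ : ℝ) : Submonoid (EuclideanSpace ℝ (Fin N) →ᵇ ℝ) where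
  carrier := gaussians N δ
  one_mem' := ⟨0, 0, le_rfl, by simp, fun p => by simp⟩
  mul_mem' := by
    rintro φ χ ⟨t, v, ht, hv, hφ⟩ ⟨s, w, hs, hw, hχ⟩
    refine ⟨t + s, v + w, by positivity, (norm_add_le _ _).trans (by linarith), fun p => ?_⟩
    rw [BoundedContinuousFunction.mul_apply, hφ, hχ, ← Real.exp_add, inner_add_right]
    congr 1; ring

/-- The algebra spanned by the Gaussians. -/
noncomputable def gaussianAlgebra (N : ℕ) (δ : ℝ) : StarSubalgebra ℝ (EuclideanSpace ℝ (Fin N) →ᵇ ℝ) where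
  toSubalgebra := Algebra.adjoin ℝ (gaussianSubmonoid N δ : Set (EuclideanSpace ℝ (Fin N) →ᵇ ℝ))
  star_mem' := by
    intro a ha
    have : star a = a := by ext p; simp
    rwa [this]

theorem gaussianAlgebra_separatesPoints (hδ : 0 < δ) :
    ((gaussianAlgebra N δ).map
      (BoundedContinuousFunction.toContinuousMapStarₐ ℝ)).SeparatesPoints := by
  intro x y hxy
  obtain ⟨φ, hφ, hφe⟩ := exists_gaussian (N := N) (δ := δ) (t := 1) (v := 0) zero_le_one
    (by simpa using hδ.le)
  have hn : 0 < ‖x - y‖ := norm_pos_iff.2 (sub_ne_zero.2 hxy)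
  obtain ⟨χ, hχ, hχe⟩ := exists_gaussian (N := N) (δ := δ) (t := 1) (v := (δ / ‖x - y‖) • (x - y))
    zero_le_one (by
      rw [norm_smul, Real.norm_of_nonneg (by positivity), div_mul_cancel₀ _ hn.ne', one_mul])
  by_contra! hcon
  have mem : ∀ ξ ∈ gaussians N δ, ξ x = ξ y := by
    intro ξ hξ
    refine hcon ξ ⟨BoundedContinuousFunction.toContinuousMapStarₐ ℝ ξ, ?_, rfl⟩
    exact ⟨ξ, Algebra.subset_adjoin hξ, rfl⟩
  have h1 := mem φ hφ
  have h2 := mem χ hχ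
  rw [hφe, hφe, Real.exp_eq_exp, inner_zero_right, inner_zero_right] at h1
  rw [hχe, hχe, Real.exp_eq_exp, inner_smul_right, inner_smul_right] at h2
  have h3 : δ / ‖x - y‖ * (⟪x, x - y⟫ - ⟪y, x - y⟫) = 0 := by linarith
  rw [← inner_sub_left, real_inner_self_eq_norm_sq] at h3
  have : 0 < δ / ‖x - y‖ * ‖x - y‖ ^ 2 := by positivity
  exact this.ne' h3

/-- Gaussians centred at the points of a ball separate the finite signed measures, hence also the
densities with respect to `μ` when `q` is essentially invertible. -/
theorem ae_eq_zero_of_gaussian_eq_zero (hq : Measurable q) (hδ : 0 < δ)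
    {R : EuclideanSpace ℝ (Fin N) → Y} (hR : Measurable R) (hRq : ∀ᵐ y ∂μ, R (q y) = y)
    (hI : Integrable (fun y => g y * Real.exp (-‖q y‖ ^ 2)) μ)
    (h : ∀ t > 0, ∀ v : EuclideanSpace ℝ (Fin N), ‖v‖ ≤ t * δ →
      ∫ y, g y * Real.exp (-t * ‖q y‖ ^ 2 + ⟪q y, v⟫) ∂μ = 0) : g =ᵐ[μ] 0 := by
  set G : Y → ℝ := fun y => g y * Real.exp (-‖q y‖ ^ 2) with hG
  have hGm := hI.aestronglyMeasurable
  -- the positive and the negative part of `G μ` have the same integrals against Gaussians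
  let P : Measure Y := μ.withDensity fun y => ENNReal.ofReal (G y)
  let P' : Measure Y := μ.withDensity fun y => ENNReal.ofReal (-G y)
  have hf : IsFiniteMeasure P := isFiniteMeasure_withDensity_ofReal hI.2
  have hf' : IsFiniteMeasure P' := isFiniteMeasure_withDensity_ofReal hI.neg.2
  have hmP : AEMeasurable (fun y => ENNReal.ofReal (G y)) μ := hGm.aemeasurable.ennreal_ofReal
  have hmP' : AEMeasurable (fun y => ENNReal.ofReal (-G y)) μ :=
    hGm.aemeasurable.neg.ennreal_ofReal
  have hdiff : ∀ φ : EuclideanSpace ℝ (Fin N) →ᵇ ℝ,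
      ∫ p, φ p ∂(P.map q) - ∫ p, φ p ∂(P'.map q) = ∫ y, G y * φ (q y) ∂μ := by
    intro φ
    have hφm : Measurable φ := φ.continuous.measurable
    have hbd : ∀ F : Y → ℝ, Integrable F μ → Integrable (fun y => F y * φ (q y)) μ := fun F hF =>
      hF.mul_bdd (c := ‖φ‖) (hφm.comp hq).aestronglyMeasurable
        (Eventually.of_forall fun y => φ.norm_coe_le_norm _)
    rw [integral_map hq.aemeasurable hφm.aestronglyMeasurable,
      integral_map hq.aemeasurable hφm.aestronglyMeasurable,
      integral_withDensity_eq_integral_toReal_smul₀ hmP (by simp),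
      integral_withDensity_eq_integral_toReal_smul₀ hmP' (by simp)]
    simp only [smul_eq_mul, ENNReal.toReal_ofReal']
    rw [← integral_sub (hbd _ hI.pos_part) (hbd _ hI.neg_part)]
    refine integral_congr_ae (Eventually.of_forall fun y => ?_)
    simp only
    rw [← sub_mul]
    congr 1
    rcases le_total 0 (G y) with hx | hx
    · rw [max_eq_left hx, max_eq_right (by linarith)]; ring
    · rw [max_eq_right hx, max_eq_left (by linarith)]; ring
  have hmap : P.map q = P'.map q := by
    refine ext_of_forall_mem_subalgebra_integral_eq_of_polish (𝕜 := ℝ)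
      (gaussianAlgebra_separatesPoints (N := N) hδ) fun φ hφ => ?_
    rw [← sub_eq_zero, hdiff]
    have hφ' : φ ∈ Submodule.span ℝ (gaussians N δ) := by
      have h1 : φ ∈ Subalgebra.toSubmodule (Algebra.adjoin ℝ
        (gaussianSubmonoid N δ : Set (EuclideanSpace ℝ (Fin N) →ᵇ ℝ))) := hφ
      rw [Algebra.adjoin_eq_span, Submonoid.closure_eq] at h1
      exact h1
    clear hφ
    have hbd : ∀ φ : EuclideanSpace ℝ (Fin N) →ᵇ ℝ, Integrable (fun y => G y * φ (q y)) μ :=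
      fun φ => hI.mul_bdd (c := ‖φ‖)
        (φ.continuous.measurable.comp hq).aestronglyMeasurable
        (Eventually.of_forall fun y => φ.norm_coe_le_norm _)
    induction hφ' using Submodule.span_induction with
    | mem φ hφ =>
      obtain ⟨t, v, ht, hv, he⟩ := hφ
      rw [← h (t + 1) (by positivity) v (by nlinarith)]
      refine integral_congr_ae (Eventually.of_forall fun y => ?_)
      simp only [hG, he]
      rw [mul_assoc, ← Real.exp_add]
      congr 2; ring
    | zero => simp
    | add φ χ _ _ h1 h2 =>
      simp only [BoundedContinuousFunction.add_apply, mul_add]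
      rw [integral_add (hbd φ) (hbd χ), h1, h2, add_zero]
    | smul c φ _ h1 =>
      simp only [BoundedContinuousFunction.smul_apply, smul_eq_mul]
      have : ∀ y, G y * (c * φ (q y)) = c * (G y * φ (q y)) := fun y => by ring
      simp_rw [this]
      rw [integral_const_mul, h1, mul_zero]
  have hback : ∀ {ν : Measure Y}, ν ≪ μ → (ν.map q).map R = ν := by
    intro ν hν
    rw [Measure.map_map hR hq]
    have : R ∘ q =ᵐ[ν] id := hν.ae_le hRq
    rw [Measure.map_congr this, Measure.map_id]
  have hPP : P = P' := by
    have h1 : P ≪ μ := withDensity_absolutelyContinuous μ _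
    have h2 : P' ≪ μ := withDensity_absolutelyContinuous μ _
    rw [← hback h1, hmap, hback h2]
  have hden := (withDensity_eq_iff hmP hmP' (by
    have := hf.measure_univ_lt_top
    simpa [P] using this.ne)).1 hPP
  filter_upwards [hden] with y hy
  have hGy : G y = 0 := by
    rcases le_total 0 (G y) with h0 | h0
    · rw [ENNReal.ofReal_of_nonpos (by linarith : -G y ≤ 0), ENNReal.ofReal_eq_zero] at hy
      exact le_antisymm hy h0
    · rw [ENNReal.ofReal_of_nonpos h0, eq_comm, ENNReal.ofReal_eq_zero] at hy
      linarith
  exact (mul_eq_zero.1 hGy).resolve_right (Real.exp_ne_zero _)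

/-- Unique continuation: a density is determined by its potential near a point away from
the support. -/
theorem ae_eq_zero_of_potential_const (hq : Measurable q) (hδ : 0 < δ)
    (hqδ : ∀ᵐ y ∂μ, 2 * δ ≤ ‖q y‖) {R : EuclideanSpace ℝ (Fin N) → Y} (hR : Measurable R)
    (hRq : ∀ᵐ y ∂μ, R (q y) = y) (hg : AEStronglyMeasurable g μ) {b κ c : ℝ} (hb : b ≤ -1)
    (hN : (N : ℝ) + 2 * b < 0) (hκ : κ ≠ 0) {ψ : ℝ → ℝ} {m : Y → ℝ}
    (hψ : ∀ s > 0, HasDerivAt ψ (κ * s ^ b) s)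
    (hI : Integrable (fun y => g y * (‖q y‖ ^ 2) ^ (b + 1)) μ)
    (hψI : ∀ x ∈ ball (0 : EuclideanSpace ℝ (Fin N)) δ,
      Integrable (fun y => g y * (ψ (‖x - q y‖ ^ 2) + m y)) μ)
    (hc : ∀ x ∈ ball (0 : EuclideanSpace ℝ (Fin N)) δ, ∫ y, g y * (ψ (‖x - q y‖ ^ 2) + m y) ∂μ = c) :
    g =ᵐ[μ] 0 := by
  have hIb : ∀ k : ℕ, Integrable (fun y => g y * (‖q y‖ ^ 2) ^ (b - k)) μ := fun k =>
    integrable_rpow_of_le hq hδ hqδ (by have : (0 : ℝ) ≤ k := Nat.cast_nonneg k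
                                        linarith) hI
  have hmom : ∀ k : ℕ, ∀ x ∈ ball (0 : EuclideanSpace ℝ (Fin N)) δ,
      ∫ y, g y * (‖x - q y‖ ^ 2) ^ (b - k) ∂μ = 0 := by
    intro k
    induction k with
    | zero =>
      intro x hx
      simpa using potential_laplacian_eq_zero hq hδ hqδ hg hb hN.ne hκ hψ hI hψI hc hx
    | succ k ih =>
      intro x hx
      have hk : (0 : ℝ) ≤ k := Nat.cast_nonneg k
      have e : b - (k + 1 : ℕ) + 1 = b - k := by push_cast; ring
      refine potential_laplacian_eq_zero (ψ := fun s => s ^ (b - k)) (κ := b - k) (c := 0)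
        (m := fun _ => 0)
        hq hδ hqδ hg (by push_cast; linarith) (by push_cast; linarith) (by linarith)
        (fun s hs => ?_) (by rw [e]; exact hIb k)
        (fun z hz => by
          simpa using integrable_potential hq hδ hqδ hg (by linarith) (hIb k) hz)
        (fun z hz => by simpa using ih z hz) hx
      convert Real.hasDerivAt_rpow_const (p := b - k) (Or.inl hs.ne') using 3
      push_cast; ring
  have hgauss : ∀ x ∈ ball (0 : EuclideanSpace ℝ (Fin N)) δ, ∀ t > 0,
      ∫ y, g y * Real.exp (-t * ‖x - q y‖ ^ 2) ∂μ = 0 := fun x hx t ht =>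
    gaussian_eq_zero_of_potentials hq hδ hqδ hg (by linarith) (by simpa using hIb 0) hx
      (fun k => hmom k x hx) ht
  refine ae_eq_zero_of_gaussian_eq_zero hq hδ hR hRq ?_ fun t ht v hv => ?_
  · -- `exp (-s)` is dominated by `s ^ b`
    have hbd := continuousOn_rpow_mul_exp_neg_div b (by linarith) one_pos ((2 * δ) ^ 2)⁻¹
    obtain ⟨C, hC⟩ := isCompact_Icc.exists_bound_of_continuousOn hbd
    have hI0 : Integrable (fun y => g y * (‖q y‖ ^ 2) ^ b) μ := by simpa using hIb 0
    refine (hI0.mul_bdd (c := C)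
      (g := fun y => (‖q y‖ ^ 2)⁻¹ ^ b * Real.exp (-1 / (‖q y‖ ^ 2)⁻¹))
      (by fun_prop : Measurable fun y =>
        (‖q y‖ ^ 2)⁻¹ ^ b * Real.exp (-1 / (‖q y‖ ^ 2)⁻¹)).aestronglyMeasurable ?_).congr ?_
    · filter_upwards [hqδ] with y hy
      exact hC _ ⟨by positivity, inv_anti₀ (by positivity) (by gcongr)⟩
    · filter_upwards [hqδ] with y hy
      have h0 : 0 < ‖q y‖ ^ 2 := by
        have : 0 < ‖q y‖ := by linarith
        positivity
      have h1 : (‖q y‖ ^ 2) ^ b ≠ 0 := (Real.rpow_pos_of_pos h0 b).ne'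
      rw [Real.inv_rpow h0.le, div_inv_eq_mul, neg_one_mul]
      field_simp
  · -- complete the square
    have hx : (2 * t)⁻¹ • v ∈ ball (0 : EuclideanSpace ℝ (Fin N)) δ := by
      rw [mem_ball_zero_iff, norm_smul, Real.norm_of_nonneg (by positivity), inv_mul_lt_iff₀
        (by positivity)]
      nlinarith [mul_pos ht hδ]
    have e : ∀ y, g y * Real.exp (-t * ‖q y‖ ^ 2 + ⟪q y, v⟫) =
        Real.exp (t * ‖(2 * t)⁻¹ • v‖ ^ 2) *
          (g y * Real.exp (-t * ‖(2 * t)⁻¹ • v - q y‖ ^ 2)) := by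
      intro y
      rw [mul_left_comm, ← Real.exp_add, norm_sub_sq_real, inner_smul_left, real_inner_comm v]
      congr 2
      simp only [conj_trivial]
      field_simp
      ring
    simp_rw [e]
    rw [integral_const_mul, hgauss _ hx t ht, mul_zero]

end Uniqueness

end ReflPos

/-! ### Null vectors of the reflected forms -/

namespace ReflPos

open Filter Metric

section Abstract

variable {X : Type*} [MeasurableSpace X] {μ : Measure X} [SFinite μ] {k : X → X → ℝ}

/-- The first variation of a nonnegative quadratic form vanishes at a null vector. -/
theorem integral_kernel_eq_zero_of_null (hsymm : ∀ x y, k x y = k y x) {h g : X → ℝ}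
    (hhh : Integrable (fun p : X × X => h p.1 * h p.2 * k p.1 p.2) (μ.prod μ))
    (h0 : ∫ p : X × X, h p.1 * h p.2 * k p.1 p.2 ∂(μ.prod μ) = 0)
    (hhg : Integrable (fun p : X × X => h p.1 * g p.2 * k p.1 p.2) (μ.prod μ))
    (hgg : Integrable (fun p : X × X => g p.1 * g p.2 * k p.1 p.2) (μ.prod μ))
    (psd : ∀ ε : ℝ, Integrable (fun p : X × X =>
        (h p.1 + ε * g p.1) * (h p.2 + ε * g p.2) * k p.1 p.2) (μ.prod μ) →
      0 ≤ ∫ p : X × X, (h p.1 + ε * g p.1) * (h p.2 + ε * g p.2) * k p.1 p.2 ∂(μ.prod μ)) :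
    ∫ p : X × X, h p.1 * g p.2 * k p.1 p.2 ∂(μ.prod μ) = 0 := by
  have hgh : Integrable (fun p : X × X => g p.1 * h p.2 * k p.1 p.2) (μ.prod μ) := by
    refine hhg.swap.congr (Eventually.of_forall fun p => ?_)
    simp only [Function.comp_apply, Prod.fst_swap, Prod.snd_swap]
    rw [hsymm, mul_comm (h p.2)]
  have egh : ∫ p : X × X, g p.1 * h p.2 * k p.1 p.2 ∂(μ.prod μ) =
      ∫ p : X × X, h p.1 * g p.2 * k p.1 p.2 ∂(μ.prod μ) := by
    rw [← integral_prod_swap]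
    refine integral_congr_ae (Eventually.of_forall fun p => ?_)
    simp only [Prod.fst_swap, Prod.snd_swap]
    rw [hsymm, mul_comm (g p.2)]
  set a := ∫ p : X × X, h p.1 * g p.2 * k p.1 p.2 ∂(μ.prod μ)
  set b := ∫ p : X × X, g p.1 * g p.2 * k p.1 p.2 ∂(μ.prod μ)
  have expand : ∀ ε : ℝ, 0 ≤ 2 * ε * a + ε ^ 2 * b := by
    intro ε
    have e : ∀ p : X × X, (h p.1 + ε * g p.1) * (h p.2 + ε * g p.2) * k p.1 p.2 =
        h p.1 * h p.2 * k p.1 p.2 + (ε * (h p.1 * g p.2 * k p.1 p.2) +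
          (ε * (g p.1 * h p.2 * k p.1 p.2) + ε ^ 2 * (g p.1 * g p.2 * k p.1 p.2))) := by
      intro p; ring
    have h1 := psd ε
    simp_rw [e] at h1
    have i2 : Integrable (fun p : X × X => ε * (g p.1 * h p.2 * k p.1 p.2) +
        ε ^ 2 * (g p.1 * g p.2 * k p.1 p.2)) (μ.prod μ) :=
      (hgh.const_mul ε).add (hgg.const_mul (ε ^ 2))
    have i3 : Integrable (fun p : X × X => ε * (h p.1 * g p.2 * k p.1 p.2) +
        (ε * (g p.1 * h p.2 * k p.1 p.2) + ε ^ 2 * (g p.1 * g p.2 * k p.1 p.2))) (μ.prod μ) :=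
      (hhg.const_mul ε).add i2
    have h2 := h1 (hhh.add i3)
    rw [integral_add hhh i3, integral_add (hhg.const_mul ε) i2,
      integral_add (hgh.const_mul ε) (hgg.const_mul _), integral_const_mul, integral_const_mul,
      integral_const_mul, h0, egh] at h2
    linarith
  by_contra ha
  have ha2 : 0 < a ^ 2 := by positivity
  have hb : 0 < |b| + 1 := by positivity
  have h1 := expand (-a / (|b| + 1))
  have h2 : 2 * (-a / (|b| + 1)) * a + (-a / (|b| + 1)) ^ 2 * b =
      a ^ 2 / (|b| + 1) ^ 2 * (b - 2 * (|b| + 1)) := by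
    field_simp; ring
  rw [h2] at h1
  have h3 : b - 2 * (|b| + 1) < 0 := by linarith [le_abs_self b, abs_nonneg b]
  have : a ^ 2 / (|b| + 1) ^ 2 * (b - 2 * (|b| + 1)) < 0 := mul_neg_of_pos_of_neg (by positivity) h3
  linarith

/-- The potential of a null vector is constant on every set on which the kernel is dominated.
With `z = 0` positivity is available for all test functions and the constant is zero; with `z = 1`
it is available for those of mean zero. -/
theorem potential_ae_eq_const_of_null (hk : Measurable (Function.uncurry k))
    (hsymm : ∀ x y, k x y = k y x) {h : X → ℝ} (hm : AEStronglyMeasurable h μ)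
    (hhh : Integrable (fun p : X × X => h p.1 * h p.2 * k p.1 p.2) (μ.prod μ))
    (h0 : ∫ p : X × X, h p.1 * h p.2 * k p.1 p.2 ∂(μ.prod μ) = 0)
    {E : Set X} (hE : MeasurableSet E) (hE0 : μ E ≠ 0) (hEf : μ E ≠ ⊤) {k0 : X → ℝ}
    (hk0 : ∀ᵐ y ∂μ, ∀ x ∈ E, |k x y| ≤ k0 y) (hk0h : Integrable (fun y => |h y| * k0 y) μ)
    (hk0E : IntegrableOn k0 E μ) {z : ℝ} (hz : z = 0 ∨ z = 1)
    (psd : ∀ g : X → ℝ, Integrable g μ → z * ∫ x, g x ∂μ = 0 →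
      Integrable (fun p : X × X => (h p.1 + g p.1) * (h p.2 + g p.2) * k p.1 p.2) (μ.prod μ) →
      0 ≤ ∫ p : X × X, (h p.1 + g p.1) * (h p.2 + g p.2) * k p.1 p.2 ∂(μ.prod μ)) :
    ∃ c : ℝ, (z = 0 → c = 0) ∧ ∀ᵐ x ∂(μ.restrict E), ∫ y, h y * k x y ∂μ = c := by
  have hk' : Measurable fun p : X × X => k p.1 p.2 := hk
  set U : X → ℝ := fun x => ∫ y, h y * k x y ∂μ with hU
  have hUm : AEStronglyMeasurable U μ := by
    refine AEStronglyMeasurable.integral_prod_right' (f := fun p : X × X => h p.2 * k p.1 p.2) ?_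
    exact hm.comp_snd.mul hk'.aestronglyMeasurable
  set A := ∫ y, |h y| * k0 y ∂μ with hA
  have hUb : ∀ x ∈ E, |U x| ≤ A := by
    intro x hx
    rw [← Real.norm_eq_abs]
    refine norm_integral_le_of_norm_le hk0h ?_
    filter_upwards [hk0] with y hy
    rw [norm_mul]
    exact mul_le_mul_of_nonneg_left (hy x hx) (abs_nonneg _)
  have hUi : IntegrableOn U E μ :=
    Measure.integrableOn_of_bounded hEf hUm (ae_restrict_of_forall_mem hE hUb)
  set c : ℝ := z * ((μ.real E)⁻¹ * ∫ x in E, U x ∂μ) with hc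
  refine ⟨c, fun h => by rw [hc, h, zero_mul], ?_⟩
  have hEr : μ.real E ≠ 0 := by
    rw [Measure.real, ENNReal.toReal_ne_zero]; exact ⟨hE0, hEf⟩
  have hconst : IntegrableOn (fun _ : X => c) E μ := integrableOn_const hEf
  have hUc : IntegrableOn (fun x => U x - c) E μ := hUi.sub hconst
  have hmean : ∫ x in E, (U x - c) ∂μ = ∫ x in E, U x ∂μ - c * μ.real E := by
    rw [integral_sub hUi hconst, setIntegral_const, smul_eq_mul, mul_comm]
  -- testing against the deviation of the potential from its mean on `E`, or from `0` if `z = 0`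
  set g : X → ℝ := E.indicator (fun x => U x - c) with hg
  have hgi : Integrable g μ := (integrable_indicator_iff hE).2 hUc
  have hgint : ∫ x, g x ∂μ = ∫ x in E, (U x - c) ∂μ := integral_indicator hE
  have hzg : z * ∫ x, g x ∂μ = 0 := by
    rw [hgint, hmean, hc]
    rcases hz with rfl | rfl
    · ring
    · field_simp; ring
  have hcg : c * ∫ x, g x ∂μ = 0 := by
    rw [hc, mul_right_comm, hzg, zero_mul]
  have hgb : ∀ x, |g x| ≤ E.indicator (fun _ => A + |c|) x := by
    intro x
    by_cases hx : x ∈ E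
    · simp only [hg, Set.indicator_of_mem hx]
      exact (abs_sub _ _).trans (by linarith [hUb x hx])
    · simp [hg, Set.indicator_of_notMem hx]
  have hA0 : ∀ x, 0 ≤ E.indicator (fun _ => A + |c|) x := fun x => (abs_nonneg _).trans (hgb x)
  have hEi : Integrable (E.indicator fun _ => A + |c|) μ :=
    (integrable_indicator_iff hE).2 (integrableOn_const hEf)
  have hhg : Integrable (fun p : X × X => h p.1 * g p.2 * k p.1 p.2) (μ.prod μ) := by
    refine (hk0h.mul_prod hEi).mono' ((hm.comp_fst.mul hgi.1.comp_snd).mul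
      hk'.aestronglyMeasurable) ?_
    filter_upwards [Measure.quasiMeasurePreserving_fst.ae hk0] with p hp
    rw [norm_mul, norm_mul, Real.norm_eq_abs, Real.norm_eq_abs, Real.norm_eq_abs]
    by_cases hx : p.2 ∈ E
    · have h1 := hp p.2 hx
      rw [hsymm] at h1
      calc |h p.1| * |g p.2| * |k p.1 p.2| ≤
            |h p.1| * E.indicator (fun _ => A + |c|) p.2 * k0 p.1 := by
            gcongr
            · exact mul_nonneg (abs_nonneg _) (hA0 _)
            · exact hgb _
        _ = _ := by ring
    · simp [hg, Set.indicator_of_notMem hx]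
  have hgg : Integrable (fun p : X × X => g p.1 * g p.2 * k p.1 p.2) (μ.prod μ) := by
    have hk0' : Integrable (E.indicator k0) μ := (integrable_indicator_iff hE).2 hk0E
    refine ((hk0'.const_mul (A + |c|)).mul_prod hEi).mono' ((hgi.1.comp_fst.mul hgi.1.comp_snd).mul
      hk'.aestronglyMeasurable) ?_
    filter_upwards [Measure.quasiMeasurePreserving_fst.ae hk0] with p hp
    rw [norm_mul, norm_mul, Real.norm_eq_abs, Real.norm_eq_abs, Real.norm_eq_abs]
    by_cases hx : p.2 ∈ E
    · by_cases hx1 : p.1 ∈ E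
      · have h1 := hp p.2 hx
        rw [hsymm] at h1
        have h2 := hgb p.1
        rw [Set.indicator_of_mem hx1] at h2 ⊢
        have h3 := (abs_nonneg _).trans h2
        calc |g p.1| * |g p.2| * |k p.1 p.2| ≤
              (A + |c|) * E.indicator (fun _ => A + |c|) p.2 * k0 p.1 := by
              gcongr
              · exact mul_nonneg h3 (hA0 _)
              · exact hgb _
          _ = _ := by ring
      · simp [hg, Set.indicator_of_notMem hx1]
    · simp [hg, Set.indicator_of_notMem hx]
  have key := integral_kernel_eq_zero_of_null hsymm hhh h0 hhg hgg fun ε hi =>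
    psd (fun x => ε * g x) (hgi.const_mul ε) (by rw [integral_const_mul, mul_left_comm, hzg,
      mul_zero]) hi
  rw [integral_prod_symm _ hhg] at key
  have e1 : ∀ y, ∫ x, h x * g y * k x y ∂μ = g y * U y := by
    intro y
    rw [hU, ← integral_const_mul]
    refine integral_congr_ae (Eventually.of_forall fun x => ?_)
    simp only
    rw [hsymm x y]; ring
  simp_rw [e1] at key
  have hgU : Integrable (fun y => g y * U y) μ := by
    refine (hhg.integral_prod_right).congr (Eventually.of_forall fun y => ?_)
    exact e1 y
  have e2 : ∀ y, g y * g y = g y * U y - c * g y := by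
    intro y
    by_cases hy : y ∈ E
    · simp only [hg, Set.indicator_of_mem hy]; ring
    · simp [hg, Set.indicator_of_notMem hy]
  have hsq : ∫ y, g y * g y ∂μ = 0 := by
    simp_rw [e2]
    rw [integral_sub hgU (hgi.const_mul c), integral_const_mul, key, hcg, sub_zero]
  have hg2 : Integrable (fun y => g y * g y) μ := by
    simp_rw [e2]; exact hgU.sub (hgi.const_mul c)
  have hae := (integral_eq_zero_iff_of_nonneg (fun y => mul_self_nonneg (g y)) hg2).1 hsq
  rw [ae_restrict_iff' hE]
  filter_upwards [hae] with x hx hxE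
  have : g x = 0 := mul_self_eq_zero.1 hx
  simp only [hg, Set.indicator_of_mem hxE] at this
  linarith

end Abstract

section Concrete

variable {N : ℕ} {B : BallOrHalfSpace N} {x₁ : EuclideanSpace ℝ (Fin N)} {δ : ℝ}

/-- Harnack-type comparison of `Q` at nearby points. -/
theorem Q_comparable (hB : ball x₁ (2 * δ) ⊆ B.carrier) {x y : EuclideanSpace ℝ (Fin N)}
    (hx : x ∈ ball x₁ δ) (hy : 0 < B.rho y) (hs : 0 < B.scale y) :
    2 * δ ≤ ‖B.reflect y - x₁‖ ∧ 0 < B.Q x y ∧ B.Q x₁ y ≤ 4 * B.Q x y ∧ B.Q x y ≤ 4 * B.Q x₁ y := by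
  have hδ : 0 < δ := dist_nonneg.trans_lt hx
  have hout : B.reflect y ∉ B.carrier := by
    rw [B.mem_carrier_iff, B.rho_reflect hs]
    have : 0 < B.scale y ^ 2 * B.rho y := by positivity
    linarith
  have h1 : 2 * δ ≤ ‖B.reflect y - x₁‖ := by
    by_contra! hc
    exact hout (hB (by rwa [mem_ball, dist_eq_norm]))
  have hx' : ‖x - x₁‖ < δ := by rwa [mem_ball, dist_eq_norm] at hx
  have h2 : ‖B.reflect y - x₁‖ ≤ 2 * ‖x - B.reflect y‖ := by
    have := norm_sub_le_norm_sub_add_norm_sub (B.reflect y) x x₁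
    rw [norm_sub_rev (B.reflect y) x] at this
    linarith
  have h3 : ‖x - B.reflect y‖ ≤ 2 * ‖B.reflect y - x₁‖ := by
    have := norm_sub_le_norm_sub_add_norm_sub x x₁ (B.reflect y)
    rw [norm_sub_rev x₁] at this
    linarith
  have e1 := B.norm_sub_reflect_sq x hs
  have e2 := B.norm_sub_reflect_sq x₁ hs
  rw [norm_sub_rev] at e2
  have h4 : 0 < B.scale y ^ 2 := by positivity
  have h5 : 0 < ‖x - B.reflect y‖ := by linarith
  have h6 : 0 < ‖x - B.reflect y‖ ^ 2 := by positivity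
  have h7 : ‖B.reflect y - x₁‖ ^ 2 ≤ (2 * ‖x - B.reflect y‖) ^ 2 := by gcongr
  have h8 : ‖x - B.reflect y‖ ^ 2 ≤ (2 * ‖B.reflect y - x₁‖) ^ 2 := by gcongr
  refine ⟨h1, ?_, ?_, ?_⟩
  · rw [e1] at h6
    exact pos_of_mul_pos_right h6 h4.le
  · rw [mul_pow, e1, e2] at h7
    refine le_of_mul_le_mul_left ?_ h4
    linarith
  · rw [mul_pow, e1, e2] at h8
    refine le_of_mul_le_mul_left ?_ h4
    linarith

/-- The potential of a null vector is constant on a ball. -/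
theorem potential_const_of_null [NeZero N]
    {k : EuclideanSpace ℝ (Fin N) → EuclideanSpace ℝ (Fin N) → ℝ}
    (hk : Measurable (Function.uncurry k)) (hsymm : ∀ x y, k x y = k y x)
    {h : EuclideanSpace ℝ (Fin N) → ℝ} (hm : AEStronglyMeasurable h B.vol)
    (hhh : Integrable (fun p : _ × _ => h p.1 * h p.2 * k p.1 p.2) (B.vol.prod B.vol))
    (h0 : ∫ p, h p.1 * h p.2 * k p.1 p.2 ∂(B.vol.prod B.vol) = 0)
    (hδ : 0 < δ) (hB : ball x₁ (2 * δ) ⊆ B.carrier) (hs : 0 < B.scale x₁) {A D : ℝ} (hA : 0 ≤ A)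
    (hk0 : ∀ y, 0 < B.rho y → 0 < B.scale y → ∀ x ∈ ball x₁ δ, |k x y| ≤ A * |k x₁ y| + D)
    (hcont : ∀ y, 0 < B.rho y → 0 < B.scale y → ContinuousOn (fun x => k x y) (ball x₁ δ))
    (hint : Integrable (fun y => |h y| * (A * |k x₁ y| + D)) B.vol)
    {z : ℝ} (hz : z = 0 ∨ z = 1)
    (psd : ∀ g : EuclideanSpace ℝ (Fin N) → ℝ, Integrable g B.vol → z * ∫ x, g x ∂B.vol = 0 →
      Integrable (fun p : _ × _ => (h p.1 + g p.1) * (h p.2 + g p.2) * k p.1 p.2)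
        (B.vol.prod B.vol) →
      0 ≤ ∫ p, (h p.1 + g p.1) * (h p.2 + g p.2) * k p.1 p.2 ∂(B.vol.prod B.vol)) :
    ∃ c : ℝ, (z = 0 → c = 0) ∧ ∀ x ∈ ball x₁ δ,
      Integrable (fun y => h y * k x y) B.vol ∧ ∫ y, h y * k x y ∂B.vol = c := by
  have hk' : Measurable fun p : EuclideanSpace ℝ (Fin N) × EuclideanSpace ℝ (Fin N) =>
    k p.1 p.2 := hk
  have hsub : ball x₁ δ ⊆ B.carrier := (ball_subset_ball (by linarith)).trans hB
  have hres : B.vol.restrict (ball x₁ δ) = volume.restrict (ball x₁ δ) :=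
    Measure.restrict_restrict_of_subset hsub
  have hvE : B.vol (ball x₁ δ) = volume (ball x₁ δ) :=
    Measure.restrict_eq_self _ hsub
  have hpos : 0 < B.rho x₁ := (B.mem_carrier_iff _).1 (hsub (mem_ball_self hδ))
  have hae : ∀ᵐ y ∂B.vol, 0 < B.rho y ∧ 0 < B.scale y := B.ae_vol_rho_pos.and B.ae_vol_scale_pos
  have hdom : ∀ x ∈ ball x₁ δ, ∀ᵐ y ∂B.vol, ‖h y * k x y‖ ≤ |h y| * (A * |k x₁ y| + D) := by
    intro x hx
    filter_upwards [hae] with y hy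
    rw [norm_mul]
    exact mul_le_mul_of_nonneg_left (hk0 y hy.1 hy.2 x hx) (abs_nonneg _)
  have hmeas : ∀ x, AEStronglyMeasurable (fun y => h y * k x y) B.vol := fun x =>
    hm.mul (hk'.comp measurable_prodMk_left).aestronglyMeasurable
  obtain ⟨c, hc, hU⟩ := potential_ae_eq_const_of_null (μ := B.vol) hk hsymm hm hhh h0
    (E := ball x₁ δ) measurableSet_ball (by rw [hvE]; exact (measure_ball_pos _ _ hδ).ne')
    (by rw [hvE]; exact measure_ball_lt_top.ne) (k0 := fun y => A * |k x₁ y| + D)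
    (by filter_upwards [hae] with y hy using hk0 y hy.1 hy.2) hint
    (by
      have : Measurable fun y => A * |k x₁ y| + D := by
        have := hk'.comp (measurable_prodMk_left (x := x₁))
        exact (this.abs.const_mul A).add_const D
      refine Measure.integrableOn_of_bounded (M := A * (A * |k x₁ x₁| + D) + |D|)
        (by rw [hvE]; exact measure_ball_lt_top.ne) this.aestronglyMeasurable
        (ae_restrict_of_forall_mem measurableSet_ball fun y hy => ?_)
      have h1 := hk0 x₁ hpos hs y hy
      rw [hsymm] at h1
      rw [Real.norm_eq_abs]
      refine (abs_add_le _ _).trans ?_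
      rw [abs_mul, abs_abs, abs_of_nonneg hA]
      gcongr) hz psd
  refine ⟨c, hc, fun x hx => ⟨hint.mono' (hmeas x) (hdom x hx), ?_⟩⟩
  have hcontU : ContinuousOn (fun x => ∫ y, h y * k x y ∂B.vol) (ball x₁ δ) := by
    refine continuousOn_of_dominated (fun x _ => hmeas x) hdom hint ?_
    filter_upwards [hae] with y hy
    exact continuousOn_const.mul (hcont y hy.1 hy.2)
  rw [hres] at hU
  exact Measure.eqOn_open_of_ae_eq (g := fun _ => c) hU isOpen_ball hcontU continuousOn_const hx

/-- By Fubini's theorem the potential of `h` is given by a convergent integral at almost every point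
of `{h ≠ 0}`, so at some good point of `B` as soon as `h` does not vanish. -/
theorem exists_integrable_potential [NeZero N]
    {k : EuclideanSpace ℝ (Fin N) → EuclideanSpace ℝ (Fin N) → ℝ}
    {h : EuclideanSpace ℝ (Fin N) → ℝ}
    (hhh : Integrable (fun p : _ × _ => h p.1 * h p.2 * k p.1 p.2) (B.vol.prod B.vol))
    (hne : ¬ h =ᵐ[B.vol] 0) :
    ∃ (x₁ : EuclideanSpace ℝ (Fin N)) (δ : ℝ), 0 < δ ∧ ball x₁ (2 * δ) ⊆ B.carrier ∧
      0 < B.scale x₁ ∧ Integrable (fun y => h y * k x₁ y) B.vol := by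
  have h1 : ∃ᵐ x ∂B.vol, h x ≠ 0 := by
    intro hc
    exact hne (hc.mono fun x hx => not_not.1 hx)
  obtain ⟨x₁, hx, hi, hr, hs⟩ := (h1.and_eventually (hhh.prod_right_ae.and
    (B.ae_vol_rho_pos.and B.ae_vol_scale_pos))).exists
  obtain ⟨ε, hε, hball⟩ := Metric.isOpen_iff.1 B.isOpen_carrier x₁ ((B.mem_carrier_iff _).2 hr)
  refine ⟨x₁, ε / 2, by positivity, by rwa [mul_div_cancel₀ _ two_ne_zero], hs, ?_⟩
  refine (hi.const_mul (h x₁)⁻¹).congr (Eventually.of_forall fun y => ?_)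
  simp only
  field_simp

/-- Definiteness of the reflected Riesz form above the critical exponent. The potential of `h` at `x ∈ B`
is the Riesz potential at `x` of a density supported on the complement of `B`, so its constancy on
a small ball inside `B` forces the density to vanish. At `λ = N - 2` this breaks down because
Riesz potentials are then harmonic off the support. -/
theorem riesz_ae_eq_zero_of_null [NeZero N] {lam : ℝ} (hlam : 0 < lam) (hN : (N : ℝ) - 2 < lam)
    {h : EuclideanSpace ℝ (Fin N) → ℝ} (hm : AEStronglyMeasurable h B.vol)
    (hi : Integrable (fun p : _ × _ => h p.1 * h p.2 * B.Q p.1 p.2 ^ (-lam / 2))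
      (B.vol.prod B.vol))
    (h0 : ∫ p, h p.1 * h p.2 * B.Q p.1 p.2 ^ (-lam / 2) ∂(B.vol.prod B.vol) = 0) :
    h =ᵐ[B.vol] 0 := by
  by_contra hne
  obtain ⟨x₁, δ, hδ, hB, hs, hint⟩ := exists_integrable_potential
    (k := fun x y => B.Q x y ^ (-lam / 2)) hi hne
  have hQ := measurable_Q B
  have hae : ∀ᵐ y ∂B.vol, 0 < B.rho y ∧ 0 < B.scale y := B.ae_vol_rho_pos.and B.ae_vol_scale_pos
  have hQc := B.continuous_Q
  obtain ⟨c, -, hU⟩ := potential_const_of_null (B := B) (k := fun x y => B.Q x y ^ (-lam / 2))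
    (A := 4 ^ (lam / 2)) (D := 0) (z := 0)
    (by unfold Function.uncurry; fun_prop) (fun x y => by rw [B.Q_comm]) hm hi h0 hδ hB hs
    (by positivity)
    (fun y hy hys x hx => by
      obtain ⟨-, h1, h2, h3⟩ := Q_comparable hB hx hy hys
      obtain ⟨-, h4, -, -⟩ := Q_comparable hB (mem_ball_self hδ) hy hys
      rw [abs_of_nonneg (by positivity), abs_of_nonneg (by positivity), add_zero]
      have h5 : (4 * B.Q x y) ^ (-lam / 2) ≤ B.Q x₁ y ^ (-lam / 2) :=
        Real.rpow_le_rpow_of_nonpos h4 h2 (by linarith)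
      rw [Real.mul_rpow (by norm_num) h1.le] at h5
      calc B.Q x y ^ (-lam / 2)
          = 4 ^ (lam / 2) * (4 ^ (-lam / 2) * B.Q x y ^ (-lam / 2)) := by
            rw [← mul_assoc, ← Real.rpow_add (by norm_num)]; ring_nf; simp
        _ ≤ _ := by gcongr)
    (fun y hy hys x hx => by
      obtain ⟨-, h1, -, -⟩ := Q_comparable hB hx hy hys
      have : ContinuousAt (fun x => B.Q x y) x :=
        (hQc.comp (by fun_prop : Continuous fun x => (x, y))).continuousAt
      exact (this.rpow_const (Or.inl h1.ne')).continuousWithinAt)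
    (by
      refine (hint.abs.const_mul (4 ^ (lam / 2))).congr (Eventually.of_forall fun y => ?_)
      simp only [abs_mul, add_zero]; ring)
    (Or.inl rfl)
    (fun g hg _ hgi => reflectedRiesz_nonneg hlam hN.le (hm.add hg.1) hgi)
  have kernel : ∀ x, ∀ᵐ y ∂B.vol, h y * B.Q x y ^ (-lam / 2) =
      h y * B.scale y ^ lam * (‖x - x₁ - (B.reflect y - x₁)‖ ^ 2) ^ (-lam / 2) := by
    intro x
    filter_upwards [hae] with y hy
    have hQ0 : 0 ≤ B.Q x y := by
      have := B.norm_sub_reflect_sq x hy.2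
      have h4 : 0 < B.scale y ^ 2 := pow_pos hy.2 2
      exact nonneg_of_mul_nonneg_right (this ▸ sq_nonneg _) h4
    rw [sub_sub_sub_cancel_right, B.norm_sub_reflect_sq x hy.2, Real.mul_rpow (by positivity) hQ0,
      ← Real.rpow_natCast, ← Real.rpow_mul hy.2.le, mul_assoc, ← mul_assoc (B.scale y ^ lam),
      ← Real.rpow_add hy.2]
    have : lam + (2 : ℕ) * (-lam / 2) = 0 := by push_cast; ring
    rw [this, Real.rpow_zero, one_mul]
  have hR := B.measurable_reflect
  have hmem : ∀ x ∈ ball (0 : EuclideanSpace ℝ (Fin N)) δ, x + x₁ ∈ ball x₁ δ := by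
    intro x hx
    simpa [mem_ball, dist_eq_norm] using hx
  have hz := ae_eq_zero_of_potential_const (μ := B.vol) (q := fun y => B.reflect y - x₁)
    (g := fun y => h y * B.scale y ^ lam) (b := -lam / 2 - 1) (κ := -lam / 2) (c := c)
    (ψ := fun s => s ^ (-lam / 2)) (m := fun _ => 0) (R := fun p => B.reflect (p + x₁))
    (by fun_prop) hδ
    (by
      filter_upwards [hae] with y hy
      exact (Q_comparable hB (mem_ball_self hδ) hy.1 hy.2).1)
    (by fun_prop)
    (by
      filter_upwards [hae] with y hy
      rw [sub_add_cancel, B.reflect_reflect hy.2])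
    (hm.mul (B.measurable_scale.pow_const lam).aestronglyMeasurable)
    (by linarith) (by linarith) (by linarith)
    (fun s hs => Real.hasDerivAt_rpow_const (Or.inl hs.ne'))
    (by
      rw [sub_add_cancel]
      refine ((hU x₁ (mem_ball_self hδ)).1.congr (kernel x₁)).congr
        (Eventually.of_forall fun y => ?_)
      simp only
      rw [sub_self, zero_sub, norm_neg])
    (fun x hx => by
      refine ((hU _ (hmem x hx)).1.congr (kernel _)).congr (Eventually.of_forall fun y => ?_)
      simp only [add_sub_cancel_right, add_zero])
    (fun x hx => by
      rw [← (hU _ (hmem x hx)).2, integral_congr_ae (kernel _)]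
      simp only [add_sub_cancel_right, add_zero])
  refine hne ?_
  filter_upwards [hz, hae] with y hy hy'
  exact (mul_eq_zero.1 hy).resolve_right (Real.rpow_pos_of_pos hy'.2 _).ne'

/-- Definiteness of the reflected logarithmic form on densities of mean zero, in dimension one. -/
theorem log_ae_eq_zero_of_null [NeZero N] (hN : (N : ℝ) - 2 < 0)
    {h : EuclideanSpace ℝ (Fin N) → ℝ} (h1 : Integrable h B.vol) (hmean : ∫ x, h x ∂B.vol = 0)
    (hi : Integrable (fun p : _ × _ => h p.1 * h p.2 * (-(1 / 2) * Real.log (B.Q p.1 p.2)))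
      (B.vol.prod B.vol))
    (h0 : ∫ p, h p.1 * h p.2 * (-(1 / 2) * Real.log (B.Q p.1 p.2)) ∂(B.vol.prod B.vol) = 0) :
    h =ᵐ[B.vol] 0 := by
  by_contra hne
  obtain ⟨x₁, δ, hδ, hB, hs, hint⟩ := exists_integrable_potential
    (k := fun x y => -(1 / 2) * Real.log (B.Q x y)) hi hne
  have hQ := measurable_Q B
  have hae : ∀ᵐ y ∂B.vol, 0 < B.rho y ∧ 0 < B.scale y := B.ae_vol_rho_pos.and B.ae_vol_scale_pos
  have hQc := B.continuous_Q
  obtain ⟨c, -, hU⟩ := potential_const_of_null (B := B)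
    (k := fun x y => -(1 / 2) * Real.log (B.Q x y)) (A := 1) (D := Real.log 4) (z := 1)
    (by unfold Function.uncurry; fun_prop) (fun x y => by rw [B.Q_comm]) h1.1 hi h0 hδ hB hs
    zero_le_one
    (fun y hy hys x hx => by
      obtain ⟨-, h1, h2, h3⟩ := Q_comparable hB hx hy hys
      obtain ⟨-, h4, -, -⟩ := Q_comparable hB (mem_ball_self hδ) hy hys
      have h5 := Real.log_le_log h4 h2
      have h6 := Real.log_le_log h1 h3
      rw [Real.log_mul (by norm_num) h1.ne'] at h5
      rw [Real.log_mul (by norm_num) h4.ne'] at h6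
      have h7 : 0 ≤ Real.log 4 := Real.log_nonneg (by norm_num)
      have h8 : |Real.log (B.Q x y) - Real.log (B.Q x₁ y)| ≤ Real.log 4 :=
        abs_le.2 ⟨by linarith, by linarith⟩
      have h9 := abs_sub_abs_le_abs_sub (Real.log (B.Q x y)) (Real.log (B.Q x₁ y))
      rw [abs_mul, abs_mul, abs_neg, abs_of_pos (by norm_num : (0 : ℝ) < 1 / 2)]
      linarith)
    (fun y hy hys x hx => by
      obtain ⟨-, h1, -, -⟩ := Q_comparable hB hx hy hys
      have : ContinuousAt (fun x => B.Q x y) x :=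
        (hQc.comp (by fun_prop : Continuous fun x => (x, y))).continuousAt
      exact (continuousAt_const.mul (this.log h1.ne')).continuousWithinAt)
    (by
      refine (hint.abs.add (h1.abs.mul_const (Real.log 4))).congr
        (Eventually.of_forall fun y => ?_)
      simp only [Pi.add_apply, abs_mul, one_mul]; ring)
    (Or.inr rfl)
    (fun g hg hg0 hgi => reflectedLog_nonneg hN.le (h1.add hg)
      (by
        simp only [Pi.add_apply]
        rw [integral_add h1 hg, hmean, zero_add]; linarith) hgi)
  have kernel : ∀ x, (∀ᵐ y ∂B.vol, 0 < B.Q x y) → ∀ᵐ y ∂B.vol, h y * (-(1 / 2) * Real.log (B.Q x y)) =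
      h y * (-(1 / 2) * Real.log (‖x - x₁ - (B.reflect y - x₁)‖ ^ 2) + Real.log (B.scale y)) := by
    intro x hx
    filter_upwards [hae, hx] with y hy hxy
    rw [sub_sub_sub_cancel_right, B.norm_sub_reflect_sq x hy.2,
      Real.log_mul (pow_pos hy.2 2).ne' hxy.ne', Real.log_pow]
    push_cast; ring
  have hR := B.measurable_reflect
  have hmem : ∀ x ∈ ball (0 : EuclideanSpace ℝ (Fin N)) δ, x + x₁ ∈ ball x₁ δ := by
    intro x hx
    simpa [mem_ball, dist_eq_norm] using hx
  have hQpos : ∀ x ∈ ball (0 : EuclideanSpace ℝ (Fin N)) δ, ∀ᵐ y ∂B.vol, 0 < B.Q (x + x₁) y := by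
    intro x hx
    filter_upwards [hae] with y hy
    exact (Q_comparable hB (hmem x hx) hy.1 hy.2).2.1
  have hz := ae_eq_zero_of_potential_const (μ := B.vol) (q := fun y => B.reflect y - x₁)
    (g := h) (b := -1) (κ := -(1 / 2)) (c := c)
    (ψ := fun s => -(1 / 2) * Real.log s) (m := fun y => Real.log (B.scale y))
    (R := fun p => B.reflect (p + x₁))
    (by fun_prop) hδ
    (by
      filter_upwards [hae] with y hy
      exact (Q_comparable hB (mem_ball_self hδ) hy.1 hy.2).1)
    (by fun_prop)
    (by
      filter_upwards [hae] with y hy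
      rw [sub_add_cancel, B.reflect_reflect hy.2])
    h1.1 le_rfl (by linarith) (by norm_num)
    (fun s hs => by
      rw [Real.rpow_neg_one]
      exact (Real.hasDerivAt_log hs.ne').const_mul _)
    (by simpa using h1)
    (fun x hx => by
      refine ((hU _ (hmem x hx)).1.congr (kernel _ (hQpos x hx))).congr
        (Eventually.of_forall fun y => ?_)
      simp only [add_sub_cancel_right])
    (fun x hx => by
      rw [← (hU _ (hmem x hx)).2, integral_congr_ae (kernel _ (hQpos x hx))]
      simp only [add_sub_cancel_right])
  exact hne hz

end Concrete

end ReflPos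

/-! ### The Riesz energy of real functions -/

namespace ReflPos.BallOrHalfSpace

open Filter

variable {N : ℕ} {lam : ℝ} {B : BallOrHalfSpace N}

theorem weight_nonneg (x : EuclideanSpace ℝ (Fin N)) : 0 ≤ B.weight lam x := by
  rw [weight_eq]
  exact Real.rpow_nonneg (B.scale_nonneg x) _

theorem measurable_weight : Measurable (B.weight lam) := by
  have : B.weight lam = fun x => B.scale x ^ (2 * (N : ℝ) - lam) := funext (weight_eq lam B)
  rw [this]
  exact B.measurable_scale.pow_const _

theorem weight_mul_weight_reflect {x : EuclideanSpace ℝ (Fin N)} (hx : 0 < B.scale x) :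
    B.weight lam x * B.weight lam (B.reflect x) = 1 := by
  rw [weight_eq, weight_eq, B.scale_reflect hx, ← Real.mul_rpow hx.le (inv_nonneg.2 hx.le),
    mul_inv_cancel₀ hx.ne', Real.one_rpow]

theorem reflect_notMem {x : EuclideanSpace ℝ (Fin N)} (hr : 0 < B.rho x) (hx : 0 < B.scale x) :
    B.reflect x ∉ B.carrier := by
  rw [B.mem_carrier_iff, B.rho_reflect hx]
  have : 0 < B.scale x ^ 2 * B.rho x := by positivity
  linarith

section Parts

variable {V : Type*} [NormedAddCommGroup V] [NormedSpace ℝ V] {f : EuclideanSpace ℝ (Fin N) → V}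
  {x : EuclideanSpace ℝ (Fin N)}

theorem inner_part_apply (hr : 0 < B.rho x) : B.inner_part lam f x = f x :=
  if_pos ((B.mem_carrier_iff x).2 hr)

theorem outer_part_apply (hr : 0 < B.rho x) : B.outer_part lam f x = B.theta lam f x :=
  if_pos ((B.mem_carrier_iff x).2 hr)

theorem inner_part_reflect (hr : 0 < B.rho x) (hx : 0 < B.scale x) :
    B.inner_part lam f (B.reflect x) = B.weight lam (B.reflect x) • f x := by
  rw [inner_part, if_neg (reflect_notMem hr hx), theta, B.reflect_reflect hx]

theorem outer_part_reflect (hr : 0 < B.rho x) (hx : 0 < B.scale x) :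
    B.outer_part lam f (B.reflect x) = f (B.reflect x) := by
  rw [outer_part, if_neg (reflect_notMem hr hx)]

theorem theta_inner_part (hr : 0 < B.rho x) (hx : 0 < B.scale x) :
    B.theta lam (B.inner_part lam f) x = f x := by
  rw [theta, inner_part_reflect hr hx, smul_smul, weight_mul_weight_reflect hx, one_smul]

theorem theta_outer_part (hr : 0 < B.rho x) (hx : 0 < B.scale x) :
    B.theta lam (B.outer_part lam f) x = B.theta lam f x := by
  rw [theta, outer_part_reflect hr hx, theta]

theorem norm_theta : (fun x => ‖B.theta lam f x‖) = B.theta lam fun x => ‖f x‖ := by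
  ext x
  rw [theta, theta, norm_smul, Real.norm_of_nonneg (weight_nonneg x), smul_eq_mul]

theorem norm_inner_part :
    (fun x => ‖B.inner_part lam f x‖) = B.inner_part lam fun x => ‖f x‖ := by
  ext x
  simp only [inner_part]
  split_ifs
  · rfl
  · exact congrFun norm_theta x

theorem norm_outer_part :
    (fun x => ‖B.outer_part lam f x‖) = B.outer_part lam fun x => ‖f x‖ := by
  ext x
  simp only [outer_part]
  split_ifs
  · exact congrFun norm_theta x
  · rfl

theorem map_inner_part (L : V →ₗ[ℝ] ℝ) :
    (fun x => L (B.inner_part lam f x)) = B.inner_part lam fun x => L (f x) := by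
  ext x
  simp only [inner_part, theta]
  split_ifs
  · rfl
  · rw [map_smul]

theorem map_outer_part (L : V →ₗ[ℝ] ℝ) :
    (fun x => L (B.outer_part lam f x)) = B.outer_part lam fun x => L (f x) := by
  ext x
  simp only [outer_part, theta]
  split_ifs
  · rw [map_smul]
  · rfl

variable [NeZero N]

theorem aestronglyMeasurable_theta (hf : AEStronglyMeasurable f volume) :
    AEStronglyMeasurable (B.theta lam f) volume :=
  measurable_weight.aestronglyMeasurable.smul
    (hf.comp_quasiMeasurePreserving B.quasiMeasurePreserving_reflect)

theorem aestronglyMeasurable_inner_part (hf : AEStronglyMeasurable f volume) :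
    AEStronglyMeasurable (B.inner_part lam f) volume := by
  classical
  have : B.inner_part lam f = B.carrier.piecewise f (B.theta lam f) := by
    ext x; simp only [inner_part, Set.piecewise]
  rw [this]
  exact AEStronglyMeasurable.piecewise B.measurableSet_carrier hf.restrict
    (aestronglyMeasurable_theta hf).restrict

theorem aestronglyMeasurable_outer_part (hf : AEStronglyMeasurable f volume) :
    AEStronglyMeasurable (B.outer_part lam f) volume := by
  classical
  have : B.outer_part lam f = B.carrier.piecewise (B.theta lam f) f := by
    ext x; simp only [outer_part, Set.piecewise]
  rw [this]
  exact AEStronglyMeasurable.piecewise B.measurableSet_carrier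
    (aestronglyMeasurable_theta hf).restrict hf.restrict

theorem ae_vol_pos (B : BallOrHalfSpace N) : ∀ᵐ x ∂B.vol, 0 < B.rho x ∧ 0 < B.scale x :=
  B.ae_vol_rho_pos.and B.ae_vol_scale_pos

theorem inner_part_ae : B.inner_part lam f =ᵐ[B.vol] f := by
  filter_upwards [B.ae_vol_pos] with x hx using inner_part_apply hx.1

theorem theta_inner_part_ae : B.theta lam (B.inner_part lam f) =ᵐ[B.vol] f := by
  filter_upwards [B.ae_vol_pos] with x hx using theta_inner_part hx.1 hx.2

theorem outer_part_ae : B.outer_part lam f =ᵐ[B.vol] B.theta lam f := by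
  filter_upwards [B.ae_vol_pos] with x hx using outer_part_apply hx.1

theorem theta_outer_part_ae : B.theta lam (B.outer_part lam f) =ᵐ[B.vol] B.theta lam f := by
  filter_upwards [B.ae_vol_pos] with x hx using theta_outer_part hx.1 hx.2

/-- `f = Θ f` holds almost everywhere as soon as it holds almost everywhere on `B`. -/
theorem ae_eq_theta_of_ae_vol (h : f =ᵐ[B.vol] B.theta lam f) : f =ᵐ[volume] B.theta lam f := by
  refine B.ae_iff_ae_vol.2 ⟨h, ?_⟩
  filter_upwards [h, B.ae_vol_pos] with x hx hp
  rw [theta, B.reflect_reflect hp.2, hx, theta, smul_smul, mul_comm,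
    weight_mul_weight_reflect hp.2, one_smul]

end Parts

section Riesz

variable {F u w : EuclideanSpace ℝ (Fin N) → ℝ}

theorem Q_pos {x y : EuclideanSpace ℝ (Fin N)} (hx : 0 < B.rho x) (hy : 0 < B.rho y) :
    0 < B.Q x y := by
  unfold Q; positivity

theorem jac_mul_scale_rpow {x : EuclideanSpace ℝ (Fin N)} (hs : 0 < B.scale x) :
    B.jac x * B.scale x ^ (-lam) = B.weight lam x := by
  rw [weight_eq, jac, ← Real.rpow_natCast, ← Real.rpow_add hs]
  congr 1; push_cast; ring

/-- The integrand of the Riesz energy of a real function. -/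
noncomputable def rieszReal (lam : ℝ) (F : EuclideanSpace ℝ (Fin N) → ℝ)
    (p : EuclideanSpace ℝ (Fin N) × EuclideanSpace ℝ (Fin N)) : ℝ :=
  F p.1 * F p.2 * ‖p.1 - p.2‖ ^ (-lam)

theorem aestronglyMeasurable_rieszReal (hF : AEStronglyMeasurable F volume) :
    AEStronglyMeasurable (rieszReal lam F) volume := by
  have h2 : AEStronglyMeasurable
    (fun p : EuclideanSpace ℝ (Fin N) × EuclideanSpace ℝ (Fin N) => F p.1 * F p.2)
    (volume.prod volume) := hF.comp_fst.mul hF.comp_snd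
  exact h2.mul (Measurable.aestronglyMeasurable (by fun_prop))

theorem norm_sub_reflect_rpow {x y : EuclideanSpace ℝ (Fin N)} (hx : 0 < B.rho x)
    (hy : 0 < B.rho y) (hs : 0 < B.scale y) :
    ‖x - B.reflect y‖ ^ (-lam) = B.scale y ^ (-lam) * B.Q x y ^ (-lam / 2) := by
  have h1 : ‖x - B.reflect y‖ ^ (-lam) = (‖x - B.reflect y‖ ^ 2) ^ (-lam / 2) := by
    rw [← Real.rpow_natCast, ← Real.rpow_mul (norm_nonneg _)]
    congr 1; push_cast; ring
  rw [h1, B.norm_sub_reflect_sq x hs, Real.mul_rpow (by positivity) (Q_pos hx hy).le,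
    ← Real.rpow_natCast, ← Real.rpow_mul hs.le]
  congr 2; push_cast; ring

/-- Polarization of the reflected form. -/
theorem integral_sub_sub_kernel
    {k : EuclideanSpace ℝ (Fin N) → EuclideanSpace ℝ (Fin N) → ℝ}
    (huu : Integrable (fun p : _ × _ => u p.1 * u p.2 * k p.1 p.2) (B.vol.prod B.vol))
    (huw : Integrable (fun p : _ × _ => u p.1 * w p.2 * k p.1 p.2) (B.vol.prod B.vol))
    (hwu : Integrable (fun p : _ × _ => w p.1 * u p.2 * k p.1 p.2) (B.vol.prod B.vol))
    (hww : Integrable (fun p : _ × _ => w p.1 * w p.2 * k p.1 p.2) (B.vol.prod B.vol)) :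
    Integrable (fun p : _ × _ => (u p.1 - w p.1) * (u p.2 - w p.2) * k p.1 p.2)
        (B.vol.prod B.vol) ∧
      ∫ p, (u p.1 - w p.1) * (u p.2 - w p.2) * k p.1 p.2 ∂(B.vol.prod B.vol) =
        (∫ p, u p.1 * u p.2 * k p.1 p.2 ∂(B.vol.prod B.vol) +
          ∫ p, w p.1 * w p.2 * k p.1 p.2 ∂(B.vol.prod B.vol)) -
        (∫ p, u p.1 * w p.2 * k p.1 p.2 ∂(B.vol.prod B.vol) +
          ∫ p, w p.1 * u p.2 * k p.1 p.2 ∂(B.vol.prod B.vol)) := by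
  have e : ∀ p : EuclideanSpace ℝ (Fin N) × EuclideanSpace ℝ (Fin N),
      (u p.1 - w p.1) * (u p.2 - w p.2) * k p.1 p.2 =
        (u p.1 * u p.2 * k p.1 p.2 + w p.1 * w p.2 * k p.1 p.2) -
          (u p.1 * w p.2 * k p.1 p.2 + w p.1 * u p.2 * k p.1 p.2) := by
    intro p; ring
  simp_rw [e]
  refine ⟨(huu.add hww).sub (huw.add hwu), ?_⟩
  rw [← integral_add huu hww, ← integral_add huw hwu]
  exact integral_sub (huu.add hww) (huw.add hwu)

variable [NeZero N]

theorem ae_prod_pos (B : BallOrHalfSpace N) : ∀ᵐ p ∂(B.vol.prod B.vol),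
    (0 < B.rho p.1 ∧ 0 < B.scale p.1) ∧ 0 < B.rho p.2 ∧ 0 < B.scale p.2 :=
  (Measure.quasiMeasurePreserving_fst.ae B.ae_vol_pos).and
    (Measure.quasiMeasurePreserving_snd.ae B.ae_vol_pos)

/-- The diagonal is a null set. This matters because the kernels take the value of the convention
`0 ^ (-λ) = 0`, respectively `log 0 = 0`, on it. -/
theorem ae_prod_ne (B : BallOrHalfSpace N) : ∀ᵐ p ∂(B.vol.prod B.vol), p.1 ≠ p.2 := by
  have hm : MeasurableSet {p : EuclideanSpace ℝ (Fin N) × EuclideanSpace ℝ (Fin N) | p.1 ≠ p.2} :=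
    (measurableSet_eq_fun measurable_fst measurable_snd).compl
  have : Nontrivial (EuclideanSpace ℝ (Fin N)) := inferInstance
  refine (Measure.ae_prod_iff_ae_ae hm).2 (Eventually.of_forall fun x => ?_)
  filter_upwards [ae_restrict_of_ae (Measure.ae_ne volume x)] with y hy using hy.symm

/-- The energy integrand of `F` on the four blocks, pulled back to `B × B`. Here `u` is `F` on `B`, and
`w` is `Θ F` on `B`, which encodes `F` on the complement; the weight of `Θ` is just what makes all
powers of the scale cancel. -/
theorem rieszReal_pieces (hu : F =ᵐ[B.vol] u) (hw : B.theta lam F =ᵐ[B.vol] w) :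
    (rieszReal lam F =ᵐ[B.vol.prod B.vol] fun p => u p.1 * u p.2 * ‖p.1 - p.2‖ ^ (-lam)) ∧
    ((fun p => B.jac p.2 * rieszReal lam F (p.1, B.reflect p.2)) =ᵐ[B.vol.prod B.vol]
      fun p => u p.1 * w p.2 * B.Q p.1 p.2 ^ (-lam / 2)) ∧
    ((fun p => B.jac p.1 * rieszReal lam F (B.reflect p.1, p.2)) =ᵐ[B.vol.prod B.vol]
      fun p => w p.1 * u p.2 * B.Q p.1 p.2 ^ (-lam / 2)) ∧
    ((fun p => B.jac p.1 * B.jac p.2 * rieszReal lam F (B.reflect p.1, B.reflect p.2))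
      =ᵐ[B.vol.prod B.vol] fun p => w p.1 * w p.2 * ‖p.1 - p.2‖ ^ (-lam)) := by
  have hu1 := Measure.quasiMeasurePreserving_fst (μ := B.vol) (ν := B.vol) |>.ae hu
  have hu2 := Measure.quasiMeasurePreserving_snd (μ := B.vol) (ν := B.vol) |>.ae hu
  have hw1 := Measure.quasiMeasurePreserving_fst (μ := B.vol) (ν := B.vol) |>.ae hw
  have hw2 := Measure.quasiMeasurePreserving_snd (μ := B.vol) (ν := B.vol) |>.ae hw
  refine ⟨?_, ?_, ?_, ?_⟩
  · filter_upwards [hu1, hu2] with p h1 h2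
    rw [rieszReal, h1, h2]
  · filter_upwards [hu1, hw2, B.ae_prod_pos] with p h1 h2 hp
    rw [rieszReal, ← h1, ← h2, norm_sub_reflect_rpow hp.1.1 hp.2.1 hp.2.2, theta,
      ← jac_mul_scale_rpow hp.2.2, smul_eq_mul]
    ring
  · filter_upwards [hw1, hu2, B.ae_prod_pos] with p h1 h2 hp
    rw [rieszReal, ← h1, ← h2, norm_sub_rev, norm_sub_reflect_rpow hp.2.1 hp.1.1 hp.1.2, theta,
      ← jac_mul_scale_rpow hp.1.2, smul_eq_mul, B.Q_comm]
    ring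
  · filter_upwards [hw1, hw2, B.ae_prod_pos] with p h1 h2 hp
    rw [rieszReal, ← h1, ← h2, B.norm_reflect_sub_reflect hp.1.2 hp.2.2, theta, theta,
      ← jac_mul_scale_rpow hp.1.2, ← jac_mul_scale_rpow hp.2.2, smul_eq_mul, smul_eq_mul,
      Real.mul_rpow (mul_nonneg hp.1.2.le hp.2.2.le) (norm_nonneg _),
      Real.mul_rpow hp.1.2.le hp.2.2.le]
    ring

theorem integrable_rieszReal_iff (hF : AEStronglyMeasurable F volume) (hu : F =ᵐ[B.vol] u)
    (hw : B.theta lam F =ᵐ[B.vol] w) :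
    Integrable (rieszReal lam F) ↔
      (Integrable (fun p : _ × _ => u p.1 * u p.2 * ‖p.1 - p.2‖ ^ (-lam)) (B.vol.prod B.vol) ∧
        Integrable (fun p : _ × _ => u p.1 * w p.2 * B.Q p.1 p.2 ^ (-lam / 2))
          (B.vol.prod B.vol)) ∧
      (Integrable (fun p : _ × _ => w p.1 * u p.2 * B.Q p.1 p.2 ^ (-lam / 2))
          (B.vol.prod B.vol) ∧
        Integrable (fun p : _ × _ => w p.1 * w p.2 * ‖p.1 - p.2‖ ^ (-lam))
          (B.vol.prod B.vol)) := by
  obtain ⟨h1, h2, h3, h4⟩ := rieszReal_pieces hu hw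
  rw [B.integrable_prod_iff_vol (aestronglyMeasurable_rieszReal hF), integrable_congr h1,
    integrable_congr h2, integrable_congr h3, integrable_congr h4]

theorem integral_rieszReal_eq (hF : Integrable (rieszReal lam F)) (hu : F =ᵐ[B.vol] u)
    (hw : B.theta lam F =ᵐ[B.vol] w) :
    ∫ p, rieszReal lam F p =
      (∫ p, u p.1 * u p.2 * ‖p.1 - p.2‖ ^ (-lam) ∂(B.vol.prod B.vol) +
        ∫ p, u p.1 * w p.2 * B.Q p.1 p.2 ^ (-lam / 2) ∂(B.vol.prod B.vol)) +
      (∫ p, w p.1 * u p.2 * B.Q p.1 p.2 ^ (-lam / 2) ∂(B.vol.prod B.vol) +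
        ∫ p, w p.1 * w p.2 * ‖p.1 - p.2‖ ^ (-lam) ∂(B.vol.prod B.vol)) := by
  obtain ⟨h1, h2, h3, h4⟩ := rieszReal_pieces hu hw
  rw [B.integral_prod_eq_vol hF, integral_congr_ae h1, integral_congr_ae h2,
    integral_congr_ae h3, integral_congr_ae h4]

/-- The reflected kernel is dominated by the Riesz kernel on `B`. -/
theorem integrable_kernel_of_integrable_riesz (hlam : 0 < lam) (hu : AEStronglyMeasurable u B.vol)
    (h : Integrable (fun p : _ × _ => u p.1 * u p.2 * ‖p.1 - p.2‖ ^ (-lam))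
      (B.vol.prod B.vol)) :
    Integrable (fun p : _ × _ => u p.1 * u p.2 * B.Q p.1 p.2 ^ (-lam / 2))
      (B.vol.prod B.vol) := by
  have hQ := measurable_Q B
  refine h.mono ((hu.comp_fst.mul hu.comp_snd).mul
    (Measurable.aestronglyMeasurable (by fun_prop))) ?_
  filter_upwards [B.ae_prod_pos, B.ae_prod_ne] with p hp hne
  have h0 : 0 < ‖p.1 - p.2‖ := norm_pos_iff.2 (sub_ne_zero.2 hne)
  have hQ0 := Q_pos hp.1.1 hp.2.1
  rw [norm_mul _ (_ ^ _), norm_mul _ (_ ^ _), Real.norm_of_nonneg (Real.rpow_nonneg hQ0.le _),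
    Real.norm_of_nonneg (Real.rpow_nonneg (norm_nonneg _) _)]
  refine mul_le_mul_of_nonneg_left ?_ (norm_nonneg _)
  have h1 : ‖p.1 - p.2‖ ^ (-lam) = (‖p.1 - p.2‖ ^ 2) ^ (-lam / 2) := by
    rw [← Real.rpow_natCast, ← Real.rpow_mul (norm_nonneg _)]
    congr 1; push_cast; ring
  rw [h1]
  refine Real.rpow_le_rpow_of_nonpos (by positivity) ?_ (by linarith)
  unfold Q
  have := mul_pos hp.1.1 hp.2.1
  linarith

end Riesz

end ReflPos.BallOrHalfSpace

namespace ReflPos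

open BallOrHalfSpace

variable {N : ℕ} [NeZero N] {lam : ℝ} {B : BallOrHalfSpace N}

theorem integrable_rieszReal (h0 : 0 < lam) (hlam : lam < N) {f : EuclideanSpace ℝ (Fin N) → ℝ}
    (hf : MemLp f (ENNReal.ofReal (2 * (N : ℝ) / (2 * (N : ℝ) - lam))) volume) :
    Integrable (rieszReal lam f) ∧ Integrable (rieszReal lam (B.inner_part lam f)) ∧
      Integrable (rieszReal lam (B.outer_part lam f)) := by
  have hm := hf.1
  have hI : Integrable (rieszReal lam f) := by
    refine (integrable_hls_diag h0 hlam hf).mono (aestronglyMeasurable_rieszReal hm)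
      (Filter.Eventually.of_forall fun p => le_of_eq ?_)
    simp only [rieszReal, norm_mul, Real.norm_eq_abs, abs_abs]
  obtain ⟨⟨h1, -⟩, -, h4⟩ := (integrable_rieszReal_iff (B := B) hm
    Filter.EventuallyEq.rfl Filter.EventuallyEq.rfl).1 hI
  have hu : AEStronglyMeasurable f B.vol := hm.restrict
  have hw : AEStronglyMeasurable (B.theta lam f) B.vol := (aestronglyMeasurable_theta hm).restrict
  have k1 := integrable_kernel_of_integrable_riesz h0 hu h1
  have k4 := integrable_kernel_of_integrable_riesz h0 hw h4
  exact ⟨hI, (integrable_rieszReal_iff (aestronglyMeasurable_inner_part hm) inner_part_ae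
      theta_inner_part_ae).2 ⟨⟨h1, k1⟩, k1, h1⟩,
    (integrable_rieszReal_iff (aestronglyMeasurable_outer_part hm) outer_part_ae
      theta_outer_part_ae).2 ⟨⟨h4, k4⟩, k4, h4⟩⟩

/-- The gain in energy under reflection is the reflected form of `f - Θ f`. -/
theorem rieszReal_gain (h0 : 0 < lam) (hlam : lam < N) {f : EuclideanSpace ℝ (Fin N) → ℝ}
    (hf : MemLp f (ENNReal.ofReal (2 * (N : ℝ) / (2 * (N : ℝ) - lam))) volume) :
    Integrable (fun p : _ × _ => (f p.1 - B.theta lam f p.1) * (f p.2 - B.theta lam f p.2) *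
        B.Q p.1 p.2 ^ (-lam / 2)) (B.vol.prod B.vol) ∧
      1 / 2 * ((∫ p, rieszReal lam (B.inner_part lam f) p) +
        ∫ p, rieszReal lam (B.outer_part lam f) p) - ∫ p, rieszReal lam f p =
      ∫ p, (f p.1 - B.theta lam f p.1) * (f p.2 - B.theta lam f p.2) *
        B.Q p.1 p.2 ^ (-lam / 2) ∂(B.vol.prod B.vol) := by
  have hm := hf.1
  obtain ⟨hI, hi, ho⟩ := integrable_rieszReal (B := B) h0 hlam hf
  obtain ⟨⟨h1, h2⟩, h3, h4⟩ := (integrable_rieszReal_iff (B := B) hm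
    Filter.EventuallyEq.rfl Filter.EventuallyEq.rfl).1 hI
  have k1 := integrable_kernel_of_integrable_riesz h0 hm.restrict h1
  have k4 := integrable_kernel_of_integrable_riesz h0 (aestronglyMeasurable_theta hm).restrict h4
  obtain ⟨hint, heq⟩ := integral_sub_sub_kernel (k := fun x y => B.Q x y ^ (-lam / 2)) k1 h2 h3 k4
  refine ⟨hint, ?_⟩
  rw [heq, integral_rieszReal_eq (B := B) hI Filter.EventuallyEq.rfl Filter.EventuallyEq.rfl,
    integral_rieszReal_eq hi inner_part_ae theta_inner_part_ae,
    integral_rieszReal_eq ho outer_part_ae theta_outer_part_ae]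
  ring

theorem rieszReal_le (h0 : 0 < lam) (hN : (N : ℝ) - 2 ≤ lam) (hlam : lam < N)
    {f : EuclideanSpace ℝ (Fin N) → ℝ}
    (hf : MemLp f (ENNReal.ofReal (2 * (N : ℝ) / (2 * (N : ℝ) - lam))) volume) :
    ∫ p, rieszReal lam f p ≤ 1 / 2 * ((∫ p, rieszReal lam (B.inner_part lam f) p) +
        ∫ p, rieszReal lam (B.outer_part lam f) p) := by
  obtain ⟨hint, heq⟩ := rieszReal_gain (B := B) h0 hlam hf
  have := reflectedRiesz_nonneg h0 hN (hf.1.sub (aestronglyMeasurable_theta hf.1)).restrict hint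
  simp only [Pi.sub_apply] at this
  linarith

theorem rieszReal_lt (h0 : 0 < lam) (hN : (N : ℝ) - 2 < lam) (hlam : lam < N)
    {f : EuclideanSpace ℝ (Fin N) → ℝ}
    (hf : MemLp f (ENNReal.ofReal (2 * (N : ℝ) / (2 * (N : ℝ) - lam))) volume)
    (hne : ¬ f =ᵐ[volume] B.theta lam f) :
    ∫ p, rieszReal lam f p < 1 / 2 * ((∫ p, rieszReal lam (B.inner_part lam f) p) +
        ∫ p, rieszReal lam (B.outer_part lam f) p) := by
  refine (rieszReal_le h0 hN.le hlam hf).lt_of_ne fun hc => hne (ae_eq_theta_of_ae_vol ?_)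
  obtain ⟨hint, heq⟩ := rieszReal_gain (B := B) h0 hlam hf
  have hm : AEStronglyMeasurable (fun x => f x - B.theta lam f x) B.vol :=
    (hf.1.sub (aestronglyMeasurable_theta hf.1)).restrict
  filter_upwards [riesz_ae_eq_zero_of_null h0 hN hm hint (by rw [← heq, hc]; ring)] with x hx
  exact sub_eq_zero.1 hx

end ReflPos

/-! ### The Riesz energy of complex functions -/

namespace ReflPos

open BallOrHalfSpace

variable {N : ℕ} {lam : ℝ} {g : EuclideanSpace ℝ (Fin N) → ℂ}

theorem rieszIntegrand_self_re (p : EuclideanSpace ℝ (Fin N) × EuclideanSpace ℝ (Fin N)) :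
    (rieszIntegrand lam g g p).re =
      rieszReal lam (fun x => (g x).re) p + rieszReal lam (fun x => (g x).im) p := by
  rw [rieszIntegrand, Complex.div_ofReal_re, rieszReal, rieszReal,
    Real.rpow_neg (norm_nonneg _)]
  simp only [Complex.mul_re, Complex.conj_re, Complex.conj_im]
  ring

theorem integrable_rieszIntegrand (hg : AEStronglyMeasurable g volume)
    (h : Integrable (rieszReal lam fun x => ‖g x‖)) : Integrable (rieszIntegrand lam g g) := by
  refine h.mono ?_ (Filter.Eventually.of_forall fun p => le_of_eq ?_)
  · have h1 : AEStronglyMeasurable (fun p : EuclideanSpace ℝ (Fin N) × EuclideanSpace ℝ (Fin N) =>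
        starRingEnd ℂ (g p.1)) (volume.prod volume) :=
      (Complex.continuous_conj.comp_aestronglyMeasurable hg).comp_fst
    have h2 : AEStronglyMeasurable (fun p : EuclideanSpace ℝ (Fin N) × EuclideanSpace ℝ (Fin N) =>
        (((‖p.1 - p.2‖ ^ lam : ℝ) : ℂ))⁻¹) (volume.prod volume) :=
      (by fun_prop : Measurable fun p : EuclideanSpace ℝ (Fin N) × EuclideanSpace ℝ (Fin N) =>
        (((‖p.1 - p.2‖ ^ lam : ℝ) : ℂ))⁻¹).aestronglyMeasurable
    refine ((h1.mul hg.comp_snd).mul h2).congr (Filter.Eventually.of_forall fun p => ?_)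
    simp only [Pi.mul_apply, rieszIntegrand, div_eq_mul_inv]
  · rw [rieszIntegrand, rieszReal, norm_div, norm_mul, RCLike.norm_conj, Complex.norm_real,
      Real.norm_of_nonneg (by positivity), Real.norm_of_nonneg (by positivity),
      Real.rpow_neg (norm_nonneg _), div_eq_mul_inv]

theorem rieszEnergy_im : (rieszEnergy lam g).im = 0 := by
  rw [← Complex.conj_eq_iff_im, rieszEnergy, rieszForm, ← integral_conj]
  have hs := integral_prod_swap (μ := (volume : Measure (EuclideanSpace ℝ (Fin N))))
    (ν := (volume : Measure (EuclideanSpace ℝ (Fin N)))) (rieszIntegrand lam g g)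
  rw [← Measure.volume_eq_prod] at hs
  rw [← hs]
  refine integral_congr_ae (Filter.Eventually.of_forall fun p => ?_)
  simp only [rieszIntegrand, map_div₀, map_mul, Complex.conj_conj, Complex.conj_ofReal,
    Prod.fst_swap, Prod.snd_swap]
  rw [norm_sub_rev, mul_comm]

theorem rieszEnergy_re (hg : Integrable (rieszIntegrand lam g g))
    (hre : Integrable (rieszReal lam fun x => (g x).re))
    (him : Integrable (rieszReal lam fun x => (g x).im)) :
    (rieszEnergy lam g).re =
      (∫ p, rieszReal lam (fun x => (g x).re) p) + ∫ p, rieszReal lam (fun x => (g x).im) p := by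
  have h := Complex.reCLM.integral_comp_comm hg
  simp only [Complex.reCLM_apply] at h
  rw [rieszEnergy, rieszForm, ← h, ← integral_add hre him]
  exact integral_congr_ae (Filter.Eventually.of_forall rieszIntegrand_self_re)

/-- Reflection positivity of the Riesz energy. -/
theorem riesz_reflection_positivity [NeZero N] (B : BallOrHalfSpace N) (h0 : 0 < lam)
    (hN : (N : ℝ) - 2 ≤ lam) (hlam : lam < N) {f : EuclideanSpace ℝ (Fin N) → ℂ}
    (hf : MemLp f (ENNReal.ofReal (2 * (N : ℝ) / (2 * (N : ℝ) - lam))) volume) :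
    (∀ g ∈ ({f, B.inner_part lam f, B.outer_part lam f} : Set (EuclideanSpace ℝ (Fin N) → ℂ)),
      Integrable (rieszIntegrand lam g g) volume ∧ (rieszEnergy lam g).im = 0) ∧
    (rieszEnergy lam f).re ≤ 1 / 2 * ((rieszEnergy lam (B.inner_part lam f)).re +
      (rieszEnergy lam (B.outer_part lam f)).re) ∧
    ((N : ℝ) - 2 < lam → ¬ (f =ᵐ[volume] B.theta lam f) →
      (rieszEnergy lam f).re < 1 / 2 * ((rieszEnergy lam (B.inner_part lam f)).re +
        (rieszEnergy lam (B.outer_part lam f)).re)) := by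
  have hm := hf.1
  have hre : MemLp (fun x => (f x).re) _ volume := hf.re
  have him : MemLp (fun x => (f x).im) _ volume := hf.im
  obtain ⟨n1, n2, n3⟩ := integrable_rieszReal (B := B) h0 hlam hf.norm
  obtain ⟨r1, r2, r3⟩ := integrable_rieszReal (B := B) h0 hlam hre
  obtain ⟨i1, i2, i3⟩ := integrable_rieszReal (B := B) h0 hlam him
  rw [← norm_inner_part] at n2
  rw [← norm_outer_part] at n3
  have eri : B.inner_part lam (fun x => (f x).re) = fun x => (B.inner_part lam f x).re :=
    (map_inner_part Complex.reLm).symm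
  have ero : B.outer_part lam (fun x => (f x).re) = fun x => (B.outer_part lam f x).re :=
    (map_outer_part Complex.reLm).symm
  have eii : B.inner_part lam (fun x => (f x).im) = fun x => (B.inner_part lam f x).im :=
    (map_inner_part Complex.imLm).symm
  have eio : B.outer_part lam (fun x => (f x).im) = fun x => (B.outer_part lam f x).im :=
    (map_outer_part Complex.imLm).symm
  have j1 := integrable_rieszIntegrand hm n1
  have j2 := integrable_rieszIntegrand (aestronglyMeasurable_inner_part hm) n2
  have j3 := integrable_rieszIntegrand (aestronglyMeasurable_outer_part hm) n3
  have lr := rieszReal_le (B := B) h0 hN hlam hre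
  have li := rieszReal_le (B := B) h0 hN hlam him
  have E1 := rieszEnergy_re j1 r1 i1
  have E2 := rieszEnergy_re j2 (eri ▸ r2) (eii ▸ i2)
  have E3 := rieszEnergy_re j3 (ero ▸ r3) (eio ▸ i3)
  rw [← eri, ← eii] at E2
  rw [← ero, ← eio] at E3
  refine ⟨?_, ?_, fun hN' hne => ?_⟩
  · rintro g (rfl | rfl | rfl)
    · exact ⟨j1, rieszEnergy_im⟩
    · exact ⟨j2, rieszEnergy_im⟩
    · exact ⟨j3, rieszEnergy_im⟩
  · rw [E1, E2, E3]; linarith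
  · rw [E1, E2, E3]
    -- strictness holds as soon as it does for the real or for the imaginary part
    by_cases h : (fun x => (f x).re) =ᵐ[volume] B.theta lam fun x => (f x).re
    · have h' : ¬ (fun x => (f x).im) =ᵐ[volume] B.theta lam fun x => (f x).im := by
        intro h'
        refine hne ?_
        filter_upwards [h, h'] with x hx hx'
        refine Complex.ext ?_ ?_
        · rw [hx]; simp [theta]
        · rw [hx']; simp [theta]
      have := rieszReal_lt (B := B) h0 hN' hlam him h'
      linarith
    · have := rieszReal_lt (B := B) h0 hN' hlam hre h
      linarith

end ReflPos

/-! ### Functions of finite entropy -/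

namespace ReflPos

open BallOrHalfSpace Real

variable {N : ℕ} {f : EuclideanSpace ℝ (Fin N) → ℝ}

/-- The functions for which the logarithmic energy is considered: nonnegative, integrable, with
finite entropy relative to the weight of the stereographic projection. -/
structure LogClass (f : EuclideanSpace ℝ (Fin N) → ℝ) : Prop where
  nonneg : ∀ᵐ x, 0 ≤ f x
  integrable : Integrable f
  entropy : Integrable (fun x => f x * posLog (f x * ((1 + ‖x‖ ^ 2) / 2) ^ N))

theorem one_le_one_add_sq (x : EuclideanSpace ℝ (Fin N)) : 1 ≤ 1 + ‖x‖ ^ 2 := by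
  have := sq_nonneg ‖x‖; linarith

theorem integrable_one_add_norm_sq_rpow [NeZero N] :
    Integrable fun x : EuclideanSpace ℝ (Fin N) => (1 + ‖x‖ ^ 2) ^ (-(5 * (N : ℝ) / 8)) := by
  have hN : (0 : ℝ) < N := by exact_mod_cast NeZero.pos N
  have := integrable_rpow_neg_one_add_norm_sq (E := EuclideanSpace ℝ (Fin N)) (μ := volume)
    (r := 5 * (N : ℝ) / 4) (by simp; linarith)
  refine this.congr (Filter.Eventually.of_forall fun x => ?_)
  simp only
  congr 1; ring

/-- Where `f ≤ (1 + |x|²)^(-3N/4)` the integrand is dominated by a power of `1 + |x|²` which is still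
integrable; elsewhere the entropy density controls `(N/4) log (1 + |x|²)` up to a constant, so any
exponent strictly between `N/2` and `N` in place of `3N/4` would do. -/
theorem LogClass.integrable_mul_log [NeZero N] (h : LogClass f) :
    Integrable fun x => f x * log (1 + ‖x‖ ^ 2) := by
  have hN : (0 : ℝ) < N := by exact_mod_cast NeZero.pos N
  refine Integrable.mono' ((integrable_one_add_norm_sq_rpow.const_mul (8 / (N : ℝ))).add
    ((h.entropy.add (h.integrable.const_mul (N * log 2))).const_mul (4 / (N : ℝ))))
    (h.integrable.1.mul (Measurable.aestronglyMeasurable (by fun_prop))) ?_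
  filter_upwards [h.nonneg] with x hx
  have hD := one_le_one_add_sq x
  have hD0 : 0 < 1 + ‖x‖ ^ 2 := by linarith
  have hL : 0 ≤ log (1 + ‖x‖ ^ 2) := log_nonneg hD
  have hp : 0 ≤ posLog (f x * ((1 + ‖x‖ ^ 2) / 2) ^ N) := posLog_nonneg
  have hl2 : 0 ≤ log 2 := log_nonneg (by norm_num)
  rw [Real.norm_of_nonneg (mul_nonneg hx hL)]
  simp only [Pi.add_apply]
  rcases le_total (f x) ((1 + ‖x‖ ^ 2) ^ (-(3 * (N : ℝ) / 4))) with hc | hc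
  · have h1 : f x * log (1 + ‖x‖ ^ 2) ≤ 8 / (N : ℝ) * (1 + ‖x‖ ^ 2) ^ (-(5 * (N : ℝ) / 8)) := by
      have h2 := log_le_rpow_div hD0.le (by positivity : (0 : ℝ) < N / 8)
      calc f x * log (1 + ‖x‖ ^ 2) ≤ (1 + ‖x‖ ^ 2) ^ (-(3 * (N : ℝ) / 4)) *
            ((1 + ‖x‖ ^ 2) ^ ((N : ℝ) / 8) / (N / 8)) := by gcongr
        _ = 8 / (N : ℝ) * ((1 + ‖x‖ ^ 2) ^ (-(3 * (N : ℝ) / 4)) *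
            (1 + ‖x‖ ^ 2) ^ ((N : ℝ) / 8)) := by field_simp
        _ = _ := by
          rw [← rpow_add hD0]; congr 2; ring
    have : 0 ≤ 4 / (N : ℝ) * (f x * posLog (f x * ((1 + ‖x‖ ^ 2) / 2) ^ N) +
      N * log 2 * f x) := by positivity
    linarith
  · have hf0 : 0 < f x := (rpow_pos_of_pos hD0 _).trans_le hc
    have h1 : N / 4 * log (1 + ‖x‖ ^ 2) - N * log 2 ≤
        posLog (f x * ((1 + ‖x‖ ^ 2) / 2) ^ N) := by
      refine le_trans ?_ (le_max_right 0 _)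
      rw [log_mul hf0.ne' (by positivity), log_pow, log_div hD0.ne' (by norm_num)]
      have h2 := log_le_log (rpow_pos_of_pos hD0 _) hc
      rw [log_rpow hD0] at h2
      nlinarith
    have h3 : 0 ≤ 8 / (N : ℝ) * (1 + ‖x‖ ^ 2) ^ (-(5 * (N : ℝ) / 8)) := by positivity
    have h4 : f x * log (1 + ‖x‖ ^ 2) ≤ 4 / (N : ℝ) *
        (f x * posLog (f x * ((1 + ‖x‖ ^ 2) / 2) ^ N) + N * log 2 * f x) := by
      rw [div_mul_eq_mul_div, le_div_iff₀ hN]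
      nlinarith [mul_le_mul_of_nonneg_left h1 hf0.le]
    linarith

/-- Large values of `f` are controlled by the entropy density, small ones are split at the threshold
`(1 + |x|²)^(-3N/4)` again: below it `|log f| ≤ 6 f^(-1/6)`, and above it `|log f|` is at most
`(3N/4) log (1 + |x|²)`. -/
theorem LogClass.integrable_mul_log_self [NeZero N] (h : LogClass f) :
    Integrable fun x => f x * log (f x) := by
  have hN : (0 : ℝ) < N := by exact_mod_cast NeZero.pos N
  have hm : AEStronglyMeasurable (fun x => f x * log (f x)) volume :=
    h.integrable.1.mul (measurable_log.comp_aemeasurable h.integrable.1.aemeasurable).aestronglyMeasurable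
  refine Integrable.mono' ((integrable_one_add_norm_sq_rpow.const_mul 6).add
    ((h.entropy.add (h.integrable.const_mul (N * log 2))).add
      (h.integrable_mul_log.const_mul (3 * (N : ℝ) / 4)))) hm ?_
  filter_upwards [h.nonneg] with x hx
  have hD := one_le_one_add_sq x
  have hD0 : 0 < 1 + ‖x‖ ^ 2 := by linarith
  have hL : 0 ≤ log (1 + ‖x‖ ^ 2) := log_nonneg hD
  have hp : 0 ≤ posLog (f x * ((1 + ‖x‖ ^ 2) / 2) ^ N) := posLog_nonneg
  have hl2 : 0 ≤ log 2 := log_nonneg (by norm_num)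
  have t1 : 0 ≤ 6 * (1 + ‖x‖ ^ 2) ^ (-(5 * (N : ℝ) / 8)) := by positivity
  have t2 : 0 ≤ f x * posLog (f x * ((1 + ‖x‖ ^ 2) / 2) ^ N) + N * log 2 * f x := by positivity
  have t3 : 0 ≤ 3 * (N : ℝ) / 4 * (f x * log (1 + ‖x‖ ^ 2)) := by positivity
  simp only [Pi.add_apply]
  rcases hx.eq_or_lt with h0 | h0
  · rw [← h0, zero_mul, norm_zero]
    rw [← h0] at t2 t3
    linarith
  rw [norm_eq_abs]
  rcases le_total 1 (f x) with hc | hc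
  · have h1 : log (f x) ≤ posLog (f x * ((1 + ‖x‖ ^ 2) / 2) ^ N) + N * log 2 := by
      have h2 : log (f x * ((1 + ‖x‖ ^ 2) / 2) ^ N) ≤ posLog (f x * ((1 + ‖x‖ ^ 2) / 2) ^ N) :=
        le_max_right 0 _
      rw [log_mul h0.ne' (by positivity), log_pow, log_div hD0.ne' (by norm_num)] at h2
      nlinarith
    rw [abs_of_nonneg (mul_nonneg hx (log_nonneg hc))]
    nlinarith [mul_le_mul_of_nonneg_left h1 hx]
  · have hlog : log (f x) ≤ 0 := log_nonpos hx hc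
    rcases le_total (f x) ((1 + ‖x‖ ^ 2) ^ (-(3 * (N : ℝ) / 4))) with hd | hd
    · have h1 := abs_log_mul_self_rpow_lt (f x) (1 / 6) h0 hc (by norm_num)
      rw [abs_mul, abs_of_nonneg (rpow_nonneg hx _)] at h1
      have h2 : |f x * log (f x)| ≤ 6 * (1 + ‖x‖ ^ 2) ^ (-(5 * (N : ℝ) / 8)) := by
        have e : f x = f x ^ (5 / 6 : ℝ) * f x ^ (1 / 6 : ℝ) := by
          rw [← rpow_add h0]; norm_num
        rw [abs_mul, abs_of_pos h0]
        calc f x * |log (f x)| = f x ^ (5 / 6 : ℝ) * (|log (f x)| * f x ^ (1 / 6 : ℝ)) := by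
              nth_rewrite 1 [e]; ring
          _ ≤ ((1 + ‖x‖ ^ 2) ^ (-(3 * (N : ℝ) / 4))) ^ (5 / 6 : ℝ) * (1 / (1 / 6)) := by
              gcongr
          _ = _ := by
              rw [← rpow_mul hD0.le, mul_comm]
              congr 1
              · norm_num
              · congr 1; ring
      linarith
    · have h2 := log_le_log (rpow_pos_of_pos hD0 _) hd
      rw [log_rpow hD0] at h2
      rw [abs_of_nonpos (mul_nonpos_of_nonneg_of_nonpos hx hlog)]
      nlinarith [mul_le_mul_of_nonneg_left h2 hx]

/-- Young's inequality for the conjugate pair `s log s - s`, `exp t`. -/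
theorem mul_le_mul_log_add_exp {s : ℝ} (hs : 0 ≤ s) (t : ℝ) : s * t ≤ |s * log s| + exp t := by
  rcases hs.eq_or_lt with h | h
  · rw [← h]; simp [(exp_pos t).le]
  · have h1 := add_one_le_exp (t - log s)
    rw [exp_sub, exp_log h, le_div_iff₀ h] at h1
    nlinarith [le_abs_self (s * log s)]

/-- At large distances the logarithm is split between the two points; at short distances Young's
inequality trades it for the entropy and the integrable singularity `|x - y|^(-N/2)`. -/
theorem abs_log_norm_le [NeZero N] {s : ℝ} (hs : 0 ≤ s) (x y : EuclideanSpace ℝ (Fin N)) :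
    s * |log ‖x - y‖| ≤ s * (log 2 + log (1 + ‖x‖ ^ 2) + log (1 + ‖y‖ ^ 2)) +
      2 / (N : ℝ) * (|s * log s| + hlsProfile N (N / 2) (x - y)) := by
  have hN : (0 : ℝ) < N := by exact_mod_cast NeZero.pos N
  have hx := one_le_one_add_sq x
  have hy := one_le_one_add_sq y
  have lx := log_nonneg hx
  have ly := log_nonneg hy
  have hl2 : 0 ≤ log 2 := log_nonneg (by norm_num)
  have hψ := hlsProfile_nonneg (N / 2 : ℝ) (x - y)
  have t1 : 0 ≤ s * (log 2 + log (1 + ‖x‖ ^ 2) + log (1 + ‖y‖ ^ 2)) := by positivity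
  have t2 : 0 ≤ 2 / (N : ℝ) * (|s * log s| + hlsProfile N (N / 2) (x - y)) := by positivity
  rcases (norm_nonneg (x - y)).eq_or_lt with h0 | h0
  · rw [← h0]; simp only [log_zero, abs_zero, mul_zero]; linarith
  rcases le_or_gt 1 ‖x - y‖ with h1 | h1
  · have h2 : ‖x - y‖ ^ 2 ≤ 2 * (1 + ‖x‖ ^ 2) * (1 + ‖y‖ ^ 2) := by
      have h3 := norm_sub_le x y
      nlinarith [sq_nonneg (‖x‖ - ‖y‖), mul_nonneg (sq_nonneg ‖x‖) (sq_nonneg ‖y‖),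
        norm_nonneg (x - y), norm_nonneg x, norm_nonneg y]
    have h3 := log_le_log (by positivity) h2
    rw [log_pow, log_mul (by positivity) (by positivity), log_mul (by norm_num) (by positivity)]
      at h3
    have h4 := log_nonneg h1
    push_cast at h3
    rw [abs_of_nonneg h4]
    have h5 : log ‖x - y‖ ≤ log 2 + log (1 + ‖x‖ ^ 2) + log (1 + ‖y‖ ^ 2) := by linarith
    have := mul_le_mul_of_nonneg_left h5 hs
    linarith
  · have h2 : log ‖x - y‖ ≤ 0 := log_nonpos h0.le h1.le
    have h3 := mul_le_mul_log_add_exp hs (-(N / 2 : ℝ) * log ‖x - y‖)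
    have h4 : exp (-(N / 2 : ℝ) * log ‖x - y‖) = hlsProfile N (N / 2) (x - y) := by
      rw [hlsProfile, if_pos h1, rpow_def_of_pos h0, mul_comm]
    rw [h4] at h3
    rw [abs_of_nonpos h2]
    have h5 : s * -log ‖x - y‖ ≤ 2 / (N : ℝ) * (|s * log s| + hlsProfile N (N / 2) (x - y)) := by
      rw [div_mul_eq_mul_div, le_div_iff₀ hN]
      linarith
    linarith

theorem LogClass.integrable_logIntegrand [NeZero N] (h : LogClass f) :
    Integrable (logIntegrand f f) := by
  have hN : (0 : ℝ) < N := by exact_mod_cast NeZero.pos N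
  have i1 := h.integrable
  have i2 := h.integrable_mul_log
  have i3 := h.integrable_mul_log_self.abs
  have iψ : Integrable (fun p : EuclideanSpace ℝ (Fin N) × EuclideanSpace ℝ (Fin N) =>
      f p.2 * hlsProfile N (N / 2) (p.1 - p.2)) (volume.prod volume) := by
    have hψ := integrable_hlsProfile (N := N) (lam := N / 2) (by linarith)
    have := i1.convolution_integrand (ContinuousLinearMap.mul ℝ ℝ) hψ
    simpa using this
  have j1 : Integrable (fun p : EuclideanSpace ℝ (Fin N) × EuclideanSpace ℝ (Fin N) =>
      log 2 * (f p.1 * f p.2) + (f p.1 * log (1 + ‖p.1‖ ^ 2)) * f p.2 +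
        f p.1 * (f p.2 * log (1 + ‖p.2‖ ^ 2)) + 2 / (N : ℝ) * (|f p.1 * log (f p.1)| * f p.2 +
          f p.2 * hlsProfile N (N / 2) (p.1 - p.2))) (volume.prod volume) :=
    ((((i1.mul_prod i1).const_mul _).add (i2.mul_prod i1)).add (i1.mul_prod i2)).add
      (((i3.mul_prod i1).add iψ).const_mul _)
  rw [Measure.volume_eq_prod]
  refine j1.mono' ?_ ?_
  · have h2 : AEStronglyMeasurable
      (fun p : EuclideanSpace ℝ (Fin N) × EuclideanSpace ℝ (Fin N) => f p.1)
      (volume.prod volume) := i1.1.comp_fst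
    exact (h2.mul (Measurable.aestronglyMeasurable (by fun_prop))).mul i1.1.comp_snd
  · filter_upwards [Measure.quasiMeasurePreserving_fst.ae h.nonneg,
      Measure.quasiMeasurePreserving_snd.ae h.nonneg] with p h1 h2
    rw [logIntegrand, one_div, log_inv, norm_mul, norm_mul, norm_neg, Real.norm_of_nonneg h1,
      Real.norm_of_nonneg h2, norm_eq_abs]
    have := mul_le_mul_of_nonneg_right (abs_log_norm_le h1 p.1 p.2) h2
    linarith

end ReflPos

/-! ### Logarithmic energy in terms of the data on `B` -/

namespace ReflPos

open BallOrHalfSpace Real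

variable {N : ℕ} {B : BallOrHalfSpace N}

theorem weight_zero (x : EuclideanSpace ℝ (Fin N)) : B.weight 0 x = B.jac x := by
  rw [weight_eq, jac, sub_zero, ← rpow_natCast]
  push_cast; rfl

theorem jac_mul_jac_reflect {x : EuclideanSpace ℝ (Fin N)} (hx : 0 < B.scale x) :
    B.jac x * B.jac (B.reflect x) = 1 := by
  rw [← weight_zero, ← weight_zero, weight_mul_weight_reflect hx]

/-- The reflection changes the factor `1 + |x|²` of the stereographic projection by no more than `scale²`
and a constant. -/
theorem one_add_norm_reflect_sq_le (B : BallOrHalfSpace N) : ∃ C : ℝ, 0 < C ∧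
    ∀ x, 0 < B.scale x → 1 + ‖B.reflect x‖ ^ 2 ≤ C * B.scale x ^ 2 * (1 + ‖x‖ ^ 2) := by
  cases B with
  | ball a r hr =>
    refine ⟨((1 + 2 * ‖a‖ ^ 2) * (2 + 2 * ‖a‖ ^ 2) + 2 * r ^ 4) / r ^ 2, by positivity,
      fun x hx => ?_⟩
    have hz := scale_pos_ball hx
    have h1 : ‖(ball a r hr).reflect x‖ ≤ r ^ 2 / ‖x - a‖ + ‖a‖ := by
      refine (norm_add_le _ _).trans ?_
      rw [norm_smul, Real.norm_of_nonneg (by positivity)]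
      refine le_of_eq ?_
      field_simp
    have h2 : ‖(ball a r hr).reflect x‖ ^ 2 ≤ 2 * (r ^ 2 / ‖x - a‖) ^ 2 + 2 * ‖a‖ ^ 2 := by
      have : ‖(ball a r hr).reflect x‖ ^ 2 ≤ (r ^ 2 / ‖x - a‖ + ‖a‖) ^ 2 := by gcongr
      nlinarith [sq_nonneg (r ^ 2 / ‖x - a‖ - ‖a‖)]
    have h3 : ‖x - a‖ ^ 2 ≤ (2 + 2 * ‖a‖ ^ 2) * (1 + ‖x‖ ^ 2) := by
      have h4 := norm_sub_le x a
      have h5 : ‖x - a‖ ^ 2 ≤ (‖x‖ + ‖a‖) ^ 2 := by gcongr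
      nlinarith [sq_nonneg (‖x‖ - ‖a‖), mul_nonneg (sq_nonneg ‖x‖) (sq_nonneg ‖a‖)]
    have e : (((1 + 2 * ‖a‖ ^ 2) * (2 + 2 * ‖a‖ ^ 2) + 2 * r ^ 4) / r ^ 2) *
        (ball a r hr).scale x ^ 2 * (1 + ‖x‖ ^ 2) =
        ((1 + 2 * ‖a‖ ^ 2) * ((2 + 2 * ‖a‖ ^ 2) * (1 + ‖x‖ ^ 2)) +
          2 * r ^ 4 * (1 + ‖x‖ ^ 2)) / ‖x - a‖ ^ 2 := by
      simp only [scale]; field_simp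
    rw [e, le_div_iff₀ (by positivity)]
    have h6 : (r ^ 2 / ‖x - a‖) ^ 2 * ‖x - a‖ ^ 2 = r ^ 4 := by field_simp
    have h7 := mul_le_mul_of_nonneg_right h2 (sq_nonneg ‖x - a‖)
    have h8 := mul_le_mul_of_nonneg_left h3 (by positivity : 0 ≤ 1 + 2 * ‖a‖ ^ 2)
    have h9 : 0 ≤ 2 * r ^ 4 * ‖x‖ ^ 2 := by positivity
    nlinarith
  | halfSpace e t he =>
    refine ⟨19 + 8 * t ^ 2, by positivity, fun x _ => ?_⟩
    have h0 := abs_real_inner_le_norm x e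
    rw [he, mul_one] at h0
    have h1 : ‖(halfSpace e t he).reflect x‖ ≤ 3 * ‖x‖ + 2 * |t| := by
      refine (norm_add_le _ _).trans ?_
      rw [norm_smul, he, mul_one, norm_eq_abs, abs_mul, abs_two]
      have := abs_sub t (inner ℝ x e)
      linarith
    have h2 : ‖(halfSpace e t he).reflect x‖ ^ 2 ≤ (3 * ‖x‖ + 2 * |t|) ^ 2 := by gcongr
    have h3 := sq_abs t
    simp only [scale, one_pow, mul_one]
    nlinarith [sq_nonneg (3 * ‖x‖ - 2 * |t|), mul_nonneg (sq_nonneg t) (sq_nonneg ‖x‖),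
      sq_nonneg ‖x‖]

/-- The weight in the entropy condition transforms under the reflection like a density, up to constants.
This makes the class of functions of finite entropy invariant. -/
theorem jac_mul_entropy_weight_le (B : BallOrHalfSpace N) : ∃ C : ℝ, 0 < C ∧
    (∀ x, 0 < B.scale x → ((1 + ‖B.reflect x‖ ^ 2) / 2) ^ N ≤
      C * B.jac x * ((1 + ‖x‖ ^ 2) / 2) ^ N) ∧
    ∀ x, 0 < B.scale x → B.jac x * ((1 + ‖x‖ ^ 2) / 2) ^ N ≤
      C * ((1 + ‖B.reflect x‖ ^ 2) / 2) ^ N := by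
  obtain ⟨C, hC, h⟩ := one_add_norm_reflect_sq_le B
  have h1 : ∀ x, 0 < B.scale x → ((1 + ‖B.reflect x‖ ^ 2) / 2) ^ N ≤
      C ^ N * B.jac x * ((1 + ‖x‖ ^ 2) / 2) ^ N := by
    intro x hx
    have e : C ^ N * B.jac x * ((1 + ‖x‖ ^ 2) / 2) ^ N =
        (C * B.scale x ^ 2 * (1 + ‖x‖ ^ 2) / 2) ^ N := by
      rw [jac, pow_mul, ← mul_pow, ← mul_pow]
      congr 1; ring
    rw [e]
    have := h x hx
    gcongr
  refine ⟨C ^ N, by positivity, h1, fun x hx => ?_⟩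
  have h2 := h1 _ (B.scale_reflect_pos hx)
  rw [B.reflect_reflect hx] at h2
  refine (mul_le_mul_of_nonneg_left h2 (B.jac_nonneg x)).trans (le_of_eq ?_)
  have := jac_mul_jac_reflect hx
  linear_combination C ^ N * ((1 + ‖B.reflect x‖ ^ 2) / 2) ^ N * this

theorem posLog_le_of_le_mul {s s' C : ℝ} (hs : 0 ≤ s) (h : s ≤ C * s') :
    posLog s ≤ posLog C + posLog s' :=
  (posLog_le_posLog hs h).trans posLog_mul

theorem aestronglyMeasurable_entropy {g : EuclideanSpace ℝ (Fin N) → ℝ}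
    (hg : AEStronglyMeasurable g volume) :
    AEStronglyMeasurable (fun x => g x * posLog (g x * ((1 + ‖x‖ ^ 2) / 2) ^ N)) volume := by
  refine hg.mul (continuous_posLog.measurable.comp_aemeasurable (hg.mul ?_).aemeasurable).aestronglyMeasurable
  exact (by fun_prop : Measurable fun x : EuclideanSpace ℝ (Fin N) =>
    ((1 + ‖x‖ ^ 2) / 2) ^ N).aestronglyMeasurable

section Invariance

variable [NeZero N] {f : EuclideanSpace ℝ (Fin N) → ℝ}

/-- Reflecting the values on `B` to the complement preserves the class: the Jacobian in the operator `Θ`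
and the change of variables cancel, up to an additive constant in the logarithm. -/
theorem LogClass.inner_part (h : LogClass f) : LogClass (B.inner_part 0 f) := by
  have hm := aestronglyMeasurable_inner_part (B := B) (lam := 0) h.integrable.1
  have hf := (B.ae_iff_ae_vol.1 h.nonneg).1
  obtain ⟨C, hC, -, hC2⟩ := jac_mul_entropy_weight_le B
  have key : ∀ᵐ x ∂B.vol, 0 < B.scale x ∧ 0 ≤ f x ∧ B.inner_part 0 f x = f x ∧
      B.inner_part 0 f (B.reflect x) = B.jac (B.reflect x) * f x := by
    filter_upwards [B.ae_vol_pos, hf] with x hx h0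
    refine ⟨hx.2, h0, inner_part_apply hx.1, ?_⟩
    rw [inner_part_reflect hx.1 hx.2, weight_zero, smul_eq_mul]
  refine ⟨B.ae_iff_ae_vol.2 ⟨?_, ?_⟩, (B.integrable_iff_vol hm).2 ⟨?_, ?_⟩,
    (B.integrable_iff_vol (aestronglyMeasurable_entropy hm)).2 ⟨?_, ?_⟩⟩
  · filter_upwards [key] with x hx
    rw [hx.2.2.1]; exact hx.2.1
  · filter_upwards [key] with x hx
    rw [hx.2.2.2]; exact mul_nonneg (B.jac_nonneg _) hx.2.1
  · refine h.integrable.restrict.congr ?_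
    filter_upwards [key] with x hx using hx.2.2.1.symm
  · refine h.integrable.restrict.congr ?_
    filter_upwards [key] with x hx
    rw [hx.2.2.2, ← mul_assoc, jac_mul_jac_reflect hx.1, one_mul]
  · refine h.entropy.restrict.congr ?_
    filter_upwards [key] with x hx
    rw [hx.2.2.1]
  · have i1 : Integrable (fun x => f x * posLog (f x * ((1 + ‖x‖ ^ 2) / 2) ^ N) +
        f x * posLog C) B.vol :=
      h.entropy.restrict.add (h.integrable.restrict.mul_const _)
    refine i1.mono' ?_ ?_
    · have h1 := (aestronglyMeasurable_entropy hm).comp_quasiMeasurePreserving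
        B.quasiMeasurePreserving_reflect
      exact (B.measurable_jac.aestronglyMeasurable.mul h1).restrict
    · filter_upwards [key] with x hx
      obtain ⟨hs, h0, -, h2⟩ := hx
      have h3 := hC2 _ (B.scale_reflect_pos hs)
      rw [B.reflect_reflect hs] at h3
      have h4 : B.inner_part 0 f (B.reflect x) * ((1 + ‖B.reflect x‖ ^ 2) / 2) ^ N ≤
          C * (f x * ((1 + ‖x‖ ^ 2) / 2) ^ N) := by
        rw [h2]
        nlinarith [mul_le_mul_of_nonneg_left h3 h0]
      have h5 : 0 ≤ B.inner_part 0 f (B.reflect x) * ((1 + ‖B.reflect x‖ ^ 2) / 2) ^ N := by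
        rw [h2]
        have := B.jac_nonneg (B.reflect x)
        positivity
      have h6 := posLog_le_of_le_mul h5 h4
      have e : B.jac x * (B.inner_part 0 f (B.reflect x) *
          posLog (B.inner_part 0 f (B.reflect x) * ((1 + ‖B.reflect x‖ ^ 2) / 2) ^ N)) =
          f x * posLog (B.inner_part 0 f (B.reflect x) * ((1 + ‖B.reflect x‖ ^ 2) / 2) ^ N) := by
        nth_rewrite 1 [h2]
        rw [← mul_assoc, ← mul_assoc, jac_mul_jac_reflect hs, one_mul]
      rw [e, Real.norm_of_nonneg (mul_nonneg h0 posLog_nonneg)]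
      nlinarith [mul_le_mul_of_nonneg_left h6 h0]

theorem LogClass.outer_part (h : LogClass f) : LogClass (B.outer_part 0 f) := by
  have hm := aestronglyMeasurable_outer_part (B := B) (lam := 0) h.integrable.1
  have hf := (B.ae_iff_ae_vol.1 h.nonneg).2
  obtain ⟨-, iR⟩ := (B.integrable_iff_vol h.integrable.1).1 h.integrable
  obtain ⟨-, eR⟩ := (B.integrable_iff_vol (aestronglyMeasurable_entropy h.integrable.1)).1 h.entropy
  obtain ⟨C, hC, -, hC2⟩ := jac_mul_entropy_weight_le B
  have key : ∀ᵐ x ∂B.vol, 0 < B.scale x ∧ 0 ≤ f (B.reflect x) ∧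
      B.outer_part 0 f x = B.jac x * f (B.reflect x) ∧
      B.outer_part 0 f (B.reflect x) = f (B.reflect x) := by
    filter_upwards [B.ae_vol_pos, hf] with x hx h0
    refine ⟨hx.2, h0, ?_, outer_part_reflect hx.1 hx.2⟩
    rw [outer_part_apply hx.1, theta, weight_zero, smul_eq_mul]
  refine ⟨B.ae_iff_ae_vol.2 ⟨?_, ?_⟩, (B.integrable_iff_vol hm).2 ⟨?_, ?_⟩,
    (B.integrable_iff_vol (aestronglyMeasurable_entropy hm)).2 ⟨?_, ?_⟩⟩
  · filter_upwards [key] with x hx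
    rw [hx.2.2.1]; exact mul_nonneg (B.jac_nonneg _) hx.2.1
  · filter_upwards [key] with x hx
    rw [hx.2.2.2]; exact hx.2.1
  · refine iR.congr ?_
    filter_upwards [key] with x hx using hx.2.2.1.symm
  · refine iR.congr ?_
    filter_upwards [key] with x hx
    rw [hx.2.2.2]
  · refine (eR.add (iR.mul_const (posLog C))).mono' (aestronglyMeasurable_entropy hm).restrict ?_
    filter_upwards [key] with x hx
    obtain ⟨hs, h0, h1, -⟩ := hx
    have hj := B.jac_nonneg x
    have h4 : B.outer_part 0 f x * ((1 + ‖x‖ ^ 2) / 2) ^ N ≤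
        C * (f (B.reflect x) * ((1 + ‖B.reflect x‖ ^ 2) / 2) ^ N) := by
      rw [h1]
      nlinarith [mul_le_mul_of_nonneg_left (hC2 x hs) h0]
    have h5 : 0 ≤ B.outer_part 0 f x * ((1 + ‖x‖ ^ 2) / 2) ^ N := by
      rw [h1]; positivity
    have h6 := posLog_le_of_le_mul h5 h4
    have h7 : 0 ≤ B.outer_part 0 f x := by rw [h1]; positivity
    rw [Real.norm_of_nonneg (mul_nonneg h7 posLog_nonneg)]
    have h8 := mul_le_mul_of_nonneg_left h6 h7
    refine h8.trans (le_of_eq ?_)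
    simp only [Pi.add_apply]
    rw [h1]; ring
  · refine eR.congr ?_
    filter_upwards [key] with x hx
    rw [hx.2.2.2]

end Invariance

section Energy

variable [NeZero N] {F u w : EuclideanSpace ℝ (Fin N) → ℝ}

/-- The logarithmic analogue of `rieszReal_pieces`. The powers of the scale, which cancel for the Riesz
energy, leave terms with `log (scale)` behind. -/
theorem logIntegrand_pieces (hu : F =ᵐ[B.vol] u) (hw : B.theta 0 F =ᵐ[B.vol] w) :
    (logIntegrand F F =ᵐ[B.vol.prod B.vol]
      fun p => u p.1 * u p.2 * log (1 / ‖p.1 - p.2‖)) ∧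
    ((fun p => B.jac p.2 * logIntegrand F F (p.1, B.reflect p.2)) =ᵐ[B.vol.prod B.vol]
      fun p => u p.1 * w p.2 * (-(1 / 2) * log (B.Q p.1 p.2)) -
        u p.1 * (w p.2 * log (B.scale p.2))) ∧
    ((fun p => B.jac p.1 * logIntegrand F F (B.reflect p.1, p.2)) =ᵐ[B.vol.prod B.vol]
      fun p => w p.1 * u p.2 * (-(1 / 2) * log (B.Q p.1 p.2)) -
        w p.1 * log (B.scale p.1) * u p.2) ∧
    ((fun p => B.jac p.1 * B.jac p.2 * logIntegrand F F (B.reflect p.1, B.reflect p.2))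
      =ᵐ[B.vol.prod B.vol] fun p => w p.1 * w p.2 * log (1 / ‖p.1 - p.2‖) -
        (w p.1 * log (B.scale p.1) * w p.2 + w p.1 * (w p.2 * log (B.scale p.2)))) := by
  have hu1 := Measure.quasiMeasurePreserving_fst (μ := B.vol) (ν := B.vol) |>.ae hu
  have hu2 := Measure.quasiMeasurePreserving_snd (μ := B.vol) (ν := B.vol) |>.ae hu
  have hw1 := Measure.quasiMeasurePreserving_fst (μ := B.vol) (ν := B.vol) |>.ae hw
  have hw2 := Measure.quasiMeasurePreserving_snd (μ := B.vol) (ν := B.vol) |>.ae hw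
  have hlog : ∀ x y : EuclideanSpace ℝ (Fin N), 0 < B.rho x → 0 < B.rho y → 0 < B.scale y →
      log (1 / ‖x - B.reflect y‖) = -(1 / 2) * log (B.Q x y) - log (B.scale y) := by
    intro x y hx hy hs
    have h1 : log (‖x - B.reflect y‖ ^ 2) = 2 * log (B.scale y) + log (B.Q x y) := by
      rw [B.norm_sub_reflect_sq x hs, log_mul (pow_pos hs 2).ne' (Q_pos hx hy).ne', log_pow]
      push_cast; ring
    rw [log_pow] at h1
    push_cast at h1
    rw [one_div, log_inv]
    linarith
  refine ⟨?_, ?_, ?_, ?_⟩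
  · filter_upwards [hu1, hu2] with p h1 h2
    rw [logIntegrand, h1, h2]; ring
  · filter_upwards [hu1, hw2, B.ae_prod_pos] with p h1 h2 hp
    rw [logIntegrand, ← h1, ← h2, hlog _ _ hp.1.1 hp.2.1 hp.2.2, theta, weight_zero, smul_eq_mul]
    ring
  · filter_upwards [hw1, hu2, B.ae_prod_pos] with p h1 h2 hp
    rw [logIntegrand, ← h1, ← h2, norm_sub_rev, hlog _ _ hp.2.1 hp.1.1 hp.1.2, theta, weight_zero,
      smul_eq_mul, B.Q_comm]
    ring
  · filter_upwards [hw1, hw2, B.ae_prod_pos, B.ae_prod_ne] with p h1 h2 hp hne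
    have h0 : 0 < ‖p.1 - p.2‖ := norm_pos_iff.2 (sub_ne_zero.2 hne)
    rw [logIntegrand, ← h1, ← h2, B.norm_reflect_sub_reflect hp.1.2 hp.2.2, theta, theta,
      weight_zero, weight_zero, smul_eq_mul, smul_eq_mul, one_div, one_div, log_inv, log_inv,
      log_mul (mul_pos hp.1.2 hp.2.2).ne' h0.ne', log_mul hp.1.2.ne' hp.2.2.ne']
    ring

/-- The entropy integrand on `B` and on its complement. The term with `log (scale)` compensates those of
`logIntegrand_pieces`, up to the anomaly in `LogClass.logEnergy_eq`. -/
theorem entropy_pieces (hu : F =ᵐ[B.vol] u) (hw : B.theta 0 F =ᵐ[B.vol] w) :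
    ((fun x => F x * log (F x)) =ᵐ[B.vol] fun x => u x * log (u x)) ∧
    ((fun x => B.jac x * (F (B.reflect x) * log (F (B.reflect x)))) =ᵐ[B.vol]
      fun x => w x * log (w x) - 2 * (N : ℝ) * (w x * log (B.scale x))) := by
  constructor
  · filter_upwards [hu] with x hx
    rw [hx]
  · filter_upwards [hw, B.ae_vol_pos] with x hx hp
    rw [← hx, theta, weight_zero, smul_eq_mul]
    have hj : B.jac x ≠ 0 := (pow_pos hp.2 _).ne'
    by_cases h0 : F (B.reflect x) = 0
    · simp [h0]
    · rw [log_mul hj h0, jac, log_pow]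
      push_cast; ring

/-- What the finiteness of the logarithmic energy and of the entropy says on `B`. -/
theorem LogClass.integrable_pieces (h : LogClass F) (hu : F =ᵐ[B.vol] u)
    (hw : B.theta 0 F =ᵐ[B.vol] w) :
    (Integrable u B.vol ∧ Integrable w B.vol) ∧
    (Integrable (fun x => u x * log (u x)) B.vol ∧
      Integrable (fun x => w x * log (w x) - 2 * (N : ℝ) * (w x * log (B.scale x))) B.vol) ∧
    Integrable (fun p : _ × _ => u p.1 * u p.2 * log (1 / ‖p.1 - p.2‖)) (B.vol.prod B.vol) ∧
    Integrable (fun p : _ × _ => u p.1 * w p.2 * (-(1 / 2) * log (B.Q p.1 p.2)) -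
        u p.1 * (w p.2 * log (B.scale p.2))) (B.vol.prod B.vol) ∧
    Integrable (fun p : _ × _ => w p.1 * u p.2 * (-(1 / 2) * log (B.Q p.1 p.2)) -
        w p.1 * log (B.scale p.1) * u p.2) (B.vol.prod B.vol) := by
  obtain ⟨i1, i2⟩ := (B.integrable_iff_vol h.integrable.1).1 h.integrable
  have hS := h.integrable_mul_log_self
  obtain ⟨s1, s2⟩ := (B.integrable_iff_vol hS.1).1 hS
  have hI := h.integrable_logIntegrand
  obtain ⟨⟨l1, l2⟩, l3, -⟩ := (B.integrable_prod_iff_vol hI.1).1 hI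
  obtain ⟨e1, e2⟩ := entropy_pieces hu hw
  obtain ⟨k1, k2, k3, -⟩ := logIntegrand_pieces hu hw
  refine ⟨⟨i1.congr hu, i2.congr ?_⟩, ⟨s1.congr e1, s2.congr e2⟩, l1.congr k1, l2.congr k2,
    l3.congr k3⟩
  filter_upwards [hw] with x hx
  rw [← hx, theta, weight_zero, smul_eq_mul]

/-- The logarithmic energy in terms of data on `B`. The last term is an anomaly which vanishes for
the energies of interest. -/
theorem LogClass.logEnergy_eq (h : LogClass F) (hu : F =ᵐ[B.vol] u)
    (hw : B.theta 0 F =ᵐ[B.vol] w) (iu : Integrable u B.vol) (iw : Integrable w B.vol)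
    (hws : Integrable (fun x => w x * log (B.scale x)) B.vol)
    (hwl : Integrable (fun x => w x * log (w x)) B.vol)
    (huw : Integrable (fun p : _ × _ => u p.1 * w p.2 * (-(1 / 2) * log (B.Q p.1 p.2)))
      (B.vol.prod B.vol))
    (hwu : Integrable (fun p : _ × _ => w p.1 * u p.2 * (-(1 / 2) * log (B.Q p.1 p.2)))
      (B.vol.prod B.vol))
    (hww : Integrable (fun p : _ × _ => w p.1 * w p.2 * log (1 / ‖p.1 - p.2‖))
      (B.vol.prod B.vol)) :
    logEnergy F =
      ∫ p, u p.1 * u p.2 * log (1 / ‖p.1 - p.2‖) ∂(B.vol.prod B.vol) +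
      ∫ p, w p.1 * w p.2 * log (1 / ‖p.1 - p.2‖) ∂(B.vol.prod B.vol) +
      (∫ p, u p.1 * w p.2 * (-(1 / 2) * log (B.Q p.1 p.2)) ∂(B.vol.prod B.vol) +
      ∫ p, w p.1 * u p.2 * (-(1 / 2) * log (B.Q p.1 p.2)) ∂(B.vol.prod B.vol)) -
      1 / (N : ℝ) * (∫ x, u x * log (u x) ∂B.vol + ∫ x, w x * log (w x) ∂B.vol) +
      2 * ((1 - (∫ x, u x ∂B.vol + ∫ x, w x ∂B.vol)) * ∫ x, w x * log (B.scale x) ∂B.vol) := by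
  have hN : (N : ℝ) ≠ 0 := by exact_mod_cast NeZero.ne N
  obtain ⟨e1, e2⟩ := entropy_pieces hu hw
  obtain ⟨k1, k2, k3, k4⟩ := logIntegrand_pieces hu hw
  have m1 := iu.mul_prod hws
  have m2 := hws.mul_prod iu
  have m3 := hws.mul_prod iw
  have m4 := iw.mul_prod hws
  have m34 : Integrable (fun p : _ × _ => w p.1 * log (B.scale p.1) * w p.2 +
    w p.1 * (w p.2 * log (B.scale p.2))) (B.vol.prod B.vol) := m3.add m4
  rw [logEnergy, logForm, B.integral_prod_eq_vol h.integrable_logIntegrand,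
    B.integral_eq_vol h.integrable_mul_log_self, integral_congr_ae k1, integral_congr_ae k2,
    integral_congr_ae k3, integral_congr_ae k4, integral_congr_ae e1, integral_congr_ae e2,
    integral_sub huw m1, integral_sub hwu m2, integral_sub hww m34,
    integral_add m3 m4, integral_sub hwl (hws.const_mul _), integral_const_mul,
    integral_prod_mul u (fun x => w x * log (B.scale x)),
    integral_prod_mul (fun x => w x * log (B.scale x)) u,
    integral_prod_mul (fun x => w x * log (B.scale x)) w,
    integral_prod_mul w (fun x => w x * log (B.scale x))]
  field_simp
  ring

end Energy

end ReflPos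

/-! ### Reflection positivity of the logarithmic energy -/

namespace ReflPos

open BallOrHalfSpace Real

variable {N : ℕ} {B : BallOrHalfSpace N} {f : EuclideanSpace ℝ (Fin N) → ℝ}

/-- The anomaly vanishes: for a half-space the scale is one, for a ball the total mass is one. -/
theorem anomaly_eq_zero {m : ℝ} (hm : B.IsBall → m = 1) (v : EuclideanSpace ℝ (Fin N) → ℝ) :
    (1 - m) * ∫ x, v x * log (B.scale x) ∂B.vol = 0 := by
  cases B with
  | ball a r hr => rw [hm trivial, sub_self, zero_mul]
  | halfSpace e t he => simp [scale]

variable [NeZero N]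

/-- The gain in logarithmic energy under reflection is the reflected form of `f - Θ f`. -/
theorem LogClass.gain (h : LogClass f) (hmass : ∫ x in B.carrier, f x = ∫ x in B.carrierᶜ, f x)
    (hball : B.IsBall → ∫ x, f x = 1) :
    Integrable (fun x => f x - B.theta 0 f x) B.vol ∧
    ∫ x, (f x - B.theta 0 f x) ∂B.vol = 0 ∧
    Integrable (fun p : _ × _ => (f p.1 - B.theta 0 f p.1) * (f p.2 - B.theta 0 f p.2) *
        (-(1 / 2) * log (B.Q p.1 p.2))) (B.vol.prod B.vol) ∧
    1 / 2 * (logEnergy (B.inner_part 0 f) + logEnergy (B.outer_part 0 f)) - logEnergy f =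
      ∫ p, (f p.1 - B.theta 0 f p.1) * (f p.2 - B.theta 0 f p.2) *
        (-(1 / 2) * log (B.Q p.1 p.2)) ∂(B.vol.prod B.vol) := by
  have hN : (N : ℝ) ≠ 0 := by exact_mod_cast NeZero.ne N
  have hi := h.inner_part (B := B)
  have ho := h.outer_part (B := B)
  obtain ⟨⟨iu, iw⟩, -, -, luw, lwu⟩ := h.integrable_pieces (B := B)
    Filter.EventuallyEq.rfl Filter.EventuallyEq.rfl
  obtain ⟨-, ⟨su, su'⟩, auu, luu, -⟩ := hi.integrable_pieces inner_part_ae theta_inner_part_ae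
  obtain ⟨-, ⟨sw, sw'⟩, aww, lww, -⟩ := ho.integrable_pieces outer_part_ae theta_outer_part_ae
  set u := f with hu
  set w := B.theta 0 f with hw
  -- the entropies of `f^i` on `B` and off `B` differ by a multiple of this integrand
  have hus : Integrable (fun x => u x * log (B.scale x)) B.vol := by
    refine ((su.sub su').const_mul (2 * (N : ℝ))⁻¹).congr (Filter.Eventually.of_forall fun x => ?_)
    simp only [Pi.sub_apply]
    field_simp; ring
  have hws : Integrable (fun x => w x * log (B.scale x)) B.vol := by
    refine ((sw.sub sw').const_mul (2 * (N : ℝ))⁻¹).congr (Filter.Eventually.of_forall fun x => ?_)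
    simp only [Pi.sub_apply]
    field_simp; ring
  have kuu : Integrable (fun p : _ × _ => u p.1 * u p.2 * (-(1 / 2) * log (B.Q p.1 p.2)))
      (B.vol.prod B.vol) := by
    refine (luu.add (iu.mul_prod hus)).congr (Filter.Eventually.of_forall fun p => ?_)
    simp only [Pi.add_apply, sub_add_cancel]
  have kuw : Integrable (fun p : _ × _ => u p.1 * w p.2 * (-(1 / 2) * log (B.Q p.1 p.2)))
      (B.vol.prod B.vol) := by
    refine (luw.add (iu.mul_prod hws)).congr (Filter.Eventually.of_forall fun p => ?_)
    simp only [Pi.add_apply, sub_add_cancel]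
  have kwu : Integrable (fun p : _ × _ => w p.1 * u p.2 * (-(1 / 2) * log (B.Q p.1 p.2)))
      (B.vol.prod B.vol) := by
    refine (lwu.add (hws.mul_prod iu)).congr (Filter.Eventually.of_forall fun p => ?_)
    simp only [Pi.add_apply, sub_add_cancel]
  have kww : Integrable (fun p : _ × _ => w p.1 * w p.2 * (-(1 / 2) * log (B.Q p.1 p.2)))
      (B.vol.prod B.vol) := by
    refine (lww.add (iw.mul_prod hws)).congr (Filter.Eventually.of_forall fun p => ?_)
    simp only [Pi.add_apply, sub_add_cancel]
  have hwθ : ∀ x, w x = B.jac x * f (B.reflect x) := fun x => by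
    rw [hw, theta, weight_zero, smul_eq_mul]
  have mass_eq : ∫ x, u x ∂B.vol = ∫ x, w x ∂B.vol := by
    rw [B.setIntegral_compl h.integrable.1] at hmass
    simp_rw [hwθ]
    exact hmass
  have mass_total : ∫ x, f x = ∫ x, u x ∂B.vol + ∫ x, w x ∂B.vol := by
    rw [B.integral_eq_vol h.integrable]
    simp_rw [hwθ]
    rfl
  have hb : B.IsBall → ∫ x, u x ∂B.vol + ∫ x, w x ∂B.vol = 1 := fun hB => by
    rw [← mass_total, hball hB]
  have J := h.logEnergy_eq (B := B) (u := u) (w := w) Filter.EventuallyEq.rfl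
    Filter.EventuallyEq.rfl iu iw hws sw kuw kwu aww
  have Ji := hi.logEnergy_eq (u := u) (w := u) inner_part_ae theta_inner_part_ae iu iu hus su kuu
    kuu auu
  have Jo := ho.logEnergy_eq (u := w) (w := w) outer_part_ae theta_outer_part_ae iw iw hws sw kww
    kww aww
  rw [anomaly_eq_zero hb] at J
  rw [anomaly_eq_zero (fun hB => by have := hb hB; rw [← mass_eq] at this; exact this)] at Ji
  rw [anomaly_eq_zero (fun hB => by have := hb hB; rw [mass_eq] at this; exact this)] at Jo
  obtain ⟨hint, heq⟩ := integral_sub_sub_kernel (k := fun x y => -(1 / 2) * log (B.Q x y))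
    kuu kuw kwu kww
  refine ⟨iu.sub iw, ?_, hint, ?_⟩
  · rw [integral_sub iu iw, mass_eq, sub_self]
  · rw [heq, J, Ji, Jo]; ring

/-- Reflection positivity of the logarithmic energy. -/
theorem log_reflection_positivity (hN : (N : ℝ) - 2 ≤ 0) (h : LogClass f)
    (hmass : ∫ x in B.carrier, f x = ∫ x in B.carrierᶜ, f x)
    (hball : B.IsBall → ∫ x, f x = 1) :
    (∀ g ∈ ({f, B.inner_part 0 f, B.outer_part 0 f} : Set (EuclideanSpace ℝ (Fin N) → ℝ)),
      Integrable (logIntegrand g g) volume ∧ Integrable (fun x => g x * log (g x)) volume) ∧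
    logEnergy f ≤
      1 / 2 * (logEnergy (B.inner_part 0 f) + logEnergy (B.outer_part 0 f)) ∧
    ((N : ℝ) - 2 < 0 → ¬ (f =ᵐ[volume] B.theta 0 f) →
      logEnergy f <
        1 / 2 * (logEnergy (B.inner_part 0 f) + logEnergy (B.outer_part 0 f))) := by
  obtain ⟨i1, m0, hint, heq⟩ := h.gain hmass hball
  have hle := reflectedLog_nonneg hN i1 m0 hint
  refine ⟨?_, by linarith, fun hN' hne => ?_⟩
  · rintro g (rfl | rfl | rfl)
    · exact ⟨h.integrable_logIntegrand, h.integrable_mul_log_self⟩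
    · exact ⟨h.inner_part.integrable_logIntegrand, h.inner_part.integrable_mul_log_self⟩
    · exact ⟨h.outer_part.integrable_logIntegrand, h.outer_part.integrable_mul_log_self⟩
  · refine lt_of_le_of_ne (by linarith) fun hc => hne (ae_eq_theta_of_ae_vol ?_)
    filter_upwards [log_ae_eq_zero_of_null hN' i1 m0 hint (by rw [← heq, hc]; ring)] with x hx
    exact sub_eq_zero.1 hx

end ReflPos

theorem theorem2p3 (N : ℕ) (lam : ℝ)
    (hlam : (N = 1 ∧ 0 ≤ lam ∧ lam < 1) ∨ (2 ≤ N ∧ (N : ℝ) - 2 ≤ lam ∧ lam < N))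
    (B : ReflPos.BallOrHalfSpace N) :
    -- the case `lam > 0`
    (0 < lam →
      ∀ f : EuclideanSpace ℝ (Fin N) → ℂ,
        MemLp f (ENNReal.ofReal (2 * (N : ℝ) / (2 * (N : ℝ) - lam))) volume →
        -- all energies are absolutely convergent and real
        (∀ g ∈ ({f, B.inner_part lam f, B.outer_part lam f} :
              Set (EuclideanSpace ℝ (Fin N) → ℂ)),
            Integrable (ReflPos.rieszIntegrand lam g g) volume ∧
              (ReflPos.rieszEnergy lam g).im = 0) ∧
        (ReflPos.rieszEnergy lam f).re ≤
          1 / 2 * ((ReflPos.rieszEnergy lam (B.inner_part lam f)).re +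
            (ReflPos.rieszEnergy lam (B.outer_part lam f)).re) ∧
        ((N : ℝ) - 2 < lam → ¬ (f =ᵐ[volume] B.theta lam f) →
          (ReflPos.rieszEnergy lam f).re <
            1 / 2 * ((ReflPos.rieszEnergy lam (B.inner_part lam f)).re +
              (ReflPos.rieszEnergy lam (B.outer_part lam f)).re))) ∧
    -- the logarithmic case `lam = 0`
    (lam = 0 →
      ∀ f : EuclideanSpace ℝ (Fin N) → ℝ,
        MemLp f (ENNReal.ofReal (2 * (N : ℝ) / (2 * (N : ℝ) - lam))) volume →
        (∀ᵐ x, 0 ≤ f x) →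
        Integrable (fun x => f x * Real.posLog (f x * ((1 + ‖x‖ ^ 2) / 2) ^ N)) volume →
        ∫ x in B.carrier, f x = ∫ x in B.carrierᶜ, f x →
        (B.IsBall → ∫ x, f x = 1) →
        -- all integrals in `J` are absolutely convergent
        (∀ g ∈ ({f, B.inner_part lam f, B.outer_part lam f} :
              Set (EuclideanSpace ℝ (Fin N) → ℝ)),
            Integrable (ReflPos.logIntegrand g g) volume ∧
              Integrable (fun x => g x * Real.log (g x)) volume) ∧
        ReflPos.logEnergy f ≤
          1 / 2 * (ReflPos.logEnergy (B.inner_part lam f) +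
            ReflPos.logEnergy (B.outer_part lam f)) ∧
        ((N : ℝ) - 2 < lam → ¬ (f =ᵐ[volume] B.theta lam f) →
          ReflPos.logEnergy f <
            1 / 2 * (ReflPos.logEnergy (B.inner_part lam f) +
              ReflPos.logEnergy (B.outer_part lam f)))) := by
  have hN1 : 1 ≤ N := by omega
  have : NeZero N := ⟨by omega⟩
  have hlow : (N : ℝ) - 2 ≤ lam := by
    rcases hlam with ⟨rfl, h, -⟩ | ⟨-, h, -⟩
    · push_cast; linarith
    · exact h
  have hup : lam < N := by
    rcases hlam with ⟨rfl, -, h⟩ | ⟨-, -, h⟩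
    · push_cast; exact h
    · exact h
  refine ⟨fun h0 f hf => ReflPos.riesz_reflection_positivity B h0 hlow hup hf, ?_⟩
  rintro rfl f hf hnn hent hmass hball
  have hf1 : Integrable f := by
    rw [← memLp_one_iff_integrable]
    have : (N : ℝ) ≠ 0 := by exact_mod_cast NeZero.ne N
    rwa [sub_zero, div_self (by positivity), ENNReal.ofReal_one] at hf
  exact ReflPos.log_reflection_positivity hlow ⟨hnn, hf1, hent⟩ hmass hball
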